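/- **Setting.** Let $L^2=L^2[0,1]$ with inner product $\langle\cdot,\cdot\rangle$ and norm $\|\cdot\|$, and let $(\rho_j)_{j\ge1}$ be an orthonormal basis of $L^2$. Write $\mathcal S^p=\{\gamma\in\mathbb R^p:\|\gamma\|=1\}$ and identify $\gamma\in\mathbb R^p$ with $\sum_{j\le p}\gamma_j\rho_j\in L^2$. Fix $\gamma_0\in L^2\setminus\{0\}$ with coefficients $b_{0j}=\langle\gamma_0,\rho_j\rangle$, and put $\gamma_0^{(p)}=(b_{01},\dots,b_{0p})/\|(b_{01},\dots,b_{0p})\|$ whenever the denominator is not $0$. For each $p\ge1$ let $B_p\subset\mathcal S^p$. Let $K$ be a kernel, $h=h_n>0$ bandwidths, $p=p_n\ge1$ integers, $\alpha_n>0$, and let $F_{\gamma,n}$ be the empirical distribution function of $\langle X_1,\gamma\rangle,\dots,\langle X_n,\gamma\rangle$. With $K_{ij}(\gamma)=K\big(\{F_{\gamma,n}(\langle X_i,\gamma\rangle)-F_{\gamma,n}(\langle X_j,\gamma\rangle)\}/h\big)$ set $$Q_n(\gamma)=\frac1{n(n-1)}\sum_{1\le i\ne j\le n}\langle U_i,U_j\rangle\frac1hK_{ij}(\gamma),\qquad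 \widehat v_n^2(\gamma)=\frac{2}{n(n-1)h}\sum_{1\le i\neq j\le n}\langle U_i,U_j\rangle^2K_{ij}(\gamma)^2$$ (with $Q_n/\widehat v_n:=0$ where $\widehat v_n=0$, in which case $Q_n=0$ as well), $$\widehat\gamma_n\in\arg\max_{\gamma\in B_p}\Big[nh^{1/2}\frac{Q_n(\gamma)}{\widehat v_n(\gamma)}-\alpha_n\mathbb I_{\{\gamma\ne\gamma_0^{(p)}\}}\Big],\qquad T_n=nh^{1/2}\frac{Q_n(\widehat\gamma_n)}{\widehat v_n(\widehat\gamma_n)} .$$ **Alternatives.** Let $(U^0_i,X_i)$, $i\ge1$, be independent copies of a random element $(U^0,X)$ of $L^2\times L^2$ with $\mathbb E(U^0\mid X)=0$ a.s., let $\delta:L^2\to L^2$ be measurable, and let $(r_n)$ be real numbers that tend to $0$, or $r_n=1$ for all $n$. Under $H_{1n}$ the statistics are computed from $(U_i,X_i)$, $1\le i\le n$, with $U_i=U^0_i+r_n\delta(X_i)$. **Theorem.** Suppose that (a) $\mathbb E\|U^0\|^8<\infty$; for all $p\ge1$ and $\gamma\in\mathcal S^p$ the distribution function $F_\gamma$ of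 $\langle X,\gamma\rangle$ is continuous; there are $\underline\sigma^2,C_1,C_2>0$ and $\nu>2$ with $\mathbb E\big(\langle U^0_1,U^0_2\rangle^2\mathbf 1_{\{\langle U^0_1,U^0_2\rangle\le C_1\}}\mid X_1,X_2\big)\ge\underline\sigma^2$ and $\mathbb E[\|U^0\|^\nu\mid X]\le C_2$ a.s.; for every $p\ge1$, $B_p$ is open in $\mathcal S^p$, contains $\gamma_0^{(p)}$ whenever the latter is defined, and $B_p\times\{0_{p'-p}\}\subset B_{p'}$ for all $p'>p$; (b) $K$ is a continuous probability density on $\mathbb R$, symmetric, non-increasing on $[0,\infty)$ and Lipschitz; $h\to0$, $nh^2\to\infty$ and $nh^4\to\infty$; $p=p_n\to\infty$ and $p_n\ln^{-\lambda}n$ is bounded for some $\lambda>0$; (c) $\alpha_n/\{p_n\ln n\}\to\infty$ and $r_n^2nh^{1/2}/\alpha_n\to\infty$; (d) $\mathbb E[\delta(X)]=0$ and $0<\mathbb E\|\delta(X)\|^4<\infty$; (e) there are $q\ge1$ and $\widetilde\gamma\in B_q$, independent of $n$, such that $\mathbb E[\delta(X)\mid\langle X,\widetilde\gamma\rangle]$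 is not a.s. $0$, and such that, for a jointly measurable version of $\overline\delta(t,v)=\mathbb E[\delta(X)(t)\mid F_{\widetilde\gamma}(\langle X,\widetilde\gamma\rangle)=v]$, extended by $0$ to $v\notin[0,1]$, for every $t\in[0,1]$ the function $\overline\delta(t,\cdot)$ is integrable and has an integrable Fourier transform on $\mathbb R$. Then the test based on $T_n$ is consistent against the alternatives $H_{1n}$: for every $C\in\mathbb R$, $\mathbb P(T_n\ge C)\to1$ as $n\to\infty$, whatever the choice of the maximizers $\widehat\gamma_n$. -/

import Mathlib

open MeasureTheory ProbabilityTheory Filter Topology Set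
open scoped FourierTransform ENNReal

noncomputable section

namespace FunctionalTest

/-- The Hilbert space `L²[0,1]` of (classes of) real square-integrable functions. -/
abbrev L2 : Type := Lp ℝ 2 (volume.restrict (Icc (0 : ℝ) 1))

instance instMeasurableSpaceL2 : MeasurableSpace L2 := borel L2

instance instBorelSpaceL2 : BorelSpace L2 := ⟨rfl⟩

/-- The element `∑_{j ≤ p} γ_j ρ_j` of `L²[0,1]` identified with `γ ∈ ℝ^p`. -/
def toL2 (ρ : HilbertBasis ℕ ℝ L2) {p : ℕ} (γ : EuclideanSpace ℝ (Fin p)) : L2 :=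
  ∑ j : Fin p, γ j • ρ (j : ℕ)

/-- The vector of the first `p` coefficients of `w` in the basis `ρ`. -/
def coeffs (ρ : HilbertBasis ℕ ℝ L2) (p : ℕ) (w : L2) : EuclideanSpace ℝ (Fin p) :=
  WithLp.toLp 2 fun j : Fin p => inner ℝ w (ρ (j : ℕ))

/-- The normalized truncation `γ₀^{(p)}` of `γ₀` (meaningful when `coeffs ρ p γ₀ ≠ 0`). -/
def initialDir (ρ : HilbertBasis ℕ ℝ L2) (γ₀ : L2) (p : ℕ) : EuclideanSpace ℝ (Fin p) :=
  ‖coeffs ρ p γ₀‖⁻¹ • coeffs ρ p γ₀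

/-- The vector `(γ, 0, …, 0) ∈ ℝ^q` for `γ ∈ ℝ^p`, `p ≤ q`. -/
def zeroPad {p : ℕ} (q : ℕ) (γ : EuclideanSpace ℝ (Fin p)) : EuclideanSpace ℝ (Fin q) :=
  WithLp.toLp 2 fun j : Fin q => if hj : (j : ℕ) < p then γ ⟨j, hj⟩ else 0

/-- The distribution function of `⟨X, g⟩`. -/
def projCdf {Ω : Type*} [MeasurableSpace Ω] (P : Measure Ω) (X : Ω → L2) (g : L2) (t : ℝ) : ℝ :=
  P.real {ω | inner ℝ (X ω) g ≤ t}

/-- The empirical distribution function of `⟨x₀, g⟩, …, ⟨x_{n-1}, g⟩`. -/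
def empCdf (n : ℕ) (x : ℕ → L2) (g : L2) (t : ℝ) : ℝ :=
  (Set.ncard {k : ℕ | k < n ∧ inner ℝ (x k) g ≤ t} : ℝ) / n

/-- `K_h (F_{g,n}(⟨x_i, g⟩) - F_{g,n}(⟨x_j, g⟩))`. -/
def kernelWeight (K : ℝ → ℝ) (h : ℝ) (n : ℕ) (x : ℕ → L2) (g : L2) (i j : ℕ) : ℝ :=
  K ((empCdf n x g (inner ℝ (x i) g) - empCdf n x g (inner ℝ (x j) g)) / h)

/-- The statistic `Q_n`, for the sample `(u₀, x₀), …, (u_{n-1}, x_{n-1})`. -/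
def Qstat (K : ℝ → ℝ) (h : ℝ) (n : ℕ) (u x : ℕ → L2) (g : L2) : ℝ :=
  1 / ((n : ℝ) * ((n : ℝ) - 1)) *
    ∑ ij ∈ (Finset.range n).offDiag,
      inner ℝ (u ij.1) (u ij.2) * (1 / h) * kernelWeight K h n x g ij.1 ij.2

/-- The variance estimate `v̂_n²`. -/
def varStat (K : ℝ → ℝ) (h : ℝ) (n : ℕ) (u x : ℕ → L2) (g : L2) : ℝ :=
  2 / ((n : ℝ) * ((n : ℝ) - 1) * h) *
    ∑ ij ∈ (Finset.range n).offDiag,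
      inner ℝ (u ij.1) (u ij.2) ^ 2 * kernelWeight K h n x g ij.1 ij.2 ^ 2

/-- The standardized statistic `n h^{1/2} Q_n / v̂_n`. -/
def stdStat (K : ℝ → ℝ) (h : ℝ) (n : ℕ) (u x : ℕ → L2) (g : L2) : ℝ :=
  (n : ℝ) * Real.sqrt h * Qstat K h n u x g / Real.sqrt (varStat K h n u x g)

/-- The penalized criterion
`n h^{1/2} Q_n(γ) / v̂_n(γ) - α 1_{γ ≠ γ₀^{(p)}}`. -/
def criterion (ρ : HilbertBasis ℕ ℝ L2) (γ₀ : L2) (α : ℝ) (K : ℝ → ℝ) (h : ℝ) (n : ℕ)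
    (u x : ℕ → L2) {p : ℕ} (γ : EuclideanSpace ℝ (Fin p)) : ℝ :=
  stdStat K h n u x (toL2 ρ γ) -
    ({initialDir ρ γ₀ p}ᶜ : Set (EuclideanSpace ℝ (Fin p))).indicator (fun _ => α) γ

/-- `γ` is a maximizer of the penalized criterion over the set of directions `B`. -/
def IsLeastFavorable (ρ : HilbertBasis ℕ ℝ L2) (γ₀ : L2) (α : ℝ) (K : ℝ → ℝ) (h : ℝ) (n : ℕ)
    (u x : ℕ → L2) {p : ℕ} (B : Set (EuclideanSpace ℝ (Fin p)))
    (γ : EuclideanSpace ℝ (Fin p)) : Prop :=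
  γ ∈ B ∧ IsMaxOn (criterion ρ γ₀ α K h n u x) B γ

/-- The σ-field generated by a random element. -/
abbrev sigmaGen {Ω E : Type*} [MeasurableSpace E] (Y : Ω → E) : MeasurableSpace Ω :=
  MeasurableSpace.comap Y inferInstance

/-- The assumptions on the sample `(U_i, X_i)`, `i ≥ 0`, on the initial direction `γ₀` and on the
sets of directions `B_p`. The pair with index `0` serves as the generic pair `(U, X)`. -/
structure DataAssumption {Ω : Type*} [MeasurableSpace Ω] (P : Measure Ω) (U X : ℕ → Ω → L2)
    (ρ : HilbertBasis ℕ ℝ L2) (γ₀ : L2) (B : ∀ p : ℕ, Set (EuclideanSpace ℝ (Fin p))) :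
    Prop where
  measurable_U : ∀ i, Measurable (U i)
  measurable_X : ∀ i, Measurable (X i)
  indep : iIndepFun (fun i ω => (U i ω, X i ω)) P
  ident : ∀ i, IdentDistrib (fun ω => (U i ω, X i ω)) (fun ω => (U 0 ω, X 0 ω)) P P
  moment : Integrable (fun ω => ‖U 0 ω‖ ^ 8) P
  continuous_cdf : ∀ p : ℕ, 1 ≤ p → ∀ γ : EuclideanSpace ℝ (Fin p), ‖γ‖ = 1 →
    Continuous (projCdf P (X 0) (toL2 ρ γ))
  cond_lower : ∃ σsq C₁ : ℝ, 0 < σsq ∧ 0 < C₁ ∧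
    ∀ᵐ ω ∂P, σsq ≤
      (P[fun ω' => {z : ℝ | z ≤ C₁}.indicator (fun z => z ^ 2) (inner ℝ (U 0 ω') (U 1 ω')) |
        sigmaGen fun ω' => (X 0 ω', X 1 ω')]) ω
  cond_upper : ∃ ν C₂ : ℝ, 2 < ν ∧ 0 < C₂ ∧ Integrable (fun ω => ‖U 0 ω‖ ^ ν) P ∧
    ∀ᵐ ω ∂P, (P[fun ω' => ‖U 0 ω'‖ ^ ν | sigmaGen (X 0)]) ω ≤ C₂
  initial_ne : γ₀ ≠ 0
  initial_mem : ∀ p : ℕ, 1 ≤ p → coeffs ρ p γ₀ ≠ 0 → initialDir ρ γ₀ p ∈ B p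
  open_in_sphere : ∀ p : ℕ, 1 ≤ p → ∃ O : Set (EuclideanSpace ℝ (Fin p)),
    IsOpen O ∧ B p = O ∩ Metric.sphere 0 1
  nested : ∀ p q : ℕ, 1 ≤ p → p < q → ∀ γ ∈ B p, zeroPad q γ ∈ B q

/-- The assumptions on the kernel `K`, the bandwidths `h_n` and the dimensions `p_n`. -/
structure KernelAssumption (K : ℝ → ℝ) (h : ℕ → ℝ) (p : ℕ → ℕ) : Prop where
  continuous : Continuous K
  nonneg : ∀ x, 0 ≤ K x
  integrable : Integrable K
  integral_eq_one : ∫ x, K x = 1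
  symm : ∀ x, K x = K (-x)
  antitone : AntitoneOn K (Ici 0)
  h_pos : ∀ n, 0 < h n
  h_tendsto : Tendsto h atTop (𝓝 0)
  nh_sq : Tendsto (fun n : ℕ => (n : ℝ) * h n ^ 2) atTop atTop
  one_le_p : ∀ n, 1 ≤ p n
  p_tendsto : Tendsto p atTop atTop
  p_growth : ∃ lam : ℝ, 0 < lam ∧
    (fun n : ℕ => (p n : ℝ)) =O[atTop] fun n : ℕ => Real.log n ^ lam

/-- `d t v` is a version of `𝔼[D(t) | V = v]` for an `L²[0,1]`-valued random element `D` and a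
`[0,1]`-valued random variable `V`: it is jointly measurable, extended by zero to `v ∉ [0,1]`, and
almost surely `t ↦ d t V` represents the `L²[0,1]`-valued conditional expectation `𝔼[D | V]`. -/
def IsCondMeanFunction {Ω : Type*} [MeasurableSpace Ω] (P : Measure Ω) (D : Ω → L2) (V : Ω → ℝ)
    (d : ℝ → ℝ → ℝ) : Prop :=
  Measurable (Function.uncurry d) ∧
  (∀ t v, v ∉ Icc (0 : ℝ) 1 → d t v = 0) ∧
  ∀ᵐ ω ∂P, ((P[D | sigmaGen V]) ω : ℝ → ℝ) =ᵐ[volume.restrict (Icc (0 : ℝ) 1)]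
    fun t => d t (V ω)

end FunctionalTest

end

set_option linter.unusedSectionVars false

namespace FunctionalTest

/-! The penalty lies between `0` and `α n`, so the statistic at the maximizer is at least the
statistic at any direction of `B (p n)` minus `α n`. Once `p n > q`, the zero-padded detecting
direction belongs to `B (p n)` and represents the same element of `L2`. Everything thus reduces to
one fixed direction, without any uniformity over `B (p n)`: with `Z_i` the projection of `X_i` and
`D_i = δ(X_i)`, the standardized statistic has to exceed `C + α n` with probability tending to one.

The quadratic form in the responses splits as `S_UU + 2 r S_UD + r² S_DD`. The weights depend on the
`Z_i` only, while `U_i` is centered given `(D_i, Z_i)` and independent of the other sample points,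
so most cross products have mean zero. Continuity of the law of `Z` excludes ties; the ranks are
then a permutation and each row of weights is a Riemann sum of order `n h`. Hence `E S_UU² = O(n²
h)` (`integral_sq_sum_UU_le`) and `E S_UD² = O(n³ h²)` (`integral_sq_sum_UD_le`).

In `S_DD` the ranks are replaced by the exact distribution function (`integral_abs_sum_DD_sub_le`),
the resulting U-statistic concentrates (`integral_sq_sum_DD_sub_mean_le`), and its mean divided by
`h` tends to `E‖E[D | Z]‖² > 0` (`tendsto_meanDD`): after the probability integral transform it is a
kernel average of an autocorrelation function, continuous because translations act continuously on
square-integrable functions. So `r² S_DD` has order `r² n² h` and dominates, since `r² n √h → ∞`.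
The variance estimate is bounded in mean, and the standardized statistic outgrows every multiple of
`α n` (`tendsto_measure_stat_lt`). -/

/-! ### Empirical distribution functions and ranks. -/

/-- The empirical distribution function of the reals `z₀, …, z_{n-1}`. -/
noncomputable def ecdf (n : ℕ) (z : ℕ → ℝ) (t : ℝ) : ℝ :=
  (Set.ncard {k : ℕ | k < n ∧ z k ≤ t} : ℝ) / n

/-- The kernel weight of the indices `i`, `j`, computed from the ranks of `z₀, …, z_{n-1}`. -/
noncomputable def rankWeight (K : ℝ → ℝ) (h : ℝ) (n : ℕ) (z : ℕ → ℝ) (i j : ℕ) : ℝ :=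
  K ((ecdf n z (z i) - ecdf n z (z j)) / h)

/-- The number of indices `k < n` with `z k ≤ t`. -/
noncomputable def rankCount (n : ℕ) (z : ℕ → ℝ) (t : ℝ) : ℕ :=
  ((Finset.range n).filter fun k => z k ≤ t).card

theorem ecdf_eq_rankCount (n : ℕ) (z : ℕ → ℝ) (t : ℝ) : ecdf n z t = rankCount n z t / n := by
  have : {k : ℕ | k < n ∧ z k ≤ t} = ((Finset.range n).filter fun k => z k ≤ t : Finset ℕ) := by
    ext k; simp
  rw [ecdf, this, Set.ncard_coe_finset, rankCount]

theorem ecdf_eq_sum (n : ℕ) (z : ℕ → ℝ) (t : ℝ) :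
    ecdf n z t = (∑ k ∈ Finset.range n, (Iic t).indicator (fun _ => (1 : ℝ)) (z k)) / n := by
  rw [ecdf_eq_rankCount, rankCount, Finset.card_filter]
  push_cast
  rfl

theorem ecdf_congr {n : ℕ} {z z' : ℕ → ℝ} (hz : ∀ k < n, z k = z' k) (t : ℝ) :
    ecdf n z t = ecdf n z' t := by
  rw [ecdf_eq_sum, ecdf_eq_sum]
  congr 1
  exact Finset.sum_congr rfl fun k hk => by rw [hz k (Finset.mem_range.1 hk)]

theorem rankWeight_congr (K : ℝ → ℝ) (h : ℝ) {n : ℕ} {z z' : ℕ → ℝ} (hz : ∀ k < n, z k = z' k)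
    {i j : ℕ} (hi : i < n) (hj : j < n) : rankWeight K h n z i j = rankWeight K h n z' i j := by
  rw [rankWeight, rankWeight, ecdf_congr hz, ecdf_congr hz, hz i hi, hz j hj]

theorem measurable_ecdf_coord (n i : ℕ) : Measurable fun z : ℕ → ℝ => ecdf n z (z i) := by
  simp only [ecdf_eq_sum]
  refine Measurable.div_const (Finset.measurable_fun_sum _ fun k _ => ?_) _
  have : (fun z : ℕ → ℝ => (Iic (z i)).indicator (fun _ => (1 : ℝ)) (z k)) =
      {z : ℕ → ℝ | z k ≤ z i}.indicator fun _ => 1 := by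
    ext z; simp [indicator]
  rw [this]
  exact measurable_const.indicator (measurableSet_le (measurable_pi_apply k) (measurable_pi_apply i))

theorem measurable_rankWeight {K : ℝ → ℝ} (hK : Measurable K) (h : ℝ) (n i j : ℕ) :
    Measurable fun z : ℕ → ℝ => rankWeight K h n z i j :=
  hK.comp (((measurable_ecdf_coord n i).sub (measurable_ecdf_coord n j)).div_const h)

theorem rankCount_lt_rankCount {n : ℕ} {z : ℕ → ℝ} {i j : ℕ} (hj : j < n) (h : z i < z j) :
    rankCount n z (z i) < rankCount n z (z j) := by
  refine Finset.card_lt_card ⟨fun k hk => ?_, fun hsub => ?_⟩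
  · simp only [Finset.mem_filter] at hk ⊢
    exact ⟨hk.1, hk.2.trans h.le⟩
  · have : j ∈ (Finset.range n).filter fun k => z k ≤ z i :=
      hsub (by simp [hj])
    simp only [Finset.mem_filter] at this
    exact absurd this.2 (not_le.2 h)

/-- Without ties, a strictly larger value has a strictly larger rank. Together with the bounds `1`
and `n` this makes the ranks a permutation of `1, …, n`. -/
theorem rankCount_injOn {n : ℕ} {z : ℕ → ℝ} (hz : InjOn z (Finset.range n)) :
    InjOn (fun i => rankCount n z (z i)) (Finset.range n) := by
  intro i hi j hj hij
  have hi' : i < n := by simpa using hi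
  have hj' : j < n := by simpa using hj
  rcases lt_trichotomy (z i) (z j) with h | h | h
  · exact absurd hij (rankCount_lt_rankCount hj' h).ne
  · exact hz hi hj h
  · exact absurd hij (rankCount_lt_rankCount hi' h).ne'

theorem rankCount_le (n : ℕ) (z : ℕ → ℝ) (t : ℝ) : rankCount n z t ≤ n :=
  (Finset.card_filter_le _ _).trans (Finset.card_range n).le

theorem one_le_rankCount {n : ℕ} {z : ℕ → ℝ} {i : ℕ} (hi : i < n) : 1 ≤ rankCount n z (z i) :=
  Finset.card_pos.2 ⟨i, by simp [hi]⟩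

/-! ### Row sums of the rank weights. -/

section Kernel

variable {K : ℝ → ℝ}

theorem kernel_le_zero (hsymm : ∀ x, K x = K (-x)) (hanti : AntitoneOn K (Ici 0)) (x : ℝ) :
    K x ≤ K 0 := by
  rcases le_total 0 x with hx | hx
  · exact hanti (mem_Ici.2 le_rfl) hx hx
  · rw [hsymm]
    exact hanti (mem_Ici.2 le_rfl) (mem_Ici.2 (neg_nonneg.2 hx)) (neg_nonneg.2 hx)

/-- Monotonicity bounds each term with `m ≥ 1` by the integral of `K (x / b)` over the preceding
unit interval; these add up to at most `b`, and the term `m = 0` contributes `K 0`. -/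
theorem sum_kernel_grid_le (hnn : ∀ x, 0 ≤ K x) (hint : Integrable K) (hone : ∫ x, K x = 1)
    (hanti : AntitoneOn K (Ici 0)) {b : ℝ} (hb : 0 < b) (n : ℕ) :
    ∑ m ∈ Finset.range n, K (m / b) ≤ K 0 + b := by
  calc ∑ m ∈ Finset.range n, K (m / b) ≤ ∑ m ∈ Finset.range (n + 1), K (m / b) :=
        Finset.sum_le_sum_of_subset_of_nonneg (Finset.range_mono n.le_succ) fun _ _ _ => hnn _
    _ = (∑ m ∈ Finset.range n, K ((0 + ((m + 1 : ℕ) : ℝ)) / b)) + K 0 := by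
        rw [Finset.sum_range_succ']; simp
    _ ≤ (∫ x in (0 : ℝ)..(0 + n), K (x / b)) + K 0 := by
        gcongr
        refine AntitoneOn.sum_le_integral (f := fun x => K (x / b)) fun x hx y hy hxy => ?_
        exact hanti (div_nonneg hx.1 hb.le) (div_nonneg hy.1 hb.le) (by gcongr)
    _ ≤ (∫ x, K (x / b)) + K 0 := by
        gcongr
        rw [intervalIntegral.integral_of_le (by positivity)]
        exact setIntegral_le_integral (hint.comp_div hb.ne') (ae_of_all _ fun x => hnn _)
    _ = K 0 + b := by
        rw [Measure.integral_comp_div, hone, abs_of_pos hb]; simp [add_comm]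

/-- Without ties, the rows of the weight matrix have sums of order `n h`. -/
theorem sum_rankWeight_le (hnn : ∀ x, 0 ≤ K x) (hint : Integrable K) (hone : ∫ x, K x = 1)
    (hsymm : ∀ x, K x = K (-x)) (hanti : AntitoneOn K (Ici 0)) {h : ℝ} (hh : 0 < h) {n : ℕ}
    {z : ℕ → ℝ} (hz : InjOn z (Finset.range n)) {i : ℕ} (hi : i < n) :
    ∑ j ∈ Finset.range n, rankWeight K h n z i j ≤ 2 * (K 0 + n * h) := by
  have hn : 0 < (n : ℝ) := by exact_mod_cast (Nat.zero_le i).trans_lt hi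
  set R : ℕ → ℕ := fun j => rankCount n z (z j) with hR
  have hinj : InjOn R (Finset.range n) := rankCount_injOn hz
  have hw : ∀ j, rankWeight K h n z i j = K (((R i : ℝ) - R j) / (n * h)) := fun j => by
    rw [rankWeight, ecdf_eq_rankCount, ecdf_eq_rankCount]
    congr 1; field_simp; simp [hR]
  have hgrid := sum_kernel_grid_le hnn hint hone hanti (mul_pos hn hh) n
  -- On either side of `R i` the distances `|R i - R j|` are distinct integers, and they are smaller
  -- than `n` because ranks lie between `1` and `n`. Each half is therefore part of the grid sum,
  -- which gives the factor `2`.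
  rw [← Finset.sum_filter_add_sum_filter_not _ (fun j => R j ≤ R i), two_mul]
  refine add_le_add (le_trans ?_ hgrid) (le_trans ?_ hgrid)
  · calc ∑ j ∈ (Finset.range n).filter (fun j => R j ≤ R i), rankWeight K h n z i j
        = ∑ j ∈ (Finset.range n).filter (fun j => R j ≤ R i), K (((R i - R j : ℕ) : ℝ) / (n * h)) := by
          refine Finset.sum_congr rfl fun j hj => ?_
          rw [hw, Nat.cast_sub (Finset.mem_filter.1 hj).2]
      _ = ∑ m ∈ ((Finset.range n).filter (fun j => R j ≤ R i)).image (fun j => R i - R j),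
            K ((m : ℝ) / (n * h)) := by
          rw [Finset.sum_image]
          intro j hj k hk hjk
          simp only [Finset.coe_filter, mem_ofPred_eq] at hj hk
          exact hinj hj.1 hk.1 (by dsimp at hjk; omega)
      _ ≤ _ := by
          refine Finset.sum_le_sum_of_subset_of_nonneg (fun m hm => ?_) fun _ _ _ => hnn _
          obtain ⟨j, hj, rfl⟩ := Finset.mem_image.1 hm
          have h1 : 1 ≤ R j := one_le_rankCount (Finset.mem_range.1 (Finset.mem_filter.1 hj).1)
          have h2 : R i ≤ n := rankCount_le n z _
          exact Finset.mem_range.2 (by omega)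
  · calc ∑ j ∈ (Finset.range n).filter (fun j => ¬ R j ≤ R i), rankWeight K h n z i j
        = ∑ j ∈ (Finset.range n).filter (fun j => ¬ R j ≤ R i),
            K (((R j - R i : ℕ) : ℝ) / (n * h)) := by
          refine Finset.sum_congr rfl fun j hj => ?_
          rw [hw, Nat.cast_sub (not_le.1 (Finset.mem_filter.1 hj).2).le, hsymm]
          congr 1; ring
      _ = ∑ m ∈ ((Finset.range n).filter (fun j => ¬ R j ≤ R i)).image (fun j => R j - R i),
            K ((m : ℝ) / (n * h)) := by
          rw [Finset.sum_image]
          intro j hj k hk hjk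
          simp only [Finset.coe_filter, mem_ofPred_eq] at hj hk
          exact hinj hj.1 hk.1 (by dsimp at hjk; omega)
      _ ≤ _ := by
          refine Finset.sum_le_sum_of_subset_of_nonneg (fun m hm => ?_) fun _ _ _ => hnn _
          obtain ⟨j, hj, rfl⟩ := Finset.mem_image.1 hm
          have h1 : 1 ≤ R i := one_le_rankCount hi
          have h2 : R j ≤ n := rankCount_le n z _
          exact Finset.mem_range.2 (by omega)

theorem rankWeight_symm (hsymm : ∀ x, K x = K (-x)) (h : ℝ) (n : ℕ) (z : ℕ → ℝ) (i j : ℕ) :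
    rankWeight K h n z i j = rankWeight K h n z j i := by
  rw [rankWeight, hsymm, rankWeight]
  congr 1; ring

end Kernel

/-! ### Orthogonality relations from conditional centering and independence. -/

section Orthogonality

variable {Ω : Type*} [MeasurableSpace Ω] {P : Measure Ω}
  {E : Type*} [NormedAddCommGroup E] [InnerProductSpace ℝ E]
  [MeasurableSpace E] [BorelSpace E] [SecondCountableTopology E]
  {τ S : Type*} [MeasurableSpace τ] [MeasurableSpace S]

/-- `f (T)` is `σ(T)`-measurable and can be pulled out of the conditional expectation of the inner
product, which leaves `⟨E[A | T], f (T)⟩ = 0`. -/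
theorem integral_inner_comp_eq_zero [CompleteSpace E] [IsProbabilityMeasure P] {A : Ω → E} {T : Ω → τ} (hT : Measurable T)
    (hA : Integrable A P) (hcond : P[A | sigmaGen T] =ᵐ[P] 0) {f : τ → E} (hf : Measurable f)
    (hint : Integrable (fun ω => inner ℝ (A ω) (f (T ω))) P) :
    ∫ ω, inner ℝ (A ω) (f (T ω)) ∂P = 0 := by
  have hm : sigmaGen T ≤ ‹MeasurableSpace Ω› := hT.comap_le
  have hfT : StronglyMeasurable[sigmaGen T] fun ω => f (T ω) :=
    (hf.comp (comap_measurable T)).stronglyMeasurable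
  have key := condExp_bilin_of_stronglyMeasurable_right (μ := P) (m := sigmaGen T) (innerSL ℝ)
    (f := A) hfT hint hA
  rw [← integral_condExp hm]
  refine integral_eq_zero_of_ae ?_
  have key' : P[fun ω => inner ℝ (A ω) (f (T ω)) | sigmaGen T] =ᵐ[P]
      fun ω => inner ℝ ((P[A | sigmaGen T]) ω) (f (T ω)) := key
  filter_upwards [key', hcond] with ω h1 h2
  rw [h1, h2]; simp

/-- If `A` is orthogonal to the functions of `T` and `(A, T)` is independent of `Y`, then `A` is
orthogonal to every function of `(T, Y)`. -/
theorem integral_inner_comp_eq_zero_of_indepFun [IsProbabilityMeasure P] {A : Ω → E} {T : Ω → τ} {Y : Ω → S}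
    (hAm : Measurable A) (hT : Measurable T) (hY : Measurable Y)
    (horth : ∀ f : τ → E, Measurable f → Integrable (fun ω => inner ℝ (A ω) (f (T ω))) P →
      ∫ ω, inner ℝ (A ω) (f (T ω)) ∂P = 0)
    (hind : IndepFun (fun ω => (A ω, T ω)) Y P) {f : τ × S → E} (hf : Measurable f)
    (hint : Integrable (fun ω => inner ℝ (A ω) (f (T ω, Y ω))) P) :
    ∫ ω, inner ℝ (A ω) (f (T ω, Y ω)) ∂P = 0 := by
  have hAT : Measurable fun ω => (A ω, T ω) := hAm.prodMk hT
  have hall : Measurable fun ω => ((A ω, T ω), Y ω) := hAT.prodMk hY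
  have hlaw : P.map (fun ω => ((A ω, T ω), Y ω)) = (P.map fun ω => (A ω, T ω)).prod (P.map Y) :=
    hind.map_prod_eq_prod_map_map hAT.aemeasurable hY.aemeasurable
  have : IsProbabilityMeasure (P.map fun ω => (A ω, T ω)) :=
    Measure.isProbabilityMeasure_map hAT.aemeasurable
  have : IsProbabilityMeasure (P.map Y) := Measure.isProbabilityMeasure_map hY.aemeasurable
  set H : (E × τ) × S → ℝ := fun q => inner ℝ q.1.1 (f (q.1.2, q.2)) with hH
  have hHm : Measurable H := by
    have h1 : Measurable fun q : (E × τ) × S => f (q.1.2, q.2) := hf.comp (by fun_prop)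
    exact Measurable.inner (by fun_prop) h1
  have hHint : Integrable H ((P.map fun ω => (A ω, T ω)).prod (P.map Y)) := by
    rw [← hlaw, integrable_map_measure hHm.aestronglyMeasurable hall.aemeasurable]
    exact hint
  have h1 : ∫ ω, inner ℝ (A ω) (f (T ω, Y ω)) ∂P = ∫ q, H q ∂(P.map fun ω => ((A ω, T ω), Y ω)) :=
    (integral_map hall.aemeasurable hHm.aestronglyMeasurable).symm
  rw [h1, hlaw, integral_prod_symm _ hHint]
  refine integral_eq_zero_of_ae ?_
  -- For almost every frozen value `y` of `Y` the slice is integrable, and it involves a function of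
  -- `T` alone, so `horth` applies.
  filter_upwards [hHint.prod_left_ae] with y hy
  have hHy : Measurable fun x => H (x, y) := hHm.comp (by fun_prop)
  rw [integral_map hAT.aemeasurable hHy.aestronglyMeasurable]
  rw [integrable_map_measure hHy.aestronglyMeasurable hAT.aemeasurable] at hy
  exact horth (fun t => f (t, y)) (hf.comp (by fun_prop)) hy

theorem integral_sq_sum_of_orthogonal {ι : Type*} (s : Finset ι) {ξ : ι → Ω → ℝ}
    (hξ : ∀ a ∈ s, MemLp (ξ a) 2 P)
    (horth : ∀ a ∈ s, ∀ b ∈ s, a ≠ b → ∫ ω, ξ a ω * ξ b ω ∂P = 0) :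
    ∫ ω, (∑ a ∈ s, ξ a ω) ^ 2 ∂P = ∑ a ∈ s, ∫ ω, ξ a ω ^ 2 ∂P := by
  have hint : ∀ a ∈ s, ∀ b ∈ s, Integrable (fun ω => ξ a ω * ξ b ω) P := fun a ha b hb =>
    (hξ a ha).integrable_mul (hξ b hb)
  simp_rw [sq, Finset.sum_mul_sum]
  rw [integral_finsetSum _ fun a ha => integrable_finsetSum _ fun b hb => hint a ha b hb]
  refine Finset.sum_congr rfl fun a ha => ?_
  rw [integral_finsetSum _ fun b hb => hint a ha b hb, Finset.sum_eq_single_of_mem a ha]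
  exact fun b hb hba => horth a ha b hb hba.symm

end Orthogonality

theorem memLp_two_norm_mul_norm {Ω : Type*} [MeasurableSpace Ω] {P : Measure Ω} {F : Type*}
    [NormedAddCommGroup F] [MeasurableSpace F] [BorelSpace F] {A B : Ω → F} 
    (hA : Measurable A) (hB : Measurable B)
    (hA4 : Integrable (fun ω => ‖A ω‖ ^ 4) P) (hB4 : Integrable (fun ω => ‖B ω‖ ^ 4) P) :
    MemLp (fun ω => ‖A ω‖ * ‖B ω‖) 2 P := by
  rw [memLp_two_iff_integrable_sq (by fun_prop)]
  refine (hA4.add hB4).mono' (by fun_prop) (ae_of_all _ fun ω => ?_)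
  rw [Real.norm_of_nonneg (by positivity), Pi.add_apply]
  nlinarith [sq_nonneg (‖A ω‖ ^ 2 - ‖B ω‖ ^ 2), sq_nonneg (‖A ω‖ ^ 2), sq_nonneg (‖B ω‖ ^ 2)]

/-! ### Schur-type bounds and sums over pairs of distinct indices. -/

section Schur

variable {n : ℕ} {w : ℕ → ℕ → ℝ} {R : ℝ}

/-- Schur's test: `a i * b j ≤ (a i ^ 2 + b j ^ 2) / 2`, and by symmetry the row bound `R` is also a
column bound. -/
theorem sum_mul_mul_weight_le (hw : ∀ i j, 0 ≤ w i j) (hsymm : ∀ i j, w i j = w j i)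
    (hrow : ∀ i < n, ∑ j ∈ Finset.range n, w i j ≤ R) (a b : ℕ → ℝ) :
    ∑ i ∈ Finset.range n, ∑ j ∈ Finset.range n, a i * b j * w i j ≤
      R / 2 * ∑ i ∈ Finset.range n, (a i ^ 2 + b i ^ 2) := by
  have hterm : ∀ i j, a i * b j * w i j ≤ 1 / 2 * (a i ^ 2 * w i j) + 1 / 2 * (b j ^ 2 * w i j) :=
    fun i j => by nlinarith [mul_nonneg (sq_nonneg (a i - b j)) (hw i j)]
  have hhalf : ∀ c : ℕ → ℝ, ∑ i ∈ Finset.range n, ∑ j ∈ Finset.range n, c i ^ 2 * w i j ≤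
      R * ∑ i ∈ Finset.range n, c i ^ 2 := fun c => by
    rw [Finset.mul_sum]
    refine Finset.sum_le_sum fun i hi => ?_
    rw [← Finset.mul_sum, mul_comm R]
    exact mul_le_mul_of_nonneg_left (hrow i (Finset.mem_range.1 hi)) (sq_nonneg _)
  calc _ ≤ ∑ i ∈ Finset.range n, ∑ j ∈ Finset.range n,
        (1 / 2 * (a i ^ 2 * w i j) + 1 / 2 * (b j ^ 2 * w i j)) :=
        Finset.sum_le_sum fun i _ => Finset.sum_le_sum fun j _ => hterm i j
    _ = 1 / 2 * (∑ i ∈ Finset.range n, ∑ j ∈ Finset.range n, a i ^ 2 * w i j) +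
        1 / 2 * (∑ i ∈ Finset.range n, ∑ j ∈ Finset.range n, b i ^ 2 * w i j) := by
        have hswap : ∑ i ∈ Finset.range n, ∑ j ∈ Finset.range n, b j ^ 2 * w i j =
            ∑ i ∈ Finset.range n, ∑ j ∈ Finset.range n, b i ^ 2 * w i j := by
          rw [Finset.sum_comm]
          exact Finset.sum_congr rfl fun i _ => Finset.sum_congr rfl fun j _ => by rw [hsymm]
        rw [← hswap]
        simp_rw [Finset.mul_sum, Finset.sum_add_distrib]
    _ ≤ 1 / 2 * (R * ∑ i ∈ Finset.range n, a i ^ 2) + 1 / 2 * (R * ∑ i ∈ Finset.range n, b i ^ 2) := by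
        have := hhalf a; have := hhalf b; linarith
    _ = _ := by rw [Finset.sum_add_distrib]; ring

/-- Cauchy–Schwarz with respect to the weights of row `i`, whose total mass is at most `R`. -/
theorem sq_sum_weight_mul_le (hw : ∀ i j, 0 ≤ w i j)
    (hrow : ∀ i < n, ∑ j ∈ Finset.range n, w i j ≤ R) (d : ℕ → ℝ) {i : ℕ} (hi : i < n) :
    (∑ j ∈ Finset.range n, w i j * d j) ^ 2 ≤ R * ∑ j ∈ Finset.range n, w i j * d j ^ 2 := by
  refine (Finset.sum_sq_le_sum_mul_sum_of_sq_le_mul _ (f := fun j => w i j)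
    (g := fun j => w i j * d j ^ 2) (fun j _ => hw i j)
    (fun j _ => mul_nonneg (hw i j) (sq_nonneg _)) (fun j _ => le_of_eq (by ring))).trans ?_
  exact mul_le_mul_of_nonneg_right (hrow i hi)
    (Finset.sum_nonneg fun j _ => mul_nonneg (hw i j) (sq_nonneg _))

end Schur

section OffDiag

theorem sum_offDiag_eq_sum_sum_erase (n : ℕ) (f : ℕ → ℕ → ℝ) :
    ∑ ij ∈ (Finset.range n).offDiag, f ij.1 ij.2 =
      ∑ i ∈ Finset.range n, ∑ j ∈ (Finset.range n).erase i, f i j := by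
  rw [Finset.sum_sigma']
  refine Finset.sum_bij' (fun ij _ => ⟨ij.1, ij.2⟩) (fun ij _ => (ij.1, ij.2)) ?_ ?_ ?_ ?_ ?_
  · rintro ⟨i, j⟩ hij
    simp only [Finset.mem_offDiag, Finset.mem_sigma, Finset.mem_erase] at hij ⊢
    exact ⟨hij.1, fun h => hij.2.2 h.symm, hij.2.1⟩
  · rintro ⟨i, j⟩ hij
    simp only [Finset.mem_offDiag, Finset.mem_sigma, Finset.mem_erase] at hij ⊢
    exact ⟨hij.1, hij.2.2, fun h => hij.2.1 h.symm⟩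
  · rintro ⟨i, j⟩ _; rfl
  · rintro ⟨i, j⟩ _; rfl
  · rintro ⟨i, j⟩ _; rfl

theorem sum_offDiag_swap (s : Finset ℕ) (f : ℕ → ℕ → ℝ) :
    ∑ ij ∈ s.offDiag, f ij.1 ij.2 = ∑ ij ∈ s.offDiag, f ij.2 ij.1 := by
  refine Finset.sum_bij' (fun ij _ => (ij.2, ij.1)) (fun ij _ => (ij.2, ij.1)) ?_ ?_ ?_ ?_ ?_
  · rintro ⟨i, j⟩ hij
    simp only [Finset.mem_offDiag] at hij ⊢
    exact ⟨hij.2.1, hij.1, hij.2.2.symm⟩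
  · rintro ⟨i, j⟩ hij
    simp only [Finset.mem_offDiag] at hij ⊢
    exact ⟨hij.2.1, hij.1, hij.2.2.symm⟩
  · rintro ⟨i, j⟩ _; rfl
  · rintro ⟨i, j⟩ _; rfl
  · rintro ⟨i, j⟩ _; rfl

/-- Restricting to `i < j` keeps one ordering of each pair. Different terms then have different
index sets, which is what makes them orthogonal later on. -/
theorem sum_offDiag_eq_two_mul (s : Finset ℕ) {f : ℕ → ℕ → ℝ} (hf : ∀ i j, f i j = f j i) :
    ∑ ij ∈ s.offDiag, f ij.1 ij.2 =
      2 * ∑ ij ∈ s.offDiag.filter (fun ij => ij.1 < ij.2), f ij.1 ij.2 := by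
  rw [← Finset.sum_filter_add_sum_filter_not _ (fun ij : ℕ × ℕ => ij.1 < ij.2), two_mul]
  congr 1
  refine Finset.sum_bij' (fun ij _ => (ij.2, ij.1)) (fun ij _ => (ij.2, ij.1)) ?_ ?_ ?_ ?_ ?_
  · rintro ⟨i, j⟩ hij
    simp only [Finset.mem_filter, Finset.mem_offDiag] at hij ⊢
    refine ⟨⟨hij.1.2.1, hij.1.1, hij.1.2.2.symm⟩, ?_⟩
    omega
  · rintro ⟨i, j⟩ hij
    simp only [Finset.mem_filter, Finset.mem_offDiag] at hij ⊢
    refine ⟨⟨hij.1.2.1, hij.1.1, hij.1.2.2.symm⟩, ?_⟩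
    omega
  · rintro ⟨i, j⟩ _; rfl
  · rintro ⟨i, j⟩ _; rfl
  · rintro ⟨i, j⟩ _; exact hf _ _

theorem sum_offDiag_le_sum_sum (n : ℕ) {f : ℕ → ℕ → ℝ} (hf : ∀ i j, 0 ≤ f i j) :
    ∑ ij ∈ (Finset.range n).offDiag, f ij.1 ij.2 ≤
      ∑ i ∈ Finset.range n, ∑ j ∈ Finset.range n, f i j := by
  rw [sum_offDiag_eq_sum_sum_erase]
  exact Finset.sum_le_sum fun i _ =>
    Finset.sum_le_sum_of_subset_of_nonneg (Finset.erase_subset _ _) fun _ _ _ => hf _ _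

end OffDiag

/-! ### The sample in a fixed direction. -/

/-- Independent copies `(U_i, D_i, Z_i)` of a triple with `𝔼[U | D, Z] = 0`, fourth moments, and
a continuous distribution function of `Z`. -/
structure CenteredSample {Ω E : Type*} [MeasurableSpace Ω] [NormedAddCommGroup E]
    [InnerProductSpace ℝ E] [CompleteSpace E] [MeasurableSpace E] (P : Measure Ω)
    (U D : ℕ → Ω → E) (Z : ℕ → Ω → ℝ) : Prop where
  measurable_U : ∀ i, Measurable (U i)
  measurable_D : ∀ i, Measurable (D i)
  measurable_Z : ∀ i, Measurable (Z i)
  indep : iIndepFun (fun i ω => (U i ω, D i ω, Z i ω)) P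
  ident : ∀ i, IdentDistrib (fun ω => (U i ω, D i ω, Z i ω)) (fun ω => (U 0 ω, D 0 ω, Z 0 ω)) P P
  moment_U : Integrable (fun ω => ‖U 0 ω‖ ^ 4) P
  moment_D : Integrable (fun ω => ‖D 0 ω‖ ^ 4) P
  centered : P[U 0 | sigmaGen fun ω => (D 0 ω, Z 0 ω)] =ᵐ[P] 0
  continuous_cdf : Continuous (cdf (P.map (Z 0)))

namespace CenteredSample

variable {Ω : Type*} [MeasurableSpace Ω] {P : Measure Ω}
  {E : Type*} [NormedAddCommGroup E] [InnerProductSpace ℝ E] [CompleteSpace E]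
  [MeasurableSpace E] {U D : ℕ → Ω → E} {Z : ℕ → Ω → ℝ}

/-- The sample point `(U_k, D_k, Z_k)`, `k ≥ 0`. -/
def point (U D : ℕ → Ω → E) (Z : ℕ → Ω → ℝ) (ω : Ω) : ℕ → E × E × ℝ :=
  fun k => (U k ω, D k ω, Z k ω)

theorem measurable_triple (hs : CenteredSample P U D Z) (i : ℕ) :
    Measurable fun ω => (U i ω, D i ω, Z i ω) :=
  (hs.measurable_U i).prodMk ((hs.measurable_D i).prodMk (hs.measurable_Z i))

theorem identDistrib_U (hs : CenteredSample P U D Z) (i : ℕ) : IdentDistrib (U i) (U 0) P P :=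
  (hs.ident i).comp measurable_fst

theorem identDistrib_D (hs : CenteredSample P U D Z) (i : ℕ) : IdentDistrib (D i) (D 0) P P :=
  (hs.ident i).comp (measurable_fst.comp measurable_snd)

theorem identDistrib_Z (hs : CenteredSample P U D Z) (i : ℕ) : IdentDistrib (Z i) (Z 0) P P :=
  (hs.ident i).comp (measurable_snd.comp measurable_snd)

theorem indepFun_Z (hs : CenteredSample P U D Z) {i j : ℕ} (hij : i ≠ j) :
    IndepFun (Z i) (Z j) P :=
  (hs.indep.indepFun hij).comp (measurable_snd.comp measurable_snd)
    (measurable_snd.comp measurable_snd)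

section Moments

variable [BorelSpace E]

theorem integrable_U_pow (hs : CenteredSample P U D Z) (i : ℕ) :
    Integrable (fun ω => ‖U i ω‖ ^ 4) P :=
  ((hs.identDistrib_U i).comp (measurable_norm.pow_const 4)).integrable_iff.2 hs.moment_U

theorem integrable_D_pow (hs : CenteredSample P U D Z) (i : ℕ) :
    Integrable (fun ω => ‖D i ω‖ ^ 4) P :=
  ((hs.identDistrib_D i).comp (measurable_norm.pow_const 4)).integrable_iff.2 hs.moment_D

theorem integral_U_pow (hs : CenteredSample P U D Z) (i : ℕ) :
    ∫ ω, ‖U i ω‖ ^ 4 ∂P = ∫ ω, ‖U 0 ω‖ ^ 4 ∂P :=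
  ((hs.identDistrib_U i).comp (measurable_norm.pow_const 4)).integral_eq

theorem integral_D_pow (hs : CenteredSample P U D Z) (i : ℕ) :
    ∫ ω, ‖D i ω‖ ^ 4 ∂P = ∫ ω, ‖D 0 ω‖ ^ 4 ∂P :=
  ((hs.identDistrib_D i).comp (measurable_norm.pow_const 4)).integral_eq

end Moments

variable [IsProbabilityMeasure P]

/-- A continuous distribution function has no atoms, so by Fubini the diagonal is null for the law
of `(Z i, Z j)`; there are countably many pairs `i ≠ j`. Outside one null set there are no ties,
whatever `n`. -/
theorem ae_injective (hs : CenteredSample P U D Z) : ∀ᵐ ω ∂P, Function.Injective fun i => Z i ω := by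
  have hprob : ∀ i, IsProbabilityMeasure (P.map (Z i)) := fun i =>
    Measure.isProbabilityMeasure_map (hs.measurable_Z i).aemeasurable
  have hatom : NullSingletonClass (P.map (Z 0)) := ⟨fun x => by
    rw [← measure_cdf (P.map (Z 0)), StieltjesFunction.measure_singleton,
      leftLim_eq_of_tendsto
        (hs.continuous_cdf.continuousAt.tendsto.mono_left nhdsWithin_le_nhds)]
    simp⟩
  have hne : ∀ i j, i ≠ j → ∀ᵐ ω ∂P, Z i ω ≠ Z j ω := fun i j hij => by
    have hlaw := (hs.indepFun_Z hij).map_prod_eq_prod_map_map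
      (hs.measurable_Z i).aemeasurable (hs.measurable_Z j).aemeasurable
    rw [(hs.identDistrib_Z j).map_eq] at hlaw
    have hdiag : MeasurableSet {q : ℝ × ℝ | q.1 = q.2} := measurableSet_eq_fun measurable_fst measurable_snd
    have : P.map (fun ω => (Z i ω, Z j ω)) {q : ℝ × ℝ | q.1 = q.2} = 0 := by
      rw [hlaw, Measure.measure_prod_null hdiag]
      refine ae_of_all _ fun x => ?_
      have : Prod.mk x ⁻¹' {q : ℝ × ℝ | q.1 = q.2} = {x} := by ext y; simp [eq_comm]
      simp [this]
    rw [Measure.map_apply ((hs.measurable_Z i).prodMk (hs.measurable_Z j)) hdiag] at this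
    exact (measure_eq_zero_iff_ae_notMem.1 this).mono fun ω h => h
  have : ∀ᵐ ω ∂P, ∀ i j, i ≠ j → Z i ω ≠ Z j ω := by
    rw [ae_all_iff]; intro i
    rw [ae_all_iff]; intro j
    by_cases hij : i = j
    · exact ae_of_all _ fun ω h => absurd hij h
    · exact (hne i j hij).mono fun ω h _ => h
  filter_upwards [this] with ω h i j hij
  by_contra hne
  exact h i j hne hij

variable [BorelSpace E] [SecondCountableTopology E]

theorem integrable_U (hs : CenteredSample P U D Z) (i : ℕ) : Integrable (U i) P := by
  refine Integrable.mono' ((integrable_const 1).add (hs.integrable_U_pow i))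
    (hs.measurable_U i).aestronglyMeasurable (ae_of_all _ fun ω => ?_)
  rw [Pi.add_apply]
  nlinarith [sq_nonneg (‖U i ω‖ ^ 2 - 1), sq_nonneg (‖U i ω‖ - 1), norm_nonneg (U i ω)]

theorem integral_inner_comp_eq_zero (hs : CenteredSample P U D Z) (i : ℕ) (f : E × ℝ → E)
    (hf : Measurable f)
    (hint : Integrable (fun ω => inner ℝ (U i ω) (f (D i ω, Z i ω))) P) :
    ∫ ω, inner ℝ (U i ω) (f (D i ω, Z i ω)) ∂P = 0 := by
  have hF : Measurable fun q : E × E × ℝ => (inner ℝ q.1 (f q.2) : ℝ) :=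
    Measurable.inner measurable_fst (hf.comp measurable_snd)
  have hid := (hs.ident i).comp hF
  have : ∫ ω, inner ℝ (U 0 ω) (f (D 0 ω, Z 0 ω)) ∂P = 0 :=
    FunctionalTest.integral_inner_comp_eq_zero ((hs.measurable_D 0).prodMk (hs.measurable_Z 0)) (hs.integrable_U 0)
      hs.centered hf (hid.integrable_iff.1 hint)
  rw [← this]
  exact hid.integral_eq

/-- `U_i` is orthogonal to every function of `(D_i, Z_i)` and of the other sample points. -/
theorem integral_inner_eq_zero (hs : CenteredSample P U D Z) (n i : ℕ) {G : (ℕ → E × E × ℝ) → E}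
    (hG : Measurable G)
    (hdep : ∀ y y' : ℕ → E × E × ℝ, (∀ k < n, k ≠ i → y k = y' k) → (y i).2 = (y' i).2 → G y = G y')
    (hint : Integrable (fun ω => inner ℝ (U i ω) (G (point U D Z ω))) P) :
    ∫ ω, inner ℝ (U i ω) (G (point U D Z ω)) ∂P = 0 := by
  classical
  set S : Finset ℕ := (Finset.range n).erase i
  have hind : IndepFun (fun ω => (U i ω, D i ω, Z i ω))
      (fun ω (k : S) => (U k ω, D k ω, Z k ω)) P :=
    (hs.indep.indepFun_finset {i} S (by simp [S]) hs.measurable_triple).comp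
      (φ := fun q : (({i} : Finset ℕ) → E × E × ℝ) => q ⟨i, Finset.mem_singleton_self i⟩)
      (ψ := id) (measurable_pi_apply _) measurable_id
  -- A sequence is rebuilt from `(D i, Z i)` and the points with index in `S`. The value `U i` and
  -- all points with index at least `n` are replaced by `0`, which `G` does not see by `hdep`; this
  -- displays `G` as a function of `(D i, Z i)` and of an independent block.
  set ext : (E × ℝ) × (S → E × E × ℝ) → ℕ → E × E × ℝ := fun q k =>
    if k = i then (0, q.1) else if hk : k ∈ S then q.2 ⟨k, hk⟩ else 0 with hext
  have hextm : Measurable ext := by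
    refine measurable_pi_lambda _ fun k => ?_
    by_cases hki : k = i
    · simp only [hext, hki, if_true]; fun_prop
    · by_cases hk : k ∈ S
      · simp only [hext, hki, hk, if_false, dif_pos]; fun_prop
      · simp only [hext, hki, hk, if_false, dif_neg, not_false_eq_true]; fun_prop
  have hGe : ∀ ω, G (point U D Z ω) = G (ext ((D i ω, Z i ω), fun k : S => (U k ω, D k ω, Z k ω))) := by
    intro ω
    refine hdep _ _ (fun k hk hki => ?_) ?_
    · have : k ∈ S := Finset.mem_erase.2 ⟨hki, Finset.mem_range.2 hk⟩
      simp [hext, hki, this, point]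
    · simp [hext, point]
  simp_rw [hGe] at hint ⊢
  exact integral_inner_comp_eq_zero_of_indepFun (f := fun q => G (ext q))
    (Y := fun ω (k : S) => (U k ω, D k ω, Z k ω)) (hs.measurable_U i)
    ((hs.measurable_D i).prodMk (hs.measurable_Z i))
    (measurable_pi_lambda _ fun k => hs.measurable_triple k)
    (hs.integral_inner_comp_eq_zero i) hind (hG.comp hextm) hint

end CenteredSample

/-- A symmetric continuous probability density, non-increasing on `[0, ∞)`. -/
structure SymmKernel (K : ℝ → ℝ) : Prop where
  continuous : Continuous K
  nonneg : ∀ x, 0 ≤ K x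
  integrable : Integrable K
  integral_eq_one : ∫ x, K x = 1
  symm : ∀ x, K x = K (-x)
  antitone : AntitoneOn K (Ici 0)

theorem SymmKernel.le_zero {K : ℝ → ℝ} (hK : SymmKernel K) (x : ℝ) : K x ≤ K 0 :=
  kernel_le_zero hK.symm hK.antitone x

theorem memLp_two_inner_mul {Ω E : Type*} [MeasurableSpace Ω] {P : Measure Ω}
    [NormedAddCommGroup E] [InnerProductSpace ℝ E] [MeasurableSpace E] [BorelSpace E]
    [SecondCountableTopology E] {A B : Ω → E} {w : Ω → ℝ} (hA : Measurable A) (hB : Measurable B)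
    (hw : Measurable w) (hA4 : Integrable (fun ω => ‖A ω‖ ^ 4) P)
    (hB4 : Integrable (fun ω => ‖B ω‖ ^ 4) P) {c : ℝ} (hwc : ∀ ω, |w ω| ≤ c) :
    MemLp (fun ω => inner ℝ (A ω) (B ω) * w ω) 2 P := by
  refine ((memLp_two_norm_mul_norm hA hB hA4 hB4).const_mul c).mono'
    ((hA.inner hB).mul hw).aestronglyMeasurable (ae_of_all _ fun ω => ?_)
  rw [norm_mul, Real.norm_eq_abs, Real.norm_eq_abs, mul_comm]
  exact mul_le_mul (hwc ω) (abs_real_inner_le_norm _ _) (abs_nonneg _) ((abs_nonneg _).trans (hwc ω))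

section Weight

variable {Ω : Type*} {K : ℝ → ℝ} {Z : ℕ → Ω → ℝ}

/-- The rank weights of the sample. -/
noncomputable def weight (K : ℝ → ℝ) (h : ℝ) (n : ℕ) (Z : ℕ → Ω → ℝ) (ω : Ω) (i j : ℕ) : ℝ :=
  rankWeight K h n (fun k => Z k ω) i j

theorem weight_nonneg (hK : SymmKernel K) (h : ℝ) (n : ℕ) (ω : Ω) (i j : ℕ) :
    0 ≤ weight K h n Z ω i j := hK.nonneg _

theorem weight_le (hK : SymmKernel K) (h : ℝ) (n : ℕ) (ω : Ω) (i j : ℕ) :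
    weight K h n Z ω i j ≤ K 0 := hK.le_zero _

theorem abs_weight_le (hK : SymmKernel K) (h : ℝ) (n : ℕ) (ω : Ω) (i j : ℕ) :
    |weight K h n Z ω i j| ≤ K 0 := by
  rw [abs_of_nonneg (weight_nonneg hK h n ω i j)]
  exact weight_le hK h n ω i j

theorem weight_symm (hK : SymmKernel K) (h : ℝ) (n : ℕ) (ω : Ω) (i j : ℕ) :
    weight K h n Z ω i j = weight K h n Z ω j i := rankWeight_symm hK.symm h n _ i j

theorem measurable_weight [MeasurableSpace Ω] (hK : SymmKernel K) (hZ : ∀ i, Measurable (Z i))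
    (h : ℝ) (n i j : ℕ) : Measurable fun ω => weight K h n Z ω i j :=
  (measurable_rankWeight hK.continuous.measurable h n i j).comp (measurable_pi_lambda _ hZ)

end Weight

/-! ### Second moments of the quadratic forms involving the errors. -/

namespace CenteredSample

variable {Ω : Type*} [MeasurableSpace Ω] {P : Measure Ω}
  {E : Type*} [NormedAddCommGroup E] [InnerProductSpace ℝ E] [CompleteSpace E]
  [MeasurableSpace E]
  {U D : ℕ → Ω → E} {Z : ℕ → Ω → ℝ} {K : ℝ → ℝ}

section Moments

variable [BorelSpace E] [SecondCountableTopology E]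

theorem memLp_UU (hs : CenteredSample P U D Z) (hK : SymmKernel K) (h : ℝ) (n i j : ℕ) :
    MemLp (fun ω => inner ℝ (U i ω) (U j ω) * weight K h n Z ω i j) 2 P :=
  memLp_two_inner_mul (hs.measurable_U i) (hs.measurable_U j)
    (measurable_weight hK hs.measurable_Z h n i j) (hs.integrable_U_pow i) (hs.integrable_U_pow j)
    fun ω => abs_weight_le hK h n ω i j

theorem memLp_UD (hs : CenteredSample P U D Z) (hK : SymmKernel K) (h : ℝ) (n i j : ℕ) :
    MemLp (fun ω => inner ℝ (U i ω) (D j ω) * weight K h n Z ω i j) 2 P :=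
  memLp_two_inner_mul (hs.measurable_U i) (hs.measurable_D j)
    (measurable_weight hK hs.measurable_Z h n i j) (hs.integrable_U_pow i) (hs.integrable_D_pow j)
    fun ω => abs_weight_le hK h n ω i j

theorem memLp_sum_UU (hs : CenteredSample P U D Z) (hK : SymmKernel K) (h : ℝ) (n : ℕ) :
    MemLp (fun ω => ∑ ij ∈ (Finset.range n).offDiag,
      inner ℝ (U ij.1 ω) (U ij.2 ω) * weight K h n Z ω ij.1 ij.2) 2 P :=
  memLp_finsetSum _ fun ij _ => hs.memLp_UU hK h n ij.1 ij.2

theorem memLp_sum_UD (hs : CenteredSample P U D Z) (hK : SymmKernel K) (h : ℝ) (n : ℕ) :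
    MemLp (fun ω => ∑ ij ∈ (Finset.range n).offDiag,
      inner ℝ (U ij.1 ω) (D ij.2 ω) * weight K h n Z ω ij.1 ij.2) 2 P :=
  memLp_finsetSum _ fun ij _ => hs.memLp_UD hK h n ij.1 ij.2

end Moments

variable [IsProbabilityMeasure P]

theorem ae_row_sum_le (hs : CenteredSample P U D Z) (hK : SymmKernel K) :
    ∀ᵐ ω ∂P, ∀ (h : ℝ) (n : ℕ), 0 < h → ∀ i < n,
      ∑ j ∈ Finset.range n, weight K h n Z ω i j ≤ 2 * (K 0 + n * h) := by
  filter_upwards [hs.ae_injective] with ω hω h n hh i hi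
  exact sum_rankWeight_le hK.nonneg hK.integrable hK.integral_eq_one hK.symm hK.antitone hh
    (hω.injOn) hi

variable [BorelSpace E] [SecondCountableTopology E]

/-- The error `U i` enters exactly once. The weights depend on all the `Z`'s, including `Z i`, but
`U i` is centered given `Z i`, so the remaining factor is of the form allowed in
`integral_inner_eq_zero`. -/
theorem integral_UU_mul_UU_eq_zero (hs : CenteredSample P U D Z) (hK : SymmKernel K) (h : ℝ)
    {n i j k l : ℕ} (hi : i < n) (hj : j < n) (hk : k < n) (hl : l < n) (hji : j ≠ i)
    (hki : k ≠ i) (hli : l ≠ i) :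
    ∫ ω, (inner ℝ (U i ω) (U j ω) * weight K h n Z ω i j) *
      (inner ℝ (U k ω) (U l ω) * weight K h n Z ω k l) ∂P = 0 := by
  set zz : (ℕ → E × E × ℝ) → ℕ → ℝ := fun y m => (y m).2.2 with hzz
  have hzzm : Measurable zz := by fun_prop
  set G : (ℕ → E × E × ℝ) → E := fun y =>
    (rankWeight K h n (zz y) i j * (inner ℝ (y k).1 (y l).1 * rankWeight K h n (zz y) k l)) • (y j).1
    with hGdef
  have hw : ∀ a b, Measurable fun y => rankWeight K h n (zz y) a b := fun a b =>
    (measurable_rankWeight hK.continuous.measurable h n a b).comp hzzm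
  have hG : Measurable G := by
    refine Measurable.smul ((hw i j).mul (Measurable.mul (Measurable.inner ?_ ?_) (hw k l))) ?_ <;>
    fun_prop
  have hcongr : ∀ ω, (inner ℝ (U i ω) (U j ω) * weight K h n Z ω i j) *
      (inner ℝ (U k ω) (U l ω) * weight K h n Z ω k l) =
      inner ℝ (U i ω) (G (point U D Z ω)) := fun ω => by
    simp only [hGdef, point, hzz, weight, inner_smul_right]
    ring
  have hint := (hs.memLp_UU hK h n i j).integrable_mul (hs.memLp_UU hK h n k l)
  have hint' : Integrable (fun ω => (inner ℝ (U i ω) (U j ω) * weight K h n Z ω i j) *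
      (inner ℝ (U k ω) (U l ω) * weight K h n Z ω k l)) P := hint
  simp_rw [hcongr] at hint' ⊢
  refine hs.integral_inner_eq_zero n i hG (fun y y' hy hyi => ?_) hint'
  have hz : ∀ m < n, zz y m = zz y' m := fun m hm => by
    by_cases hmi : m = i
    · subst hmi; simp only [hzz]; rw [hyi]
    · simp only [hzz]; rw [hy m hm hmi]
  simp only [hGdef]
  rw [hy j hj hji, hy k hk hki, hy l hl hli, rankWeight_congr K h hz hi hj,
    rankWeight_congr K h hz hk hl]

/-- Only squares of single terms survive. With `K² ≤ K 0 * K` and Schur's test they add up to order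
`n · n h`, instead of the `n² (n h)²` that the absence of cancellation would allow. -/
theorem integral_sq_sum_UU_le (hs : CenteredSample P U D Z) (hK : SymmKernel K) {h : ℝ}
    (hh : 0 < h) (n : ℕ) :
    ∫ ω, (∑ ij ∈ (Finset.range n).offDiag,
      inner ℝ (U ij.1 ω) (U ij.2 ω) * weight K h n Z ω ij.1 ij.2) ^ 2 ∂P ≤
      8 * K 0 * (K 0 + n * h) * n * ∫ ω, ‖U 0 ω‖ ^ 4 ∂P := by
  set s := (Finset.range n).offDiag.filter (fun ij : ℕ × ℕ => ij.1 < ij.2) with hsdef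
  have hsub : s ⊆ (Finset.range n).offDiag := Finset.filter_subset _ _
  have h1 : ∀ ω, (∑ ij ∈ (Finset.range n).offDiag,
      inner ℝ (U ij.1 ω) (U ij.2 ω) * weight K h n Z ω ij.1 ij.2) ^ 2 =
      4 * (∑ ij ∈ s, inner ℝ (U ij.1 ω) (U ij.2 ω) * weight K h n Z ω ij.1 ij.2) ^ 2 := fun ω => by
    rw [sum_offDiag_eq_two_mul (Finset.range n)
      (f := fun i j => inner ℝ (U i ω) (U j ω) * weight K h n Z ω i j)
      (fun i j => by rw [real_inner_comm, weight_symm hK])]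
    ring
  simp_rw [h1]
  rw [integral_const_mul, integral_sq_sum_of_orthogonal s
    (ξ := fun ij ω => inner ℝ (U ij.1 ω) (U ij.2 ω) * weight K h n Z ω ij.1 ij.2)
    (fun ij _ => hs.memLp_UU hK h n ij.1 ij.2)]
  · rw [← integral_finsetSum _ fun ij _ => (hs.memLp_UU hK h n ij.1 ij.2).integrable_sq]
    have hbound : ∀ᵐ ω ∂P, ∑ ij ∈ s,
        (inner ℝ (U ij.1 ω) (U ij.2 ω) * weight K h n Z ω ij.1 ij.2) ^ 2 ≤
        2 * K 0 * (K 0 + n * h) * ∑ i ∈ Finset.range n, ‖U i ω‖ ^ 4 := by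
      filter_upwards [hs.ae_row_sum_le hK] with ω hrow
      have hterm : ∀ i j, (inner ℝ (U i ω) (U j ω) * weight K h n Z ω i j) ^ 2 ≤
          K 0 * (‖U i ω‖ ^ 2 * ‖U j ω‖ ^ 2 * weight K h n Z ω i j) := fun i j => by
        have h2 : (inner ℝ (U i ω) (U j ω)) ^ 2 ≤ ‖U i ω‖ ^ 2 * ‖U j ω‖ ^ 2 := by
          rw [← mul_pow, sq_le_sq, abs_of_nonneg (a := ‖U i ω‖ * ‖U j ω‖) (by positivity)]
          exact abs_real_inner_le_norm _ _
        have h3 : weight K h n Z ω i j ^ 2 ≤ K 0 * weight K h n Z ω i j := by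
          rw [sq]
          exact mul_le_mul_of_nonneg_right (weight_le hK h n ω i j) (weight_nonneg hK h n ω i j)
        calc (inner ℝ (U i ω) (U j ω) * weight K h n Z ω i j) ^ 2
            = (inner ℝ (U i ω) (U j ω)) ^ 2 * weight K h n Z ω i j ^ 2 := by ring
          _ ≤ (‖U i ω‖ ^ 2 * ‖U j ω‖ ^ 2) * (K 0 * weight K h n Z ω i j) :=
              mul_le_mul h2 h3 (sq_nonneg _) (by positivity)
          _ = _ := by ring
      calc _ ≤ ∑ ij ∈ (Finset.range n).offDiag,
            K 0 * (‖U ij.1 ω‖ ^ 2 * ‖U ij.2 ω‖ ^ 2 * weight K h n Z ω ij.1 ij.2) :=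
            (Finset.sum_le_sum fun ij _ => hterm ij.1 ij.2).trans
              (Finset.sum_le_sum_of_subset_of_nonneg hsub fun ij _ _ =>
                (sq_nonneg _).trans (hterm ij.1 ij.2))
        _ ≤ ∑ i ∈ Finset.range n, ∑ j ∈ Finset.range n,
            K 0 * (‖U i ω‖ ^ 2 * ‖U j ω‖ ^ 2 * weight K h n Z ω i j) :=
            sum_offDiag_le_sum_sum n
              (f := fun i j => K 0 * (‖U i ω‖ ^ 2 * ‖U j ω‖ ^ 2 * weight K h n Z ω i j))
              fun i j => (sq_nonneg _).trans (hterm i j)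
        _ = K 0 * ∑ i ∈ Finset.range n, ∑ j ∈ Finset.range n,
            ‖U i ω‖ ^ 2 * ‖U j ω‖ ^ 2 * weight K h n Z ω i j := by
            simp_rw [Finset.mul_sum]
        _ ≤ K 0 * (2 * (K 0 + n * h) / 2 *
              ∑ i ∈ Finset.range n, ((‖U i ω‖ ^ 2) ^ 2 + (‖U i ω‖ ^ 2) ^ 2)) :=
            mul_le_mul_of_nonneg_left (sum_mul_mul_weight_le (weight_nonneg hK h n ω)
              (weight_symm hK h n ω) (hrow h n hh) (fun i => ‖U i ω‖ ^ 2) fun i => ‖U i ω‖ ^ 2)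
              (hK.nonneg 0)
        _ = _ := by
            have : ∀ i, (‖U i ω‖ ^ 2) ^ 2 + (‖U i ω‖ ^ 2) ^ 2 = 2 * ‖U i ω‖ ^ 4 := fun i => by ring
            simp_rw [this, ← Finset.mul_sum]
            ring
    have hmono := integral_mono_ae
      (integrable_finsetSum _ fun ij _ => (hs.memLp_UU hK h n ij.1 ij.2).integrable_sq)
      ((integrable_finsetSum _ fun i _ => hs.integrable_U_pow i).const_mul _) hbound
    rw [integral_const_mul, integral_finsetSum _ fun i _ => hs.integrable_U_pow i] at hmono
    simp_rw [hs.integral_U_pow, Finset.sum_const, Finset.card_range, nsmul_eq_mul] at hmono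
    linarith
  · rintro ⟨i, j⟩ hij ⟨k, l⟩ hkl hne
    simp only [hsdef, Finset.mem_filter, Finset.mem_offDiag, Finset.mem_range] at hij hkl
    by_cases hik : i = k ∨ i = l
    · have hne' : i = k → j ≠ l := fun h1 h2 => hne (by rw [h1, h2])
      have := hs.integral_UU_mul_UU_eq_zero hK h (i := j) (j := i) (k := k) (l := l) hij.1.2.1
        hij.1.1 hkl.1.1 hkl.1.2.1 (by omega) (by omega) (by omega)
      simp_rw [real_inner_comm (U i _) (U j _), weight_symm hK h n _ j i] at this
      exact this
    · push Not at hik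
      exact hs.integral_UU_mul_UU_eq_zero hK h hij.1.1 hij.1.2.1 hkl.1.1 hkl.1.2.1 (by omega)
        (by omega) (by omega)

/-- Here `l = i` is allowed, since `U i` is centered given `D i` as well as `Z i`; only the errors
must have different indices, and `j ≠ i` holds off the diagonal. -/
theorem integral_UD_mul_UD_eq_zero (hs : CenteredSample P U D Z) (hK : SymmKernel K) (h : ℝ)
    {n i j k l : ℕ} (hi : i < n) (hj : j < n) (hk : k < n) (hl : l < n) (hji : j ≠ i)
    (hki : k ≠ i) :
    ∫ ω, (inner ℝ (U i ω) (D j ω) * weight K h n Z ω i j) *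
      (inner ℝ (U k ω) (D l ω) * weight K h n Z ω k l) ∂P = 0 := by
  set zz : (ℕ → E × E × ℝ) → ℕ → ℝ := fun y m => (y m).2.2 with hzz
  have hzzm : Measurable zz := by fun_prop
  set G : (ℕ → E × E × ℝ) → E := fun y =>
    (rankWeight K h n (zz y) i j *
      (inner ℝ (y k).1 (y l).2.1 * rankWeight K h n (zz y) k l)) • (y j).2.1
    with hGdef
  have hw : ∀ a b, Measurable fun y => rankWeight K h n (zz y) a b := fun a b =>
    (measurable_rankWeight hK.continuous.measurable h n a b).comp hzzm
  have hG : Measurable G := by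
    refine Measurable.smul ((hw i j).mul (Measurable.mul (Measurable.inner ?_ ?_) (hw k l))) ?_ <;>
    fun_prop
  have hcongr : ∀ ω, (inner ℝ (U i ω) (D j ω) * weight K h n Z ω i j) *
      (inner ℝ (U k ω) (D l ω) * weight K h n Z ω k l) =
      inner ℝ (U i ω) (G (point U D Z ω)) := fun ω => by
    simp only [hGdef, point, hzz, weight, inner_smul_right]
    ring
  have hint := (hs.memLp_UD hK h n i j).integrable_mul (hs.memLp_UD hK h n k l)
  have hint' : Integrable (fun ω => (inner ℝ (U i ω) (D j ω) * weight K h n Z ω i j) *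
      (inner ℝ (U k ω) (D l ω) * weight K h n Z ω k l)) P := hint
  simp_rw [hcongr] at hint' ⊢
  refine hs.integral_inner_eq_zero n i hG (fun y y' hy hyi => ?_) hint'
  have hz : ∀ m < n, zz y m = zz y' m := fun m hm => by
    by_cases hmi : m = i
    · subst hmi; simp only [hzz]; rw [hyi]
    · simp only [hzz]; rw [hy m hm hmi]
  have hl2 : (y l).2.1 = (y' l).2.1 := by
    by_cases hli : l = i
    · subst hli; rw [hyi]
    · rw [hy l hl hli]
  simp only [hGdef]
  rw [hy j hj hji, hy k hk hki, hl2, rankWeight_congr K h hz hi hj,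
    rankWeight_congr K h hz hk hl]

/-- Orthogonality now holds between the rows `ξ i`, not between single terms. Inside a row
Cauchy–Schwarz costs one factor `n h`, and Schur's test over the rows costs another, whence `n (n
h)²`. -/
theorem integral_sq_sum_UD_le (hs : CenteredSample P U D Z) (hK : SymmKernel K) {h : ℝ}
    (hh : 0 < h) (n : ℕ) :
    ∫ ω, (∑ ij ∈ (Finset.range n).offDiag,
      inner ℝ (U ij.1 ω) (D ij.2 ω) * weight K h n Z ω ij.1 ij.2) ^ 2 ∂P ≤
      2 * (K 0 + n * h) ^ 2 * n * (∫ ω, ‖U 0 ω‖ ^ 4 ∂P + ∫ ω, ‖D 0 ω‖ ^ 4 ∂P) := by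
  set ξ : ℕ → Ω → ℝ := fun i ω => ∑ j ∈ (Finset.range n).erase i,
    inner ℝ (U i ω) (D j ω) * weight K h n Z ω i j with hξ
  have hξ2 : ∀ i, MemLp (ξ i) 2 P := fun i =>
    memLp_finsetSum _ fun j _ => hs.memLp_UD hK h n i j
  have h1 : ∀ ω, ∑ ij ∈ (Finset.range n).offDiag,
      inner ℝ (U ij.1 ω) (D ij.2 ω) * weight K h n Z ω ij.1 ij.2 =
      ∑ i ∈ Finset.range n, ξ i ω := fun ω =>
    sum_offDiag_eq_sum_sum_erase n fun i j => inner ℝ (U i ω) (D j ω) * weight K h n Z ω i j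
  simp_rw [h1]
  rw [integral_sq_sum_of_orthogonal _ fun i _ => hξ2 i]
  · rw [← integral_finsetSum _ fun i _ => (hξ2 i).integrable_sq]
    have hR : 0 ≤ K 0 + n * h := add_nonneg (hK.nonneg 0) (by positivity)
    have hbound : ∀ᵐ ω ∂P, ∑ i ∈ Finset.range n, ξ i ω ^ 2 ≤
        2 * (K 0 + n * h) ^ 2 * ∑ i ∈ Finset.range n, (‖U i ω‖ ^ 4 + ‖D i ω‖ ^ 4) := by
      filter_upwards [hs.ae_row_sum_le hK] with ω hrow
      have hrow' := hrow h n hh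
      have hterm : ∀ i < n, ξ i ω ^ 2 ≤ 2 * (K 0 + n * h) *
          ∑ j ∈ Finset.range n, ‖U i ω‖ ^ 2 * ‖D j ω‖ ^ 2 * weight K h n Z ω i j := fun i hi => by
        have habs : |ξ i ω| ≤ ‖U i ω‖ * ∑ j ∈ Finset.range n, weight K h n Z ω i j * ‖D j ω‖ := by
          rw [Finset.mul_sum]
          refine (Finset.abs_sum_le_sum_abs _ _).trans ?_
          refine (Finset.sum_le_sum fun j _ => ?_).trans
            (Finset.sum_le_sum_of_subset_of_nonneg (Finset.erase_subset i _) fun j _ _ =>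
              mul_nonneg (norm_nonneg _) (mul_nonneg (weight_nonneg hK h n ω i j) (norm_nonneg _)))
          rw [abs_mul, abs_of_nonneg (weight_nonneg hK h n ω i j)]
          calc _ ≤ ‖U i ω‖ * ‖D j ω‖ * weight K h n Z ω i j :=
                mul_le_mul_of_nonneg_right (abs_real_inner_le_norm _ _) (weight_nonneg hK h n ω i j)
            _ = _ := by ring
        calc ξ i ω ^ 2 = |ξ i ω| ^ 2 := (sq_abs _).symm
          _ ≤ (‖U i ω‖ * ∑ j ∈ Finset.range n, weight K h n Z ω i j * ‖D j ω‖) ^ 2 := by gcongr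
          _ = ‖U i ω‖ ^ 2 * (∑ j ∈ Finset.range n, weight K h n Z ω i j * ‖D j ω‖) ^ 2 := mul_pow _ _ _
          _ ≤ ‖U i ω‖ ^ 2 * (2 * (K 0 + n * h) *
                ∑ j ∈ Finset.range n, weight K h n Z ω i j * ‖D j ω‖ ^ 2) := by
              gcongr
              exact sq_sum_weight_mul_le (weight_nonneg hK h n ω) hrow' (fun j => ‖D j ω‖) hi
          _ = _ := by
              simp_rw [Finset.mul_sum]
              exact Finset.sum_congr rfl fun j _ => by ring
      calc _ ≤ ∑ i ∈ Finset.range n, 2 * (K 0 + n * h) *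
          ∑ j ∈ Finset.range n, ‖U i ω‖ ^ 2 * ‖D j ω‖ ^ 2 * weight K h n Z ω i j :=
            Finset.sum_le_sum fun i hi => hterm i (Finset.mem_range.1 hi)
        _ = 2 * (K 0 + n * h) * ∑ i ∈ Finset.range n,
          ∑ j ∈ Finset.range n, ‖U i ω‖ ^ 2 * ‖D j ω‖ ^ 2 * weight K h n Z ω i j := by
            rw [Finset.mul_sum]
        _ ≤ 2 * (K 0 + n * h) * (2 * (K 0 + n * h) / 2 *
              ∑ i ∈ Finset.range n, ((‖U i ω‖ ^ 2) ^ 2 + (‖D i ω‖ ^ 2) ^ 2)) :=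
            mul_le_mul_of_nonneg_left (sum_mul_mul_weight_le (weight_nonneg hK h n ω)
              (weight_symm hK h n ω) hrow' (fun i => ‖U i ω‖ ^ 2) fun i => ‖D i ω‖ ^ 2)
              (by positivity)
        _ = _ := by
            simp_rw [← pow_mul]
            ring
    have hint : ∀ i, Integrable (fun ω => ‖U i ω‖ ^ 4 + ‖D i ω‖ ^ 4) P := fun i =>
      (hs.integrable_U_pow i).add (hs.integrable_D_pow i)
    have hmono := integral_mono_ae
      (integrable_finsetSum _ fun i _ => (hξ2 i).integrable_sq)
      ((integrable_finsetSum _ fun i _ => hint i).const_mul _) hbound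
    rw [integral_const_mul, integral_finsetSum _ fun i _ => hint i] at hmono
    simp_rw [integral_add (hs.integrable_U_pow _) (hs.integrable_D_pow _), hs.integral_U_pow,
      hs.integral_D_pow, Finset.sum_const, Finset.card_range, nsmul_eq_mul] at hmono
    linarith
  · intro i hi k hk hik
    simp only [hξ, Finset.sum_mul_sum]
    have hI : ∀ j l, Integrable (fun ω => inner ℝ (U i ω) (D j ω) * weight K h n Z ω i j *
        (inner ℝ (U k ω) (D l ω) * weight K h n Z ω k l)) P := fun j l =>
      (hs.memLp_UD hK h n i j).integrable_mul (hs.memLp_UD hK h n k l)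
    rw [integral_finsetSum _ fun j _ => integrable_finsetSum _ fun l _ => hI j l]
    refine Finset.sum_eq_zero fun j hj => ?_
    rw [integral_finsetSum _ fun l _ => hI j l]
    refine Finset.sum_eq_zero fun l hl => ?_
    rw [Finset.mem_erase] at hj hl
    exact hs.integral_UD_mul_UD_eq_zero hK h (Finset.mem_range.1 hi) (Finset.mem_range.1 hj.2)
      (Finset.mem_range.1 hk) (Finset.mem_range.1 hl.2) hj.1 hik.symm

/-- The second sample moment of the residual products, weighted by the squared kernel. -/
theorem integral_sum_sq_le (hs : CenteredSample P U D Z) (hK : SymmKernel K) {h : ℝ}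
    (hh : 0 < h) (n : ℕ) (r : ℝ) :
    Integrable (fun ω => ∑ ij ∈ (Finset.range n).offDiag,
      inner ℝ (U ij.1 ω + r • D ij.1 ω) (U ij.2 ω + r • D ij.2 ω) ^ 2 *
        weight K h n Z ω ij.1 ij.2 ^ 2) P ∧
    ∫ ω, ∑ ij ∈ (Finset.range n).offDiag,
      inner ℝ (U ij.1 ω + r • D ij.1 ω) (U ij.2 ω + r • D ij.2 ω) ^ 2 *
        weight K h n Z ω ij.1 ij.2 ^ 2 ∂P ≤
      16 * K 0 * (K 0 + n * h) * n * (∫ ω, ‖U 0 ω‖ ^ 4 ∂P + r ^ 4 * ∫ ω, ‖D 0 ω‖ ^ 4 ∂P) := by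
  have hR : 0 ≤ K 0 + n * h := add_nonneg (hK.nonneg 0) (by positivity)
  set b : Ω → ℝ := fun ω => 16 * K 0 * (K 0 + n * h) *
    ∑ i ∈ Finset.range n, (‖U i ω‖ ^ 4 + r ^ 4 * ‖D i ω‖ ^ 4) with hb
  have hint : ∀ i, Integrable (fun ω => ‖U i ω‖ ^ 4 + r ^ 4 * ‖D i ω‖ ^ 4) P := fun i =>
    (hs.integrable_U_pow i).add ((hs.integrable_D_pow i).const_mul _)
  have hbint : Integrable b P := (integrable_finsetSum _ fun i _ => hint i).const_mul _
  have hbound : ∀ᵐ ω ∂P, ∑ ij ∈ (Finset.range n).offDiag,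
      inner ℝ (U ij.1 ω + r • D ij.1 ω) (U ij.2 ω + r • D ij.2 ω) ^ 2 *
        weight K h n Z ω ij.1 ij.2 ^ 2 ≤ b ω := by
    filter_upwards [hs.ae_row_sum_le hK] with ω hrow
    set u : ℕ → E := fun i => U i ω + r • D i ω with hu
    have hu4 : ∀ i, ‖u i‖ ^ 4 ≤ 8 * (‖U i ω‖ ^ 4 + r ^ 4 * ‖D i ω‖ ^ 4) := fun i => by
      have h1 : ‖u i‖ ≤ ‖U i ω‖ + |r| * ‖D i ω‖ := by
        refine (norm_add_le _ _).trans ?_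
        rw [norm_smul, Real.norm_eq_abs]
      calc ‖u i‖ ^ 4 ≤ (‖U i ω‖ + |r| * ‖D i ω‖) ^ 4 := by gcongr
        _ ≤ 2 ^ (4 - 1) * (‖U i ω‖ ^ 4 + (|r| * ‖D i ω‖) ^ 4) :=
            add_pow_le (norm_nonneg _) (by positivity) 4
        _ = _ := by rw [mul_pow, Even.pow_abs (by decide)]; norm_num
    have hterm : ∀ i j, inner ℝ (u i) (u j) ^ 2 * weight K h n Z ω i j ^ 2 ≤
        K 0 * (‖u i‖ ^ 2 * ‖u j‖ ^ 2 * weight K h n Z ω i j) := fun i j => by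
      have h2 : (inner ℝ (u i) (u j)) ^ 2 ≤ ‖u i‖ ^ 2 * ‖u j‖ ^ 2 := by
        rw [← mul_pow, sq_le_sq, abs_of_nonneg (a := ‖u i‖ * ‖u j‖) (by positivity)]
        exact abs_real_inner_le_norm _ _
      have h3 : weight K h n Z ω i j ^ 2 ≤ K 0 * weight K h n Z ω i j := by
        rw [sq]
        exact mul_le_mul_of_nonneg_right (weight_le hK h n ω i j) (weight_nonneg hK h n ω i j)
      calc _ ≤ (‖u i‖ ^ 2 * ‖u j‖ ^ 2) * (K 0 * weight K h n Z ω i j) :=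
            mul_le_mul h2 h3 (sq_nonneg _) (by positivity)
        _ = _ := by ring
    calc _ ≤ ∑ ij ∈ (Finset.range n).offDiag,
          K 0 * (‖u ij.1‖ ^ 2 * ‖u ij.2‖ ^ 2 * weight K h n Z ω ij.1 ij.2) :=
          Finset.sum_le_sum fun ij _ => hterm ij.1 ij.2
      _ ≤ ∑ i ∈ Finset.range n, ∑ j ∈ Finset.range n,
          K 0 * (‖u i‖ ^ 2 * ‖u j‖ ^ 2 * weight K h n Z ω i j) :=
          sum_offDiag_le_sum_sum n
            (f := fun i j => K 0 * (‖u i‖ ^ 2 * ‖u j‖ ^ 2 * weight K h n Z ω i j))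
            fun i j => (by positivity : (0 : ℝ) ≤ _).trans (hterm i j)
      _ = K 0 * ∑ i ∈ Finset.range n, ∑ j ∈ Finset.range n,
          ‖u i‖ ^ 2 * ‖u j‖ ^ 2 * weight K h n Z ω i j := by
          simp_rw [Finset.mul_sum]
      _ ≤ K 0 * (2 * (K 0 + n * h) / 2 *
            ∑ i ∈ Finset.range n, ((‖u i‖ ^ 2) ^ 2 + (‖u i‖ ^ 2) ^ 2)) :=
          mul_le_mul_of_nonneg_left (sum_mul_mul_weight_le (weight_nonneg hK h n ω)
            (weight_symm hK h n ω) (hrow h n hh) (fun i => ‖u i‖ ^ 2) fun i => ‖u i‖ ^ 2)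
            (hK.nonneg 0)
      _ = 2 * K 0 * (K 0 + n * h) * ∑ i ∈ Finset.range n, ‖u i‖ ^ 4 := by
          have : ∀ i, (‖u i‖ ^ 2) ^ 2 + (‖u i‖ ^ 2) ^ 2 = 2 * ‖u i‖ ^ 4 := fun i => by ring
          simp_rw [this, ← Finset.mul_sum]
          ring
      _ ≤ 2 * K 0 * (K 0 + n * h) *
            ∑ i ∈ Finset.range n, 8 * (‖U i ω‖ ^ 4 + r ^ 4 * ‖D i ω‖ ^ 4) := by
          have := hK.nonneg 0
          gcongr with i
          exact hu4 i
      _ = b ω := by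
          simp only [hb]
          rw [← Finset.mul_sum]; ring
  have hm : Measurable fun ω => ∑ ij ∈ (Finset.range n).offDiag,
      inner ℝ (U ij.1 ω + r • D ij.1 ω) (U ij.2 ω + r • D ij.2 ω) ^ 2 *
        weight K h n Z ω ij.1 ij.2 ^ 2 := by
    refine Finset.measurable_fun_sum _ fun ij _ => ?_
    have hu : ∀ i, Measurable fun ω => U i ω + r • D i ω := fun i =>
      (hs.measurable_U i).add ((hs.measurable_D i).const_smul r)
    exact (((hu _).inner (hu _)).pow_const 2).mul
      ((measurable_weight hK hs.measurable_Z h n _ _).pow_const 2)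
  have hI : Integrable (fun ω => ∑ ij ∈ (Finset.range n).offDiag,
      inner ℝ (U ij.1 ω + r • D ij.1 ω) (U ij.2 ω + r • D ij.2 ω) ^ 2 *
        weight K h n Z ω ij.1 ij.2 ^ 2) P := by
    refine hbint.mono' hm.aestronglyMeasurable ?_
    filter_upwards [hbound] with ω hω
    rwa [Real.norm_of_nonneg (Finset.sum_nonneg fun ij _ => by positivity)]
  refine ⟨hI, (integral_mono_ae hI hbint hbound).trans (le_of_eq ?_)⟩
  simp only [hb]
  rw [integral_const_mul, integral_finsetSum _ fun i _ => hint i]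
  simp_rw [integral_add (hs.integrable_U_pow _) ((hs.integrable_D_pow _).const_mul _),
    integral_const_mul, hs.integral_U_pow, hs.integral_D_pow, Finset.sum_const, Finset.card_range,
    nsmul_eq_mul]
  ring

end CenteredSample

theorem integral_comp_eq_zero_of_indepFun {Ω τ S : Type*} [MeasurableSpace Ω] {P : Measure Ω}
    [IsProbabilityMeasure P] [MeasurableSpace τ] [MeasurableSpace S] {A : Ω → τ} {Y : Ω → S}
    (hA : Measurable A) (hY : Measurable Y) (hind : IndepFun A Y P) {f : τ × S → ℝ}
    (hf : Measurable f) (hint : Integrable (fun ω => f (A ω, Y ω)) P)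
    (hzero : ∀ y, ∫ ω, f (A ω, y) ∂P = 0) : ∫ ω, f (A ω, Y ω) ∂P = 0 := by
  have hlaw := hind.map_prod_eq_prod_map_map hA.aemeasurable hY.aemeasurable
  have : IsProbabilityMeasure (P.map A) := Measure.isProbabilityMeasure_map hA.aemeasurable
  have : IsProbabilityMeasure (P.map Y) := Measure.isProbabilityMeasure_map hY.aemeasurable
  have hAY : Measurable fun ω => (A ω, Y ω) := hA.prodMk hY
  have hfint : Integrable f ((P.map A).prod (P.map Y)) := by
    rw [← hlaw, integrable_map_measure hf.aestronglyMeasurable hAY.aemeasurable]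
    exact hint
  have h1 : ∫ ω, f (A ω, Y ω) ∂P = ∫ q, f q ∂(P.map fun ω => (A ω, Y ω)) :=
    (integral_map hAY.aemeasurable hf.aestronglyMeasurable).symm
  rw [h1, hlaw, integral_prod_symm _ hfint]
  refine integral_eq_zero_of_ae (ae_of_all _ fun y => ?_)
  have hfy : Measurable fun x => f (x, y) := hf.comp (by fun_prop)
  simp only [Pi.zero_apply]
  rw [integral_map hA.aemeasurable hfy.aestronglyMeasurable]
  exact hzero y

/-! ### From ranks to the exact distribution function. -/

namespace CenteredSample

variable {Ω : Type*} [MeasurableSpace Ω] {P : Measure Ω} [IsProbabilityMeasure P]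
  {E : Type*} [NormedAddCommGroup E] [InnerProductSpace ℝ E] [CompleteSpace E]
  [MeasurableSpace E] {U D : ℕ → Ω → E} {Z : ℕ → Ω → ℝ}

theorem iIndepFun_Z (hs : CenteredSample P U D Z) : iIndepFun Z P :=
  hs.indep.comp (fun _ q => q.2.2) fun _ => by fun_prop

theorem isProbabilityMeasure_map (hs : CenteredSample P U D Z) :
    IsProbabilityMeasure (P.map (Z 0)) :=
  Measure.isProbabilityMeasure_map (hs.measurable_Z 0).aemeasurable

theorem integral_indicator_Iic (hs : CenteredSample P U D Z) (k : ℕ) (s : ℝ) :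
    ∫ ω, (Iic s).indicator (fun _ => (1 : ℝ)) (Z k ω) ∂P = cdf (P.map (Z 0)) s := by
  have := hs.isProbabilityMeasure_map
  rw [cdf_eq_real, ← (hs.identDistrib_Z k).map_eq]
  have h1 := integral_map (μ := P) (hs.measurable_Z k).aemeasurable
    (f := (Iic s).indicator fun _ => (1 : ℝ))
    (measurable_const.indicator measurableSet_Iic).aestronglyMeasurable
  rw [← h1, integral_indicator_const _ measurableSet_Iic, smul_eq_mul, mul_one]

/-- The mean squared error of the empirical distribution function at a sample point. -/
theorem integral_sq_ecdf_sub_cdf_le (hs : CenteredSample P U D Z) {n i : ℕ} (hi : i < n) :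
    ∫ ω, (ecdf n (fun k => Z k ω) (Z i ω) - cdf (P.map (Z 0)) (Z i ω)) ^ 2 ∂P ≤ 3 / n := by
  have hn : 0 < (n : ℝ) := by exact_mod_cast (Nat.zero_le i).trans_lt hi
  set F := cdf (P.map (Z 0)) with hF
  have hFm : Measurable F := (monotone_cdf _).measurable
  set ξ : ℕ → Ω → ℝ := fun k ω => (Iic (Z i ω)).indicator (fun _ => (1 : ℝ)) (Z k ω) - F (Z i ω)
    with hξ
  have hbase : Measurable fun q : ℝ × ℝ => (Iic q.2).indicator (fun _ => (1 : ℝ)) q.1 - F q.2 := by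
    have : (fun q : ℝ × ℝ => (Iic q.2).indicator (fun _ => (1 : ℝ)) q.1) =
        {q : ℝ × ℝ | q.1 ≤ q.2}.indicator fun _ => 1 := by
      ext q; simp [indicator]
    refine Measurable.sub ?_ (hFm.comp measurable_snd)
    rw [this]
    exact measurable_const.indicator (measurableSet_le measurable_fst measurable_snd)
  have hξm : ∀ k, Measurable (ξ k) := fun k =>
    hbase.comp ((hs.measurable_Z k).prodMk (hs.measurable_Z i))
  have hξ1 : ∀ k ω, |ξ k ω| ≤ 1 := fun k ω => by
    have h0 := cdf_nonneg (P.map (Z 0)) (Z i ω)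
    have h1 := cdf_le_one (P.map (Z 0)) (Z i ω)
    simp only [hξ, indicator]
    split_ifs <;> rw [abs_le] <;> constructor <;> linarith
  have hint : ∀ k l, Integrable (fun ω => ξ k ω * ξ l ω) P := fun k l =>
    Integrable.mono' (integrable_const (1 : ℝ)) ((hξm k).mul (hξm l)).aestronglyMeasurable
      (ae_of_all _ fun ω => by
        rw [norm_mul, Real.norm_eq_abs, Real.norm_eq_abs]
        exact mul_le_one₀ (hξ1 k ω) (abs_nonneg _) (hξ1 l ω))
  have hle1 : ∀ k l, ∫ ω, ξ k ω * ξ l ω ∂P ≤ 1 := fun k l => by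
    calc ∫ ω, ξ k ω * ξ l ω ∂P ≤ ∫ _, (1 : ℝ) ∂P :=
          integral_mono (hint k l) (integrable_const _) fun ω => by
            refine (le_abs_self _).trans ?_
            rw [abs_mul]
            exact mul_le_one₀ (hξ1 k ω) (abs_nonneg _) (hξ1 l ω)
      _ = 1 := by simp
  -- With `(Z i, Z l)` frozen, the indicator built from `Z k` has mean `F (Z i)`. The argument does
  -- not require `l ≠ i`, so only the pairs with `k = l` or `k = i` remain: at most `2 n` out of `n
  -- ^ 2`.
  have hzero : ∀ k l, k ≠ l → k ≠ i → ∫ ω, ξ k ω * ξ l ω ∂P = 0 := fun k l hkl hki => by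
    have hind : IndepFun (Z k) (fun ω => (Z i ω, Z l ω)) P :=
      (hs.iIndepFun_Z.indepFun_prodMk hs.measurable_Z i l k hki.symm hkl.symm).symm
    refine integral_comp_eq_zero_of_indepFun
      (f := fun q : ℝ × ℝ × ℝ => ((Iic q.2.1).indicator (fun _ => (1 : ℝ)) q.1 - F q.2.1) *
        ((Iic q.2.1).indicator (fun _ => (1 : ℝ)) q.2.2 - F q.2.1))
      (hs.measurable_Z k) ((hs.measurable_Z i).prodMk (hs.measurable_Z l)) hind ?_ (hint k l) ?_
    · exact (hbase.comp (f := fun q : ℝ × ℝ × ℝ => (q.1, q.2.1)) (by fun_prop)).mul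
        (hbase.comp (f := fun q : ℝ × ℝ × ℝ => (q.2.2, q.2.1)) (by fun_prop))
    · rintro ⟨s, t⟩
      simp only
      rw [integral_mul_const, integral_sub, hs.integral_indicator_Iic]
      · simp [hF]
      · exact Integrable.mono' (integrable_const (1 : ℝ))
          ((measurable_const.indicator measurableSet_Iic).comp
            (hs.measurable_Z k)).aestronglyMeasurable
          (ae_of_all _ fun ω => by simp only [indicator]; split_ifs <;> simp)
      · exact integrable_const _
  have hsum : ∀ ω, (ecdf n (fun k => Z k ω) (Z i ω) - F (Z i ω)) ^ 2 =
      1 / (n : ℝ) ^ 2 * ∑ k ∈ Finset.range n, ∑ l ∈ Finset.range n, ξ k ω * ξ l ω := fun ω => by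
    rw [← Finset.sum_mul_sum, ecdf_eq_sum]
    simp only [hξ, Finset.sum_sub_distrib, Finset.sum_const, Finset.card_range, nsmul_eq_mul]
    field_simp
  simp_rw [hsum]
  rw [integral_const_mul, integral_finsetSum _ fun k _ => integrable_finsetSum _ fun l _ => hint k l]
  simp_rw [integral_finsetSum _ fun l _ => hint _ l]
  have hcount : ∑ k ∈ Finset.range n, ∑ l ∈ Finset.range n, ∫ ω, ξ k ω * ξ l ω ∂P ≤
      ∑ k ∈ Finset.range n, ∑ l ∈ Finset.range n,
        ((if k = l then (1 : ℝ) else 0) + if k = i then 1 else 0) := by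
    refine Finset.sum_le_sum fun k _ => Finset.sum_le_sum fun l _ => ?_
    by_cases hkl : k = l
    · rw [if_pos hkl]
      have := hle1 k l
      split_ifs <;> linarith
    · by_cases hki : k = i
      · rw [if_neg hkl, if_pos hki]; linarith [hle1 k l]
      · rw [hzero k l hkl hki, if_neg hkl, if_neg hki]; simp
  have hval : ∑ k ∈ Finset.range n, ∑ l ∈ Finset.range n,
      ((if k = l then (1 : ℝ) else 0) + if k = i then 1 else 0) = 2 * n := by
    simp_rw [Finset.sum_add_distrib, Finset.sum_const, Finset.card_range, nsmul_eq_mul,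
      ← Finset.mul_sum]
    simp [hi]
    rw [Finset.filter_true_of_mem fun x hx => by simpa using hx]
    simp; ring
  rw [hval] at hcount
  refine (mul_le_mul_of_nonneg_left hcount (by positivity)).trans ?_
  rw [div_mul_eq_mul_div, div_le_div_iff₀ (by positivity) hn]
  nlinarith

variable [BorelSpace E] [SecondCountableTopology E] {K : ℝ → ℝ}

/-- The probability integral transform of `Z_i`. -/
noncomputable def unif (P : Measure Ω) (Z : ℕ → Ω → ℝ) (i : ℕ) (ω : Ω) : ℝ :=
  cdf (P.map (Z 0)) (Z i ω)

/-- The kernel weights computed from the exact distribution function. -/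
noncomputable def cdfWeight (K : ℝ → ℝ) (h : ℝ) (P : Measure Ω) (Z : ℕ → Ω → ℝ) (ω : Ω)
    (i j : ℕ) : ℝ :=
  K ((unif P Z i ω - unif P Z j ω) / h)

theorem measurable_unif (hs : CenteredSample P U D Z) (i : ℕ) : Measurable (unif P Z i) :=
  (monotone_cdf _).measurable.comp (hs.measurable_Z i)

theorem measurable_cdfWeight (hs : CenteredSample P U D Z) (hK : SymmKernel K) (h : ℝ) (i j : ℕ) :
    Measurable fun ω => cdfWeight K h P Z ω i j :=
  hK.continuous.measurable.comp (((hs.measurable_unif i).sub (hs.measurable_unif j)).div_const h)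

theorem abs_cdfWeight_le (hK : SymmKernel K) (h : ℝ) (ω : Ω) (i j : ℕ) :
    |cdfWeight K h P Z ω i j| ≤ K 0 := by
  rw [cdfWeight, abs_of_nonneg (hK.nonneg _)]
  exact hK.le_zero _

theorem memLp_DD (hs : CenteredSample P U D Z) (hK : SymmKernel K) (h : ℝ) (i j : ℕ) :
    MemLp (fun ω => inner ℝ (D i ω) (D j ω) * cdfWeight K h P Z ω i j) 2 P :=
  memLp_two_inner_mul (hs.measurable_D i) (hs.measurable_D j) (hs.measurable_cdfWeight hK h i j)
    (hs.integrable_D_pow i) (hs.integrable_D_pow j) fun ω => abs_cdfWeight_le hK h ω i j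

theorem memLp_DD_rank (hs : CenteredSample P U D Z) (hK : SymmKernel K) (h : ℝ) (n i j : ℕ) :
    MemLp (fun ω => inner ℝ (D i ω) (D j ω) * weight K h n Z ω i j) 2 P :=
  memLp_two_inner_mul (hs.measurable_D i) (hs.measurable_D j)
    (measurable_weight hK hs.measurable_Z h n i j)
    (hs.integrable_D_pow i) (hs.integrable_D_pow j) fun ω => abs_weight_le hK h n ω i j

/-- Replacing the ranks by the exact distribution function. -/
theorem integral_abs_sum_DD_sub_le (hs : CenteredSample P U D Z) {L h : ℝ}
    (hL : 0 ≤ L) (hlip : ∀ u v : ℝ, |K u - K v| ≤ L * |u - v|) (hh : 0 < h) {n : ℕ} (hn : 0 < n) :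
    ∫ ω, |(∑ ij ∈ (Finset.range n).offDiag,
        inner ℝ (D ij.1 ω) (D ij.2 ω) * weight K h n Z ω ij.1 ij.2) -
      ∑ ij ∈ (Finset.range n).offDiag,
        inner ℝ (D ij.1 ω) (D ij.2 ω) * cdfWeight K h P Z ω ij.1 ij.2| ∂P ≤
      (n : ℝ) ^ 2 * (L / h * ((∫ ω, ‖D 0 ω‖ ^ 4 ∂P + 3) / Real.sqrt n)) := by
  have hn' : 0 < (n : ℝ) := by exact_mod_cast hn
  set e : ℕ → Ω → ℝ := fun i ω => ecdf n (fun k => Z k ω) (Z i ω) - unif P Z i ω with he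
  have hem : ∀ i, Measurable (e i) := fun i =>
    ((measurable_ecdf_coord n i).comp (measurable_pi_lambda _ hs.measurable_Z)).sub
      (hs.measurable_unif i)
  have hecdf : ∀ (z : ℕ → ℝ) t, 0 ≤ ecdf n z t ∧ ecdf n z t ≤ 1 := fun z t => by
    rw [ecdf_eq_rankCount]
    refine ⟨by positivity, (div_le_one hn').2 ?_⟩
    exact_mod_cast rankCount_le n z t
  have he1 : ∀ i ω, |e i ω| ≤ 1 := fun i ω => by
    have h1 := hecdf (fun k => Z k ω) (Z i ω)
    have h2 := cdf_nonneg (P.map (Z 0)) (Z i ω)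
    have h3 := cdf_le_one (P.map (Z 0)) (Z i ω)
    simp only [he, unif]
    rw [abs_le]; constructor <;> linarith
  have hesq : ∀ i, Integrable (fun ω => e i ω ^ 2) P := fun i =>
    Integrable.mono' (integrable_const (1 : ℝ)) ((hem i).pow_const 2).aestronglyMeasurable
      (ae_of_all _ fun ω => by
        rw [Real.norm_of_nonneg (sq_nonneg _), ← sq_abs]
        exact pow_le_one₀ (abs_nonneg _) (he1 i ω))
  set s := Real.sqrt n with hsdef
  have hspos : 0 < s := Real.sqrt_pos.2 hn'
  have hs2 : s ^ 2 = n := Real.sq_sqrt hn'.le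
  -- Young's inequality separates `D` from the errors `e` of the empirical distribution function,
  -- which need not be independent of it. As `E (e i)² ≤ 3 / n`, the weight `s = √n` balances the
  -- two parts at order `1 / √n`.
  set b : ℕ × ℕ → Ω → ℝ := fun ij ω => L / h *
    (1 / (2 * s) * (‖D ij.1 ω‖ ^ 4 + ‖D ij.2 ω‖ ^ 4) + s / 2 * (e ij.1 ω ^ 2 + e ij.2 ω ^ 2)) with hb
  have hbint : ∀ ij, Integrable (b ij) P := fun ij =>
    ((((hs.integrable_D_pow ij.1).add (hs.integrable_D_pow ij.2)).const_mul _).add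
      (((hesq ij.1).add (hesq ij.2)).const_mul _)).const_mul _
  have hbval : ∀ ij ∈ (Finset.range n).offDiag, ∫ ω, b ij ω ∂P ≤
      L / h * ((∫ ω, ‖D 0 ω‖ ^ 4 ∂P + 3) / s) := fun ij hij => by
    rw [Finset.mem_offDiag, Finset.mem_range, Finset.mem_range] at hij
    simp only [hb]
    rw [integral_const_mul, integral_add, integral_const_mul, integral_const_mul,
      integral_add (hs.integrable_D_pow _) (hs.integrable_D_pow _), hs.integral_D_pow ij.1,
      hs.integral_D_pow ij.2, integral_add (hesq _) (hesq _)]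
    · have h1 := hs.integral_sq_ecdf_sub_cdf_le hij.1
      have h2 := hs.integral_sq_ecdf_sub_cdf_le hij.2.1
      have hLh : 0 ≤ L / h := by positivity
      refine mul_le_mul_of_nonneg_left ?_ hLh
      calc 1 / (2 * s) * (∫ ω, ‖D 0 ω‖ ^ 4 ∂P + ∫ ω, ‖D 0 ω‖ ^ 4 ∂P) +
            s / 2 * (∫ ω, e ij.1 ω ^ 2 ∂P + ∫ ω, e ij.2 ω ^ 2 ∂P)
          ≤ 1 / (2 * s) * (∫ ω, ‖D 0 ω‖ ^ 4 ∂P + ∫ ω, ‖D 0 ω‖ ^ 4 ∂P) +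
            s / 2 * (3 / n + 3 / n) := by
            gcongr
            · exact h1
            · exact h2
        _ = (∫ ω, ‖D 0 ω‖ ^ 4 ∂P + 3) / s := by rw [← hs2]; field_simp; ring
    · exact ((hs.integrable_D_pow ij.1).add (hs.integrable_D_pow ij.2)).const_mul _
    · exact ((hesq ij.1).add (hesq ij.2)).const_mul _
  have hpt : ∀ ω, |(∑ ij ∈ (Finset.range n).offDiag,
        inner ℝ (D ij.1 ω) (D ij.2 ω) * weight K h n Z ω ij.1 ij.2) -
      ∑ ij ∈ (Finset.range n).offDiag,
        inner ℝ (D ij.1 ω) (D ij.2 ω) * cdfWeight K h P Z ω ij.1 ij.2| ≤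
      ∑ ij ∈ (Finset.range n).offDiag, b ij ω := fun ω => by
    rw [← Finset.sum_sub_distrib]
    refine (Finset.abs_sum_le_sum_abs _ _).trans (Finset.sum_le_sum fun ij _ => ?_)
    obtain ⟨i, j⟩ := ij
    simp only [hb]
    have h1 : |weight K h n Z ω i j - cdfWeight K h P Z ω i j| ≤ L / h * (|e i ω| + |e j ω|) := by
      refine (hlip _ _).trans ?_
      rw [← sub_div, abs_div, abs_of_pos hh, div_mul_eq_mul_div, mul_div_assoc]
      refine mul_le_mul_of_nonneg_left (div_le_div_of_nonneg_right ?_ hh.le) hL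
      have : ecdf n (fun k => Z k ω) (Z i ω) - ecdf n (fun k => Z k ω) (Z j ω) -
          (unif P Z i ω - unif P Z j ω) = e i ω - e j ω := by simp only [he]; ring
      rw [this]
      exact abs_sub _ _
    have h2 := abs_real_inner_le_norm (D i ω) (D j ω)
    rw [← mul_sub, abs_mul]
    calc _ ≤ (‖D i ω‖ * ‖D j ω‖) * (L / h * (|e i ω| + |e j ω|)) :=
          mul_le_mul h2 h1 (abs_nonneg _) (by positivity)
      _ = L / h * ((‖D i ω‖ * ‖D j ω‖) * |e i ω| + (‖D i ω‖ * ‖D j ω‖) * |e j ω|) := by ring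
      _ ≤ _ := by
        have hLh : 0 ≤ L / h := by positivity
        refine mul_le_mul_of_nonneg_left ?_ hLh
        have ham : ∀ a c : ℝ, a * c ≤ 1 / (2 * s) * a ^ 2 + s / 2 * c ^ 2 := fun a c => by
          have : 1 / (2 * s) * a ^ 2 + s / 2 * c ^ 2 - a * c = 1 / (2 * s) * (a - s * c) ^ 2 := by
            field_simp; ring
          have h3 : 0 ≤ 1 / (2 * s) * (a - s * c) ^ 2 := by positivity
          linarith
        have h3 := ham (‖D i ω‖ * ‖D j ω‖) |e i ω|
        have h4 := ham (‖D i ω‖ * ‖D j ω‖) |e j ω|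
        rw [sq_abs] at h3 h4
        have h5 : (‖D i ω‖ * ‖D j ω‖) ^ 2 ≤ 1 / 2 * (‖D i ω‖ ^ 4 + ‖D j ω‖ ^ 4) := by
          nlinarith [sq_nonneg (‖D i ω‖ ^ 2 - ‖D j ω‖ ^ 2)]
        have h6 : 1 / (2 * s) * (‖D i ω‖ * ‖D j ω‖) ^ 2 ≤
            1 / (2 * s) * (1 / 2 * (‖D i ω‖ ^ 4 + ‖D j ω‖ ^ 4)) := by gcongr
        nlinarith
  have hMnn : 0 ≤ L / h * ((∫ ω, ‖D 0 ω‖ ^ 4 ∂P + 3) / s) := by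
    have : 0 ≤ ∫ ω, ‖D 0 ω‖ ^ 4 ∂P := integral_nonneg fun ω => by positivity
    positivity
  refine (integral_mono_of_nonneg (ae_of_all _ fun ω => abs_nonneg _)
    (integrable_finsetSum _ fun ij _ => hbint ij) (ae_of_all _ hpt)).trans ?_
  rw [integral_finsetSum _ fun ij _ => hbint ij]
  refine (Finset.sum_le_sum hbval).trans ?_
  rw [Finset.sum_const, nsmul_eq_mul]
  refine mul_le_mul_of_nonneg_right ?_ hMnn
  rw [Finset.offDiag_card, Finset.card_range]
  calc ((n * n - n : ℕ) : ℝ) ≤ ((n * n : ℕ) : ℝ) := by exact_mod_cast Nat.sub_le _ _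
    _ = (n : ℝ) ^ 2 := by push_cast; ring

end CenteredSample

/-! ### Concentration of the U-statistic in `D`. -/

namespace CenteredSample

variable {Ω : Type*} [MeasurableSpace Ω] {P : Measure Ω} [IsProbabilityMeasure P]
  {E : Type*} [NormedAddCommGroup E] [InnerProductSpace ℝ E] [CompleteSpace E]
  [MeasurableSpace E] [BorelSpace E] [SecondCountableTopology E]
  {U D : ℕ → Ω → E} {Z : ℕ → Ω → ℝ} {K : ℝ → ℝ}

/-- The mean of the products `⟨D_i, D_j⟩ K((V_i - V_j) / h)`, `i ≠ j`. -/
noncomputable def meanDD (K : ℝ → ℝ) (h : ℝ) (P : Measure Ω) (D : ℕ → Ω → E) (Z : ℕ → Ω → ℝ) : ℝ :=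
  ∫ ω, inner ℝ (D 0 ω) (D 1 ω) * cdfWeight K h P Z ω 0 1 ∂P

/-- The kernel `⟨d, d'⟩ K((F z - F z') / h)` as a function of two sample points. -/
noncomputable def kernelDD (K : ℝ → ℝ) (h : ℝ) (P : Measure Ω) (Z : ℕ → Ω → ℝ)
    (q : (E × E × ℝ) × (E × E × ℝ)) : ℝ :=
  inner ℝ q.1.2.1 q.2.2.1 *
    K ((cdf (P.map (Z 0)) q.1.2.2 - cdf (P.map (Z 0)) q.2.2.2) / h)

theorem measurable_kernelDD (hK : SymmKernel K) (h : ℝ) :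
    Measurable (kernelDD (E := E) K h P Z) := by
  have hF : Measurable (cdf (P.map (Z 0))) := (monotone_cdf _).measurable
  refine Measurable.mul (Measurable.inner (by fun_prop) (by fun_prop))
    (hK.continuous.measurable.comp (Measurable.div_const (Measurable.sub ?_ ?_) h))
  · exact hF.comp (by fun_prop)
  · exact hF.comp (by fun_prop)

theorem identDistrib_pair (hs : CenteredSample P U D Z) {i j : ℕ} (hij : i ≠ j) :
    IdentDistrib (fun ω => ((U i ω, D i ω, Z i ω), (U j ω, D j ω, Z j ω)))
      (fun ω => ((U 0 ω, D 0 ω, Z 0 ω), (U 1 ω, D 1 ω, Z 1 ω))) P P :=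
  ((hs.ident i).prodMk ((hs.ident j).trans (hs.ident 1).symm) (hs.indep.indepFun hij)
    (hs.indep.indepFun zero_ne_one))

theorem integral_DD_eq_meanDD (hs : CenteredSample P U D Z) (hK : SymmKernel K) (h : ℝ) {i j : ℕ}
    (hij : i ≠ j) :
    ∫ ω, inner ℝ (D i ω) (D j ω) * cdfWeight K h P Z ω i j ∂P = meanDD K h P D Z :=
  ((hs.identDistrib_pair hij).comp (measurable_kernelDD hK h)).integral_eq

theorem integral_sq_DD_le (hs : CenteredSample P U D Z) (hK : SymmKernel K) (h : ℝ) (i j : ℕ) :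
    ∫ ω, (inner ℝ (D i ω) (D j ω) * cdfWeight K h P Z ω i j) ^ 2 ∂P ≤
      K 0 ^ 2 * ∫ ω, ‖D 0 ω‖ ^ 4 ∂P := by
  have hint : Integrable (fun ω => K 0 ^ 2 * (1 / 2 * (‖D i ω‖ ^ 4 + ‖D j ω‖ ^ 4))) P :=
    (((hs.integrable_D_pow i).add (hs.integrable_D_pow j)).const_mul _).const_mul _
  refine (integral_mono (hs.memLp_DD hK h i j).integrable_sq hint fun ω => ?_).trans (le_of_eq ?_)
  · have h1 : (inner ℝ (D i ω) (D j ω)) ^ 2 ≤ 1 / 2 * (‖D i ω‖ ^ 4 + ‖D j ω‖ ^ 4) := by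
      have : (inner ℝ (D i ω) (D j ω)) ^ 2 ≤ (‖D i ω‖ * ‖D j ω‖) ^ 2 := by
        rw [sq_le_sq, abs_of_nonneg (a := ‖D i ω‖ * ‖D j ω‖) (by positivity)]
        exact abs_real_inner_le_norm _ _
      nlinarith [sq_nonneg (‖D i ω‖ ^ 2 - ‖D j ω‖ ^ 2)]
    have h2 : cdfWeight K h P Z ω i j ^ 2 ≤ K 0 ^ 2 := by
      rw [sq_le_sq, abs_of_nonneg (hK.nonneg 0)]
      exact abs_cdfWeight_le hK h ω i j
    calc _ = cdfWeight K h P Z ω i j ^ 2 * (inner ℝ (D i ω) (D j ω)) ^ 2 := by ring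
      _ ≤ _ := mul_le_mul h2 h1 (sq_nonneg _) (sq_nonneg _)
  · rw [integral_const_mul, integral_const_mul,
      integral_add (hs.integrable_D_pow _) (hs.integrable_D_pow _), hs.integral_D_pow i,
      hs.integral_D_pow j]
    ring

/-- The variance of the U-statistic with kernel `⟨D_i, D_j⟩ K((V_i - V_j) / h)`. -/
theorem integral_sq_sum_DD_sub_mean_le (hs : CenteredSample P U D Z) (hK : SymmKernel K) (h : ℝ)
    (n : ℕ) :
    ∫ ω, (∑ ij ∈ (Finset.range n).offDiag,
      (inner ℝ (D ij.1 ω) (D ij.2 ω) * cdfWeight K h P Z ω ij.1 ij.2 - meanDD K h P D Z)) ^ 2 ∂P ≤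
      4 * (n : ℝ) ^ 3 * (K 0 ^ 2 * ∫ ω, ‖D 0 ω‖ ^ 4 ∂P) := by
  set M := K 0 ^ 2 * ∫ ω, ‖D 0 ω‖ ^ 4 ∂P with hM
  have hMnn : 0 ≤ M := mul_nonneg (sq_nonneg _) (integral_nonneg fun ω => by positivity)
  set m := meanDD K h P D Z with hm
  set η : ℕ × ℕ → Ω → ℝ := fun ij ω =>
    inner ℝ (D ij.1 ω) (D ij.2 ω) * cdfWeight K h P Z ω ij.1 ij.2 - m with hη
  have hη2 : ∀ a, MemLp (η a) 2 P := fun a => (hs.memLp_DD hK h a.1 a.2).sub (memLp_const m)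
  have hint : ∀ a b, Integrable (fun ω => η a ω * η b ω) P := fun a b =>
    (hη2 a).integrable_mul (hη2 b)
  have hηsq : ∀ a : ℕ × ℕ, a.1 ≠ a.2 → ∫ ω, η a ω ^ 2 ∂P ≤ M := fun a ha => by
    have h2 := hs.memLp_DD hK h a.1 a.2
    have hI := h2.integrable one_le_two
    have heq : ∀ ω, η a ω ^ 2 = (inner ℝ (D a.1 ω) (D a.2 ω) * cdfWeight K h P Z ω a.1 a.2) ^ 2 -
        (2 * m * (inner ℝ (D a.1 ω) (D a.2 ω) * cdfWeight K h P Z ω a.1 a.2) - m ^ 2) := fun ω => by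
      simp only [hη]; ring
    have hI2 : Integrable (fun ω => 2 * m * (inner ℝ (D a.1 ω) (D a.2 ω) *
        cdfWeight K h P Z ω a.1 a.2) - m ^ 2) P := (hI.const_mul _).sub (integrable_const _)
    simp_rw [heq]
    rw [integral_sub h2.integrable_sq hI2,
      integral_sub (hI.const_mul _) (integrable_const _), integral_const_mul,
      hs.integral_DD_eq_meanDD hK h ha]
    have := hs.integral_sq_DD_le hK h a.1 a.2
    simp only [integral_const, probReal_univ, one_smul]
    nlinarith [sq_nonneg m]
  have hle : ∀ a b : ℕ × ℕ, a.1 ≠ a.2 → b.1 ≠ b.2 → ∫ ω, η a ω * η b ω ∂P ≤ M := fun a b ha hb => by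
    calc ∫ ω, η a ω * η b ω ∂P ≤ ∫ ω, 1 / 2 * (η a ω ^ 2 + η b ω ^ 2) ∂P :=
          integral_mono (hint a b) (((hη2 a).integrable_sq.add (hη2 b).integrable_sq).const_mul _)
            fun ω => by
              show η a ω * η b ω ≤ 1 / 2 * (η a ω ^ 2 + η b ω ^ 2)
              nlinarith [sq_nonneg (η a ω - η b ω)]
      _ = 1 / 2 * (∫ ω, η a ω ^ 2 ∂P + ∫ ω, η b ω ^ 2 ∂P) := by
          rw [integral_const_mul, integral_add (hη2 a).integrable_sq (hη2 b).integrable_sq]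
      _ ≤ M := by linarith [hηsq a ha, hηsq b hb]
  have hmean : ∀ a : ℕ × ℕ, a.1 ≠ a.2 → ∫ ω, η a ω ∂P = 0 := fun a ha => by
    simp only [hη]
    rw [integral_sub ((hs.memLp_DD hK h a.1 a.2).integrable one_le_two) (integrable_const _),
      hs.integral_DD_eq_meanDD hK h ha]
    simp [hm]
  have hzero : ∀ i j k l : ℕ, i ≠ j → i ≠ k → i ≠ l → j ≠ k → j ≠ l →
      ∫ ω, η (i, j) ω * η (k, l) ω ∂P = 0 := fun i j k l hij hik hil hjk hjl => by
    have hind := (hs.indep.indepFun_prodMk_prodMk hs.measurable_triple i j k l hik hil hjk hjl).comp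
      ((measurable_kernelDD (P := P) (Z := Z) hK h).sub_const m)
      ((measurable_kernelDD (P := P) (Z := Z) hK h).sub_const m)
    have := hind.integral_fun_mul_eq_mul_integral (hη2 (i, j)).aestronglyMeasurable
      (hη2 (k, l)).aestronglyMeasurable
    have h0 := hmean (i, j) hij
    calc ∫ ω, η (i, j) ω * η (k, l) ω ∂P = (∫ ω, η (i, j) ω ∂P) * ∫ ω, η (k, l) ω ∂P := this
      _ = 0 := by rw [h0, zero_mul]
  have hexp : ∀ ω, (∑ a ∈ (Finset.range n).offDiag, η a ω) ^ 2 =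
      ∑ a ∈ (Finset.range n).offDiag, ∑ b ∈ (Finset.range n).offDiag, η a ω * η b ω := fun ω => by
    rw [sq, Finset.sum_mul_sum]
  change ∫ ω, (∑ a ∈ (Finset.range n).offDiag, η a ω) ^ 2 ∂P ≤ _
  simp_rw [hexp]
  rw [integral_finsetSum _ fun a _ => integrable_finsetSum _ fun b _ => hint a b]
  simp_rw [integral_finsetSum _ fun b _ => hint _ b]
  -- Pairs `a`, `b` without a common index are independent and contribute nothing. Each of the four
  -- possible coincidences leaves `n ^ 3` couples, whence the constant `4`.
  set c : ℕ × ℕ → ℕ × ℕ → ℝ := fun a b => M * ((if a.1 = b.1 then 1 else 0) +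
    (if a.1 = b.2 then 1 else 0) + (if a.2 = b.1 then 1 else 0) + (if a.2 = b.2 then 1 else 0))
    with hc
  have hcnn : ∀ a b, 0 ≤ c a b := fun a b => by
    refine mul_nonneg hMnn ?_
    split_ifs <;> norm_num
  have hterm : ∀ a ∈ (Finset.range n).offDiag, ∀ b ∈ (Finset.range n).offDiag,
      ∫ ω, η a ω * η b ω ∂P ≤ c a b := fun a ha b hb => by
    rw [Finset.mem_offDiag] at ha hb
    by_cases hd : a.1 ≠ b.1 ∧ a.1 ≠ b.2 ∧ a.2 ≠ b.1 ∧ a.2 ≠ b.2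
    · rw [hzero a.1 a.2 b.1 b.2 ha.2.2 hd.1 hd.2.1 hd.2.2.1 hd.2.2.2]
      exact hcnn a b
    · refine (hle a b ha.2.2 hb.2.2).trans ?_
      refine le_mul_of_one_le_right hMnn ?_
      split_ifs <;> first
        | exact absurd (And.intro ‹¬ a.1 = b.1› ⟨‹_›, ‹_›, ‹_›⟩) hd
        | norm_num
  have hsub : (Finset.range n).offDiag ⊆ Finset.range n ×ˢ Finset.range n := fun a ha => by
    rw [Finset.mem_offDiag] at ha
    exact Finset.mem_product.2 ⟨ha.1, ha.2.1⟩
  calc _ ≤ ∑ a ∈ (Finset.range n).offDiag, ∑ b ∈ (Finset.range n).offDiag, c a b :=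
        Finset.sum_le_sum fun a ha => Finset.sum_le_sum fun b hb => hterm a ha b hb
    _ ≤ ∑ a ∈ Finset.range n ×ˢ Finset.range n, ∑ b ∈ Finset.range n ×ˢ Finset.range n, c a b :=
        (Finset.sum_le_sum fun a _ => Finset.sum_le_sum_of_subset_of_nonneg hsub
          fun b _ _ => hcnn a b).trans
          (Finset.sum_le_sum_of_subset_of_nonneg hsub fun a _ _ =>
            Finset.sum_nonneg fun b _ => hcnn a b)
    _ = 4 * (n : ℝ) ^ 3 * M := by
        have hval : ∀ a ∈ Finset.range n ×ˢ Finset.range n,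
            ∑ b ∈ Finset.range n ×ˢ Finset.range n, c a b = 4 * n * M := fun a ha => by
          rw [Finset.mem_product] at ha
          simp only [hc]
          rw [← Finset.mul_sum, Finset.sum_product]
          have hA : ∀ t ∈ Finset.range n, ∑ x ∈ Finset.range n, ∑ _y ∈ Finset.range n,
              (if t = x then (1 : ℝ) else 0) = n := fun t ht => by
            rw [Finset.sum_comm]
            simp [Finset.mem_range.1 ht]
          simp only [Finset.sum_add_distrib, hA _ ha.1, hA _ ha.2]
          simp only [Finset.sum_const, Finset.sum_ite_eq, ha.1, ha.2,
            if_true, Finset.card_range, nsmul_eq_mul]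
          ring
        rw [Finset.sum_congr rfl hval, Finset.sum_const, Finset.card_product, Finset.card_range,
          nsmul_eq_mul]
        push_cast
        ring

end CenteredSample

/-! ### Probability integral transform and quantiles. -/

section Quantile

variable {μ : Measure ℝ} [IsProbabilityMeasure μ]

/-- The probability integral transform: the distribution function of a law without atoms maps it
to the uniform law on `[0,1]`. -/
theorem map_cdf_eq_uniform (hF : Continuous (cdf μ)) :
    μ.map (cdf μ) = volume.restrict (Icc (0 : ℝ) 1) := by
  set F := cdf μ with hFdef
  have hFm : Measurable F := (monotone_cdf μ).measurable
  have : IsProbabilityMeasure (μ.map F) := Measure.isProbabilityMeasure_map hFm.aemeasurable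
  refine Measure.ext_of_Iic _ _ fun u => ?_
  rw [Measure.map_apply hFm measurableSet_Iic, Measure.restrict_apply measurableSet_Iic]
  rcases lt_or_ge u 0 with hu | hu
  · have h1 : F ⁻¹' Iic u = ∅ := by
      ext x
      simp only [mem_preimage, mem_Iic, mem_empty_iff_false, iff_false, not_le]
      exact hu.trans_le (cdf_nonneg μ x)
    have h2 : Iic u ∩ Icc (0 : ℝ) 1 = ∅ := by
      ext x
      simp only [mem_inter_iff, mem_Iic, mem_Icc, mem_empty_iff_false, iff_false]
      rintro ⟨h, h', -⟩; linarith
    rw [h1, h2]; simp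
  rcases le_or_gt 1 u with hu1 | hu1
  · have h1 : F ⁻¹' Iic u = univ := by
      ext x
      simp only [mem_preimage, mem_Iic, mem_univ, iff_true]
      exact (cdf_le_one μ x).trans hu1
    have h2 : Iic u ∩ Icc (0 : ℝ) 1 = Icc 0 1 :=
      inter_eq_right.2 fun x hx => hx.2.trans hu1
    rw [h1, h2]; simp
  have h2 : Iic u ∩ Icc (0 : ℝ) 1 = Icc 0 u := by
    ext x
    simp only [mem_inter_iff, mem_Iic, mem_Icc]
    constructor
    · rintro ⟨h, h', -⟩; exact ⟨h', h⟩
    · rintro ⟨h, h'⟩; exact ⟨h', h, h'.trans hu1.le⟩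
  rw [h2, Real.volume_Icc, sub_zero]
  set A := F ⁻¹' Iic u with hA
  have hclosed : IsClosed A := isClosed_Iic.preimage hF
  have hlow : ∀ x ∈ A, ∀ y ≤ x, y ∈ A := fun x hx y hyx => (monotone_cdf μ hyx).trans hx
  obtain ⟨b, hb⟩ : ∃ b, u < F b :=
    ((tendsto_cdf_atTop μ).eventually (lt_mem_nhds hu1)).exists
  have hbdd : BddAbove A := ⟨b, fun x hx => by
    by_contra hlt
    exact absurd (monotone_cdf μ (not_le.1 hlt).le) (not_le.2 (lt_of_le_of_lt hx hb))⟩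
  rcases A.eq_empty_or_nonempty with hemp | hne
  · have hu0 : u ≤ 0 := by
      refine ge_of_tendsto (tendsto_cdf_atBot μ) (Eventually.of_forall fun x => ?_)
      by_contra hlt
      have : x ∈ A := (not_le.1 hlt).le
      rw [hemp] at this
      exact this
    rw [hemp, le_antisymm hu0 hu]; simp
  -- `A` is a closed lower set, bounded above because `u < 1`, hence a half-line `Iic t`. Points to
  -- the right of `t` have `F > u`, and continuity forces `F t = u`.
  · set t := sSup A
    have htA : t ∈ A := hclosed.csSup_mem hne hbdd
    have hAeq : A = Iic t :=
      Subset.antisymm (fun x hx => le_csSup hbdd hx) fun x hx => hlow t htA x hx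
    have hFt : F t = u := by
      refine le_antisymm htA ?_
      have htend : Tendsto F (𝓝[>] t) (𝓝 (F t)) := hF.continuousAt.tendsto.mono_left nhdsWithin_le_nhds
      refine ge_of_tendsto htend ?_
      filter_upwards [self_mem_nhdsWithin] with x hx
      by_contra hlt
      have : x ∈ A := (not_le.1 hlt).le
      rw [hAeq] at this
      exact absurd (mem_Ioi.1 hx) (not_lt.2 this)
    rw [hAeq, ← ofReal_cdf, ← hFdef, hFt]

/-- The quantile function `v ↦ sup {t | F t < v}`. -/
noncomputable def quantile (F : ℝ → ℝ) (v : ℝ) : ℝ :=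
  (sSup ((fun t : ℝ => (t : EReal)) '' {t | F t < v})).toReal

/-- Taking the supremum in `EReal` makes it monotone in `v` even where the set is empty or
unbounded, and monotone functions are measurable. -/
theorem measurable_quantile (F : ℝ → ℝ) : Measurable (quantile F) := by
  have hmono : Monotone fun v : ℝ => sSup ((fun t : ℝ => (t : EReal)) '' {t | F t < v}) :=
    fun v w hvw => sSup_le_sSup (image_mono fun t (ht : F t < v) => ht.trans_le hvw)
  exact hmono.measurable.ereal_toReal

/-- Inversion can fail at `z` only if `F` is constant on some interval ending at `z`, and then `F z
= F r` for a rational `r < z`. The uniform law gives no mass to these countably many values. -/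
theorem ae_quantile_cdf (hF : Continuous (cdf μ)) : ∀ᵐ z ∂μ, quantile (cdf μ) (cdf μ z) = z := by
  have hFm : Measurable (cdf μ) := (monotone_cdf μ).measurable
  have hnull : ∀ c : ℝ, ∀ᵐ z ∂μ, cdf μ z ≠ c := fun c => by
    have h1 : μ.map (cdf μ) {c} = 0 := by rw [map_cdf_eq_uniform hF]; simp
    rw [Measure.map_apply hFm (measurableSet_singleton c)] at h1
    exact (measure_eq_zero_iff_ae_notMem.1 h1).mono fun z hz => hz
  have hall : ∀ᵐ z ∂μ, ∀ r : ℚ, cdf μ z ≠ cdf μ (r : ℝ) := ae_all_iff.2 fun r => hnull _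
  filter_upwards [hall] with z hz
  have hsup : sSup ((fun t : ℝ => (t : EReal)) '' {t | cdf μ t < cdf μ z}) = (z : EReal) := by
    refine le_antisymm (sSup_le ?_) (le_of_forall_lt fun b hb => ?_)
    · rintro _ ⟨t, ht, rfl⟩
      by_contra hlt
      have hzt : z ≤ t := by
        exact EReal.coe_le_coe_iff.1 (not_le.1 hlt).le
      exact absurd (monotone_cdf μ hzt) (not_le.2 ht)
    · obtain ⟨x, hbx, hxz⟩ := EReal.lt_iff_exists_real_btwn.1 hb
      have hxz' : x < z := by exact_mod_cast hxz
      obtain ⟨r, hxr, hrz⟩ := exists_rat_btwn hxz'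
      have hr : cdf μ (r : ℝ) < cdf μ z :=
        lt_of_le_of_ne (monotone_cdf μ hrz.le) fun h => hz r h.symm
      refine hbx.trans_le (le_trans ?_ (le_sSup ⟨(r : ℝ), hr, rfl⟩))
      exact EReal.coe_le_coe_iff.2 hxr.le
  rw [quantile, hsup, EReal.toReal_coe]

end Quantile

/-! ### Kernel averages of an autocorrelation function. -/

section Autocorrelation

variable {E : Type*} [NormedAddCommGroup E] [InnerProductSpace ℝ E]
  [MeasurableSpace E] [BorelSpace E] [SecondCountableTopology E]

/-- The autocorrelation function of a square-integrable function. -/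
noncomputable def autocorr (Φ : ℝ → E) (t : ℝ) : ℝ := ∫ v, inner ℝ (Φ v) (Φ (v + t))

/-- The autocorrelation at `t` is the inner product of `Φ` with its translate by `t`; translation is
isometric on square-integrable functions and continuous in `t`. -/
theorem autocorr_continuous_bounded {Φ : ℝ → E} (hΦ : MemLp Φ 2) :
    Continuous (autocorr Φ) ∧ ∀ t, |autocorr Φ t| ≤ ‖hΦ.toLp Φ‖ ^ 2 := by
  have hmp : ∀ t : ℝ, MeasurePreserving (fun v : ℝ => v + t) volume volume := fun t =>
    measurePreserving_add_right volume t
  set G : ℝ → Lp E 2 (volume : Measure ℝ) := fun t =>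
    Lp.compMeasurePreserving (fun v : ℝ => v + t) (hmp t) (hΦ.toLp Φ) with hG
  have hGc : Continuous G := by
    set g : C(ℝ, C(ℝ, ℝ)) :=
      (ContinuousMap.mk (fun a : ℝ × ℝ => a.2 + a.1) (by fun_prop)).curry with hg
    exact Continuous.compMeasurePreservingLp (f := fun _ : ℝ => hΦ.toLp Φ) (g := g)
      continuous_const g.continuous hmp (by norm_num)
  have heq : ∀ t, autocorr Φ t = inner ℝ (hΦ.toLp Φ) (G t) := fun t => by
    rw [L2.inner_def, autocorr]
    refine integral_congr_ae ?_
    have h1 := hΦ.coeFn_toLp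
    have h2 := Lp.coeFn_compMeasurePreserving (hΦ.toLp Φ) (hmp t)
    have h3 : (fun v => (hΦ.toLp Φ : ℝ → E) (v + t)) =ᵐ[volume] fun v => Φ (v + t) :=
      (hmp t).quasiMeasurePreserving.ae_eq_comp h1
    filter_upwards [h1, h2, h3] with v e1 e2 e3
    rw [hG, e1, e2, Function.comp_apply, e3]
  refine ⟨?_, fun t => ?_⟩
  · rw [funext heq]
    exact continuous_const.inner hGc
  · rw [heq, sq]
    refine (abs_real_inner_le_norm _ _).trans ?_
    rw [hG, Lp.norm_compMeasurePreserving]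

theorem autocorr_zero (Φ : ℝ → E) : autocorr Φ 0 = ∫ v, ‖Φ v‖ ^ 2 := by
  simp [autocorr]

/-- The shear `(v, w) ↦ (v, w - v)` preserves the measure and isolates the lag; rescaling the lag by
`h` absorbs the factor `1 / h`. The symmetry of `K` takes care of the sign of the lag. -/
theorem integral_prod_kernel_eq {K : ℝ → ℝ} (hK : SymmKernel K) {Φ : ℝ → E} (hΦm : Measurable Φ)
    (hΦ1 : Integrable Φ) {h : ℝ} (hh : 0 < h) :
    1 / h * ∫ q : ℝ × ℝ, inner ℝ (Φ q.1) (Φ q.2) * K ((q.1 - q.2) / h) =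
      ∫ s, K s * autocorr Φ (h * s) := by
  set H : ℝ × ℝ → ℝ := fun q => inner ℝ (Φ q.1) (Φ (q.1 + q.2)) * K (q.2 / h) with hH
  have hHm : Measurable H :=
    (Measurable.inner (hΦm.comp measurable_fst)
      (hΦm.comp (measurable_fst.add measurable_snd))).mul
      (hK.continuous.measurable.comp (measurable_snd.div_const h))
  have hmp : MeasurePreserving (fun z : ℝ × ℝ => (z.1, -z.1 + z.2))
      ((volume : Measure ℝ).prod volume) ((volume : Measure ℝ).prod volume) :=
    measurePreserving_prod_neg_add volume volume
  have hcomp : ∀ q : ℝ × ℝ, inner ℝ (Φ q.1) (Φ q.2) * K ((q.1 - q.2) / h) =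
      H (q.1, -q.1 + q.2) := fun q => by
    simp only [hH]
    rw [add_neg_cancel_left, hK.symm]
    congr 2; ring
  have hint : Integrable (fun q : ℝ × ℝ => inner ℝ (Φ q.1) (Φ q.2) * K ((q.1 - q.2) / h))
      ((volume : Measure ℝ).prod volume) := by
    refine ((hΦ1.norm.mul_prod hΦ1.norm).mul_const (K 0)).mono' ?_ (ae_of_all _ fun q => ?_)
    · exact ((Measurable.inner (hΦm.comp measurable_fst) (hΦm.comp measurable_snd)).mul
        (hK.continuous.measurable.comp
          ((measurable_fst.sub measurable_snd).div_const h))).aestronglyMeasurable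
    · rw [norm_mul, Real.norm_eq_abs, Real.norm_of_nonneg (hK.nonneg _)]
      exact mul_le_mul (abs_real_inner_le_norm _ _) (hK.le_zero _) (hK.nonneg _) (by positivity)
  have hHint : Integrable H ((volume : Measure ℝ).prod volume) := by
    simp_rw [hcomp] at hint
    exact (hmp.integrable_comp hHm.aestronglyMeasurable).1 hint
  have h1 : ∫ q : ℝ × ℝ, inner ℝ (Φ q.1) (Φ q.2) * K ((q.1 - q.2) / h) = ∫ q : ℝ × ℝ, H q := by
    simp_rw [hcomp]
    have := integral_map (μ := (volume : Measure ℝ).prod volume) hmp.measurable.aemeasurable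
      (f := H) hHm.aestronglyMeasurable
    rw [hmp.map_eq] at this
    exact this.symm
  rw [h1, Measure.volume_eq_prod, integral_prod_symm _ hHint]
  have h2 : ∀ t, ∫ v, H (v, t) = K (t / h) * autocorr Φ t := fun t => by
    simp only [hH]
    rw [integral_mul_const, autocorr, mul_comm]
  simp_rw [h2]
  have h3 := Measure.integral_comp_mul_left (fun t => K (t / h) * autocorr Φ t) h
  rw [abs_of_pos (inv_pos.2 hh), smul_eq_mul] at h3
  rw [one_div, ← h3]
  refine integral_congr_ae (ae_of_all _ fun s => ?_)
  simp only
  rw [mul_div_cancel_left₀ _ hh.ne']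

/-- The smoothed autocorrelation tends to the squared norm as the bandwidth tends to zero. -/
theorem tendsto_integral_prod_kernel {K : ℝ → ℝ} (hK : SymmKernel K) {Φ : ℝ → E}
    (hΦm : Measurable Φ) (hΦ1 : Integrable Φ) (hΦ2 : MemLp Φ 2) {h : ℕ → ℝ} (hh : ∀ n, 0 < h n)
    (hh0 : Tendsto h atTop (𝓝 0)) :
    Tendsto (fun n => 1 / h n * ∫ q : ℝ × ℝ, inner ℝ (Φ q.1) (Φ q.2) * K ((q.1 - q.2) / h n))
      atTop (𝓝 (∫ v, ‖Φ v‖ ^ 2)) := by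
  simp_rw [fun n => integral_prod_kernel_eq hK hΦm hΦ1 (hh n)]
  obtain ⟨hc, hb⟩ := autocorr_continuous_bounded hΦ2
  have hlim : ∫ s, K s * autocorr Φ 0 = ∫ v, ‖Φ v‖ ^ 2 := by
    rw [integral_mul_const, hK.integral_eq_one, one_mul, autocorr_zero]
  rw [← hlim]
  refine tendsto_integral_of_dominated_convergence (fun s => K s * ‖hΦ2.toLp Φ‖ ^ 2) (fun n => ?_)
    (hK.integrable.mul_const _) (fun n => ae_of_all _ fun s => ?_) (ae_of_all _ fun s => ?_)
  · exact (hK.continuous.mul (hc.comp (continuous_const.mul continuous_id))).aestronglyMeasurable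
  · rw [norm_mul, Real.norm_of_nonneg (hK.nonneg s), Real.norm_eq_abs]
    exact mul_le_mul_of_nonneg_left (hb _) (hK.nonneg s)
  · have : Tendsto (fun n => h n * s) atTop (𝓝 0) := by simpa using hh0.mul_const s
    exact ((hc.tendsto 0).comp this).const_mul (K s)

end Autocorrelation

/-! ### The limit of the mean of the U-statistic. -/

namespace CenteredSample

variable {Ω : Type*} [MeasurableSpace Ω] {P : Measure Ω} [IsProbabilityMeasure P]
  {E : Type*} [NormedAddCommGroup E] [InnerProductSpace ℝ E] [CompleteSpace E]
  [MeasurableSpace E] [BorelSpace E] [SecondCountableTopology E]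
  {U D : ℕ → Ω → E} {Z : ℕ → Ω → ℝ} {K : ℝ → ℝ}

theorem memLp_two_D (hs : CenteredSample P U D Z) (i : ℕ) : MemLp (D i) 2 P := by
  rw [memLp_two_iff_integrable_sq_norm (hs.measurable_D i).aestronglyMeasurable]
  refine ((integrable_const (1 : ℝ)).add (hs.integrable_D_pow i)).mono'
    ((hs.measurable_D i).norm.pow_const 2).aestronglyMeasurable (ae_of_all _ fun ω => ?_)
  rw [Real.norm_of_nonneg (by positivity), Pi.add_apply]
  nlinarith [sq_nonneg (‖D i ω‖ ^ 2 - 1), sq_nonneg ‖D i ω‖]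

/-- `ψ` is a regression function of `D` on `Z`. -/
def IsRegression (P : Measure Ω) (D : ℕ → Ω → E) (Z : ℕ → Ω → ℝ) (ψ : ℝ → E) : Prop :=
  Measurable ψ ∧ P[D 0 | sigmaGen (Z 0)] = ψ ∘ Z 0

/-- Doob–Dynkin factorization of a `σ(Z 0)`-measurable function. -/
theorem exists_isRegression (P : Measure Ω) (D : ℕ → Ω → E) (Z : ℕ → Ω → ℝ) :
    ∃ ψ : ℝ → E, IsRegression P D Z ψ := by
  obtain ⟨ψ, hψ, heq⟩ :=
    (stronglyMeasurable_condExp (f := D 0) (m := sigmaGen (Z 0)) (μ := P)).exists_eq_measurable_comp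
  exact ⟨ψ, hψ.measurable, heq⟩

variable {ψ : ℝ → E}

theorem memLp_two_regression (hs : CenteredSample P U D Z) (hψ : IsRegression P D Z ψ) (i : ℕ) :
    MemLp (fun ω => ψ (Z i ω)) 2 P := by
  have h0 : MemLp (ψ ∘ Z 0) 2 P := by
    rw [← hψ.2]
    exact (hs.memLp_two_D 0).condExp one_le_two
  exact ((hs.identDistrib_Z i).comp hψ.1).memLp_iff.2 h0

theorem integral_inner_residual_eq_zero (hs : CenteredSample P U D Z) (hψ : IsRegression P D Z ψ)
    (i : ℕ) (f : ℝ → E) (hf : Measurable f)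
    (hint : Integrable (fun ω => inner ℝ (D i ω - ψ (Z i ω)) (f (Z i ω))) P) :
    ∫ ω, inner ℝ (D i ω - ψ (Z i ω)) (f (Z i ω)) ∂P = 0 := by
  have hF : Measurable fun q : E × E × ℝ => (inner ℝ (q.2.1 - ψ q.2.2) (f q.2.2) : ℝ) := by
    have h1 : Measurable fun q : E × E × ℝ => ψ q.2.2 := hψ.1.comp (by fun_prop)
    have h2 : Measurable fun q : E × E × ℝ => f q.2.2 := hf.comp (by fun_prop)
    exact Measurable.inner (Measurable.sub (by fun_prop) h1) h2
  have hid := (hs.ident i).comp hF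
  have hD : Integrable (D 0) P := (hs.memLp_two_D 0).integrable one_le_two
  have hψi : Integrable (ψ ∘ Z 0) P := (hs.memLp_two_regression hψ 0).integrable one_le_two
  have hm : sigmaGen (Z 0) ≤ ‹MeasurableSpace Ω› := (hs.measurable_Z 0).comap_le
  have hψs : StronglyMeasurable[sigmaGen (Z 0)] (ψ ∘ Z 0) := by
    rw [← hψ.2]; exact stronglyMeasurable_condExp
  have hcond : P[fun ω => D 0 ω - ψ (Z 0 ω) | sigmaGen (Z 0)] =ᵐ[P] 0 := by
    have h1 := condExp_sub hD hψi (sigmaGen (Z 0))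
    rw [condExp_of_stronglyMeasurable hm hψs hψi, hψ.2, sub_self] at h1
    exact h1
  have : ∫ ω, inner ℝ (D 0 ω - ψ (Z 0 ω)) (f (Z 0 ω)) ∂P = 0 :=
    FunctionalTest.integral_inner_comp_eq_zero (hs.measurable_Z 0) (hD.sub hψi) hcond hf
      (hid.integrable_iff.1 hint)
  rw [← this]
  exact hid.integral_eq

theorem integrable_inner_mul_cdfWeight (hs : CenteredSample P U D Z) (hK : SymmKernel K) (h : ℝ)
    {A B : Ω → E} (hA : MemLp A 2 P) (hB : MemLp B 2 P) (i j : ℕ) :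
    Integrable (fun ω => inner ℝ (A ω) (B ω) * cdfWeight K h P Z ω i j) P := by
  refine ((hA.norm.integrable_mul hB.norm).mul_const (K 0)).mono'
    ((hA.aestronglyMeasurable.inner hB.aestronglyMeasurable).mul
      (hs.measurable_cdfWeight hK h i j).aestronglyMeasurable) (ae_of_all _ fun ω => ?_)
  rw [norm_mul, Real.norm_eq_abs, Real.norm_eq_abs]
  exact mul_le_mul (abs_real_inner_le_norm _ _) (abs_cdfWeight_le hK h ω i j) (abs_nonneg _)
    (mul_nonneg (norm_nonneg _) (norm_nonneg _))

/-- In the mean of the U-statistic, `D` may be replaced by its regression on `Z`. -/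
theorem meanDD_eq_regression (hs : CenteredSample P U D Z) (hK : SymmKernel K) (h : ℝ)
    (hψ : IsRegression P D Z ψ) :
    meanDD K h P D Z =
      ∫ ω, inner ℝ (ψ (Z 0 ω)) (ψ (Z 1 ω)) * cdfWeight K h P Z ω 0 1 ∂P := by
  have hF : Measurable (cdf (P.map (Z 0))) := (monotone_cdf _).measurable
  have hψ2 := hs.memLp_two_regression hψ
  have hDm := hs.measurable_D
  have hψm : ∀ i, Measurable fun ω => ψ (Z i ω) := fun i => hψ.1.comp (hs.measurable_Z i)
  have hA : ∀ i, Measurable fun ω => D i ω - ψ (Z i ω) := fun i => (hDm i).sub (hψm i)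
  have hA2 : ∀ i, MemLp (fun ω => D i ω - ψ (Z i ω)) 2 P := fun i =>
    (hs.memLp_two_D i).sub (hψ2 i)
  have hind01 : IndepFun (fun ω => (D 0 ω - ψ (Z 0 ω), Z 0 ω)) (fun ω => (D 1 ω, Z 1 ω)) P :=
    (hs.indep.indepFun zero_ne_one).comp
      (φ := fun q : E × E × ℝ => (q.2.1 - ψ q.2.2, q.2.2)) (ψ := fun q : E × E × ℝ => q.2)
      (((by fun_prop : Measurable fun q : E × E × ℝ => q.2.1).sub
        (hψ.1.comp (by fun_prop))).prodMk (by fun_prop)) (by fun_prop)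
  have hind10 : IndepFun (fun ω => (D 1 ω - ψ (Z 1 ω), Z 1 ω)) (Z 0) P :=
    (hs.indep.indepFun one_ne_zero).comp
      (φ := fun q : E × E × ℝ => (q.2.1 - ψ q.2.2, q.2.2)) (ψ := fun q : E × E × ℝ => q.2.2)
      (((by fun_prop : Measurable fun q : E × E × ℝ => q.2.1).sub
        (hψ.1.comp (by fun_prop))).prodMk (by fun_prop)) (by fun_prop)
  -- The two arguments are replaced one at a time. The residual of index `0` is orthogonal to every
  -- function of `Z 0` and of the independent pair `(D 1, Z 1)`, which covers the weighted `D 1`.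
  have step0 : ∫ ω, inner ℝ (D 0 ω - ψ (Z 0 ω)) (D 1 ω) * cdfWeight K h P Z ω 0 1 ∂P = 0 := by
    have hcongr : ∀ ω, inner ℝ (D 0 ω - ψ (Z 0 ω)) (D 1 ω) * cdfWeight K h P Z ω 0 1 =
        inner ℝ (D 0 ω - ψ (Z 0 ω)) (K ((cdf (P.map (Z 0)) (Z 0 ω) -
          cdf (P.map (Z 0)) (Z 1 ω)) / h) • D 1 ω) := fun ω => by
      rw [inner_smul_right, cdfWeight, mul_comm]; rfl
    have hint := hs.integrable_inner_mul_cdfWeight hK h (hA2 0) (hs.memLp_two_D 1) 0 1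
    simp_rw [hcongr] at hint ⊢
    exact integral_inner_comp_eq_zero_of_indepFun (T := Z 0) (Y := fun ω => (D 1 ω, Z 1 ω))
      (f := fun q : ℝ × E × ℝ => K ((cdf (P.map (Z 0)) q.1 -
          cdf (P.map (Z 0)) q.2.2) / h) • q.2.1) (hA 0) (hs.measurable_Z 0)
      ((hDm 1).prodMk (hs.measurable_Z 1)) (hs.integral_inner_residual_eq_zero hψ 0) hind01
      ((hK.continuous.measurable.comp (((hF.comp (by fun_prop)).sub
        (hF.comp (by fun_prop))).div_const h)).smul (by fun_prop)) hint
  have step1 : ∫ ω, inner ℝ (ψ (Z 0 ω)) (D 1 ω - ψ (Z 1 ω)) * cdfWeight K h P Z ω 0 1 ∂P = 0 := by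
    have hcongr : ∀ ω, inner ℝ (ψ (Z 0 ω)) (D 1 ω - ψ (Z 1 ω)) * cdfWeight K h P Z ω 0 1 =
        inner ℝ (D 1 ω - ψ (Z 1 ω)) (K ((cdf (P.map (Z 0)) (Z 0 ω) -
          cdf (P.map (Z 0)) (Z 1 ω)) / h) • ψ (Z 0 ω)) := fun ω => by
      rw [inner_smul_right, cdfWeight, mul_comm, real_inner_comm]; rfl
    have hint := hs.integrable_inner_mul_cdfWeight hK h (hψ2 0) (hA2 1) 0 1
    simp_rw [hcongr] at hint ⊢
    exact integral_inner_comp_eq_zero_of_indepFun (T := Z 1) (Y := Z 0)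
      (f := fun q : ℝ × ℝ => K ((cdf (P.map (Z 0)) q.2 -
          cdf (P.map (Z 0)) q.1) / h) • ψ q.2) (hA 1) (hs.measurable_Z 1)
      (hs.measurable_Z 0) (hs.integral_inner_residual_eq_zero hψ 1) hind10
      ((hK.continuous.measurable.comp (((hF.comp measurable_snd).sub
        (hF.comp measurable_fst)).div_const h)).smul (hψ.1.comp measurable_snd)) hint
  have hsplit : ∀ ω, inner ℝ (D 0 ω) (D 1 ω) * cdfWeight K h P Z ω 0 1 =
      inner ℝ (D 0 ω - ψ (Z 0 ω)) (D 1 ω) * cdfWeight K h P Z ω 0 1 +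
      (inner ℝ (ψ (Z 0 ω)) (D 1 ω - ψ (Z 1 ω)) * cdfWeight K h P Z ω 0 1 +
        inner ℝ (ψ (Z 0 ω)) (ψ (Z 1 ω)) * cdfWeight K h P Z ω 0 1) := fun ω => by
    rw [inner_sub_left, inner_sub_right]; ring
  have i1 := hs.integrable_inner_mul_cdfWeight hK h (hA2 0) (hs.memLp_two_D 1) 0 1
  have i2 := hs.integrable_inner_mul_cdfWeight hK h (hψ2 0) (hA2 1) 0 1
  have i3 := hs.integrable_inner_mul_cdfWeight hK h (hψ2 0) (hψ2 1) 0 1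
  have i23 : Integrable (fun ω => inner ℝ (ψ (Z 0 ω)) (D 1 ω - ψ (Z 1 ω)) *
      cdfWeight K h P Z ω 0 1 + inner ℝ (ψ (Z 0 ω)) (ψ (Z 1 ω)) * cdfWeight K h P Z ω 0 1) P :=
    i2.add i3
  rw [meanDD]
  simp_rw [hsplit]
  rw [integral_add i1 i23, integral_add i2 i3, step0, step1, zero_add, zero_add]

theorem map_unif (hs : CenteredSample P U D Z) (i : ℕ) :
    P.map (unif P Z i) = volume.restrict (Icc (0 : ℝ) 1) := by
  have := hs.isProbabilityMeasure_map
  have h1 : unif P Z i = cdf (P.map (Z 0)) ∘ Z i := rfl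
  rw [h1, ← Measure.map_map (monotone_cdf _).measurable (hs.measurable_Z i),
    (hs.identDistrib_Z i).map_eq]
  exact map_cdf_eq_uniform hs.continuous_cdf

theorem ae_quantile_unif (hs : CenteredSample P U D Z) (i : ℕ) :
    ∀ᵐ ω ∂P, quantile (cdf (P.map (Z 0))) (unif P Z i ω) = Z i ω := by
  have := hs.isProbabilityMeasure_map
  have h1 := ae_quantile_cdf hs.continuous_cdf
  rw [← (hs.identDistrib_Z i).map_eq] at h1
  have h2 := ae_of_ae_map (hs.measurable_Z i).aemeasurable h1
  rw [(hs.identDistrib_Z i).map_eq] at h2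
  exact h2

/-- The mean of the U-statistic tends to `𝔼‖𝔼[D | Z]‖²`. -/
theorem tendsto_meanDD (hs : CenteredSample P U D Z) (hK : SymmKernel K)
    (hψ : IsRegression P D Z ψ) {h : ℕ → ℝ} (hh : ∀ n, 0 < h n) (hh0 : Tendsto h atTop (𝓝 0)) :
    Tendsto (fun n => 1 / h n * meanDD K (h n) P D Z) atTop
      (𝓝 (∫ ω, ‖ψ (Z 0 ω)‖ ^ 2 ∂P)) := by
  -- The regression rewritten as a function of the uniform variable `F (Z)`. `F` need not be
  -- injective, but the quantile function recovers `Z` almost surely.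
  set φ : ℝ → E := fun v => ψ (quantile (cdf (P.map (Z 0))) v) with hφ
  have hφm : Measurable φ := hψ.1.comp (measurable_quantile _)
  -- Extension by zero turns integrals over the unit square into integrals over the plane, where
  -- translations are available.
  set Φ : ℝ → E := (Icc (0 : ℝ) 1).indicator φ with hΦ
  have hΦm : Measurable Φ := hφm.indicator measurableSet_Icc
  have hφZ : ∀ i, ∀ᵐ ω ∂P, φ (unif P Z i ω) = ψ (Z i ω) := fun i =>
    (hs.ae_quantile_unif i).mono fun ω hω => by simp only [hφ, hω]
  have hφ2 : MemLp φ 2 (volume.restrict (Icc (0 : ℝ) 1)) := by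
    rw [← hs.map_unif 0, memLp_map_measure_iff hφm.aestronglyMeasurable
      (hs.measurable_unif 0).aemeasurable]
    exact (memLp_congr_ae (hφZ 0)).2 (hs.memLp_two_regression hψ 0)
  have hΦ2 : MemLp Φ 2 := (memLp_indicator_iff_restrict measurableSet_Icc).2 hφ2
  have hΦ1 : Integrable Φ := (integrable_indicator_iff measurableSet_Icc).2
    (hφ2.integrable one_le_two)
  have hlim : ∫ v, ‖Φ v‖ ^ 2 = ∫ ω, ‖ψ (Z 0 ω)‖ ^ 2 ∂P := by
    have h1 : ∀ v, ‖Φ v‖ ^ 2 = (Icc (0 : ℝ) 1).indicator (fun v => ‖φ v‖ ^ 2) v := fun v => by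
      by_cases hv : v ∈ Icc (0 : ℝ) 1 <;> simp [hΦ, indicator, hv]
    simp_rw [h1]
    rw [integral_indicator measurableSet_Icc, ← hs.map_unif 0,
      integral_map (hs.measurable_unif 0).aemeasurable
        (hφm.norm.pow_const 2).aestronglyMeasurable]
    exact integral_congr_ae ((hφZ 0).mono fun ω hω => by simp only [hω])
  have hmean : ∀ n, meanDD K (h n) P D Z =
      ∫ q : ℝ × ℝ, inner ℝ (Φ q.1) (Φ q.2) * K ((q.1 - q.2) / h n) := fun n => by
    rw [hs.meanDD_eq_regression hK (h n) hψ]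
    set f : ℝ × ℝ → ℝ := fun q => inner ℝ (φ q.1) (φ q.2) * K ((q.1 - q.2) / h n) with hf
    have hfm : Measurable f :=
      (Measurable.inner (hφm.comp measurable_fst) (hφm.comp measurable_snd)).mul
        (hK.continuous.measurable.comp ((measurable_fst.sub measurable_snd).div_const _))
    have hVind : IndepFun (unif P Z 0) (unif P Z 1) P :=
      (hs.indepFun_Z zero_ne_one).comp (monotone_cdf _).measurable (monotone_cdf _).measurable
    have hlaw := hVind.map_prod_eq_prod_map_map (hs.measurable_unif 0).aemeasurable
      (hs.measurable_unif 1).aemeasurable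
    rw [hs.map_unif 0, hs.map_unif 1, Measure.prod_restrict] at hlaw
    have h1 : ∫ ω, inner ℝ (ψ (Z 0 ω)) (ψ (Z 1 ω)) * cdfWeight K (h n) P Z ω 0 1 ∂P =
        ∫ ω, f (unif P Z 0 ω, unif P Z 1 ω) ∂P := by
      refine integral_congr_ae ?_
      filter_upwards [hφZ 0, hφZ 1] with ω h0 h1
      simp only [hf, h0, h1, cdfWeight]
    rw [h1, ← integral_map (μ := P) ((hs.measurable_unif 0).prodMk
      (hs.measurable_unif 1)).aemeasurable hfm.aestronglyMeasurable, hlaw,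
      ← integral_indicator (measurableSet_Icc.prod measurableSet_Icc)]
    refine integral_congr_ae (ae_of_all _ fun q => ?_)
    by_cases h0 : q.1 ∈ Icc (0 : ℝ) 1 <;> by_cases h1 : q.2 ∈ Icc (0 : ℝ) 1 <;>
      simp only [hΦ, hf, indicator, h0, h1, mem_prod, and_self, and_false, false_and, if_true,
        if_false, inner_zero_left, inner_zero_right, zero_mul]
  simp_rw [hmean, ← hlim]
  exact tendsto_integral_prod_kernel hK hΦm hΦ1 hΦ2 hh hh0

theorem integral_sq_regression_pos (hs : CenteredSample P U D Z) (hψ : IsRegression P D Z ψ)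
    (hne : ¬ (P[D 0 | sigmaGen (Z 0)] =ᵐ[P] 0)) : 0 < ∫ ω, ‖ψ (Z 0 ω)‖ ^ 2 ∂P := by
  have hnn : 0 ≤ ∫ ω, ‖ψ (Z 0 ω)‖ ^ 2 ∂P := integral_nonneg fun ω => by positivity
  refine lt_of_le_of_ne hnn fun h0 => hne ?_
  have hint : Integrable (fun ω => ‖ψ (Z 0 ω)‖ ^ 2) P :=
    (hs.memLp_two_regression hψ 0).integrable_norm_pow two_ne_zero
  have := (integral_eq_zero_iff_of_nonneg (fun ω => by positivity) hint).1 h0.symm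
  rw [hψ.2]
  filter_upwards [this] with ω hω
  simpa using hω

end CenteredSample

/-! ### Probabilities of the exceptional events. -/

/-- Markov's inequality, with the mean measured relative to the threshold `b n`, so that only the
ratio `ρ n` has to vanish. -/
theorem tendsto_measure_ge_zero {Ω : Type*} [MeasurableSpace Ω] {P : Measure Ω}
    [IsProbabilityMeasure P] {f : ℕ → Ω → ℝ} {b ρ : ℕ → ℝ} (hnn : ∀ n ω, 0 ≤ f n ω)
    (hint : ∀ n, Integrable (f n) P)
    (hle : ∀ᶠ n in atTop, 0 < b n ∧ ∫ ω, f n ω ∂P ≤ ρ n * b n) (hρ : Tendsto ρ atTop (𝓝 0)) :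
    Tendsto (fun n => P {ω | b n ≤ f n ω}) atTop (𝓝 0) := by
  have hρ' : Tendsto (fun n => ENNReal.ofReal (ρ n)) atTop (𝓝 0) := by
    simpa using ENNReal.tendsto_ofReal hρ
  refine tendsto_of_tendsto_of_tendsto_of_le_of_le' tendsto_const_nhds hρ'
    (Eventually.of_forall fun n => zero_le) ?_
  filter_upwards [hle] with n ⟨hb, hn⟩
  have h1 := mul_meas_ge_le_integral_of_nonneg (ae_of_all P (hnn n)) (hint n) (b n)
  have h2 : P.real {ω | b n ≤ f n ω} ≤ ρ n := by
    have := h1.trans hn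
    rw [mul_comm (ρ n)] at this
    exact le_of_mul_le_mul_left this hb
  rw [← ofReal_measureReal]
  exact ENNReal.ofReal_le_ofReal h2

section Statistics

variable {Ω : Type*} {E : Type*} [NormedAddCommGroup E] [InnerProductSpace ℝ E]

/-- The statistic `Q_n` for the responses `U_i + r D_i`. -/
noncomputable def Qsum (K : ℝ → ℝ) (h : ℝ) (n : ℕ) (r : ℝ) (U D : ℕ → Ω → E) (Z : ℕ → Ω → ℝ)
    (ω : Ω) : ℝ :=
  1 / ((n : ℝ) * ((n : ℝ) - 1)) * ∑ ij ∈ (Finset.range n).offDiag,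
    inner ℝ (U ij.1 ω + r • D ij.1 ω) (U ij.2 ω + r • D ij.2 ω) * (1 / h) *
      weight K h n Z ω ij.1 ij.2

/-- The variance estimate for the responses `U_i + r D_i`. -/
noncomputable def Vsum (K : ℝ → ℝ) (h : ℝ) (n : ℕ) (r : ℝ) (U D : ℕ → Ω → E) (Z : ℕ → Ω → ℝ)
    (ω : Ω) : ℝ :=
  2 / ((n : ℝ) * ((n : ℝ) - 1) * h) * ∑ ij ∈ (Finset.range n).offDiag,
    inner ℝ (U ij.1 ω + r • D ij.1 ω) (U ij.2 ω + r • D ij.2 ω) ^ 2 *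
      weight K h n Z ω ij.1 ij.2 ^ 2

variable {K : ℝ → ℝ} {U D : ℕ → Ω → E} {Z : ℕ → Ω → ℝ}

/-- Expansion of the quadratic form in the responses `U_i + r D_i`. -/
theorem sum_inner_expand (hK : SymmKernel K) (h : ℝ) (n : ℕ) (r : ℝ) (ω : Ω) :
    ∑ ij ∈ (Finset.range n).offDiag,
      inner ℝ (U ij.1 ω + r • D ij.1 ω) (U ij.2 ω + r • D ij.2 ω) * weight K h n Z ω ij.1 ij.2 =
    (∑ ij ∈ (Finset.range n).offDiag,
      inner ℝ (U ij.1 ω) (U ij.2 ω) * weight K h n Z ω ij.1 ij.2) +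
    2 * r * (∑ ij ∈ (Finset.range n).offDiag,
      inner ℝ (U ij.1 ω) (D ij.2 ω) * weight K h n Z ω ij.1 ij.2) +
    r ^ 2 * ∑ ij ∈ (Finset.range n).offDiag,
      inner ℝ (D ij.1 ω) (D ij.2 ω) * weight K h n Z ω ij.1 ij.2 := by
  have hswap := sum_offDiag_swap (Finset.range n)
    fun i j => inner ℝ (U i ω) (D j ω) * weight K h n Z ω i j
  have hterm : ∀ ij : ℕ × ℕ,
      inner ℝ (U ij.1 ω + r • D ij.1 ω) (U ij.2 ω + r • D ij.2 ω) * weight K h n Z ω ij.1 ij.2 =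
      inner ℝ (U ij.1 ω) (U ij.2 ω) * weight K h n Z ω ij.1 ij.2 +
      r * (inner ℝ (U ij.1 ω) (D ij.2 ω) * weight K h n Z ω ij.1 ij.2) +
      r * (inner ℝ (U ij.2 ω) (D ij.1 ω) * weight K h n Z ω ij.2 ij.1) +
      r ^ 2 * (inner ℝ (D ij.1 ω) (D ij.2 ω) * weight K h n Z ω ij.1 ij.2) := fun ij => by
    rw [inner_add_left, inner_add_right, inner_add_right, inner_smul_left, inner_smul_left,
      inner_smul_right, inner_smul_right, weight_symm hK h n ω ij.2 ij.1,
      real_inner_comm (D ij.1 ω) (U ij.2 ω)]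
    simp only [conj_trivial]
    ring
  simp_rw [hterm, Finset.sum_add_distrib, ← Finset.mul_sum]
  rw [← hswap]
  ring

theorem Qsum_eq (h : ℝ) (n : ℕ) (r : ℝ) (ω : Ω) :
    Qsum K h n r U D Z ω = 1 / ((n : ℝ) * ((n : ℝ) - 1)) * (1 / h) *
      ∑ ij ∈ (Finset.range n).offDiag,
        inner ℝ (U ij.1 ω + r • D ij.1 ω) (U ij.2 ω + r • D ij.2 ω) *
          weight K h n Z ω ij.1 ij.2 := by
  rw [Qsum, mul_assoc]
  congr 1
  rw [Finset.mul_sum]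
  exact Finset.sum_congr rfl fun ij _ => by ring

theorem Vsum_nonneg {h : ℝ} (hh : 0 < h) {n : ℕ} (hn : 1 ≤ n) (r : ℝ) (ω : Ω) :
    0 ≤ Vsum K h n r U D Z ω := by
  have : (1 : ℝ) ≤ n := by exact_mod_cast hn
  refine mul_nonneg (div_nonneg zero_le_two ?_) (Finset.sum_nonneg fun ij _ => by positivity)
  have : 0 ≤ (n : ℝ) - 1 := by linarith
  positivity

/-- If the variance estimate vanishes, so does every product of an inner product and a weight, and
`Qsum` with them. A positive `Qsum` thus rules out division by zero in the standardized statistic.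
-/
theorem Vsum_pos_of_Qsum_pos {h : ℝ} (hh : 0 < h) {n : ℕ} (hn : 2 ≤ n) {r : ℝ} {ω : Ω}
    (hQ : 0 < Qsum K h n r U D Z ω) : 0 < Vsum K h n r U D Z ω := by
  refine lt_of_le_of_ne (Vsum_nonneg hh (by omega) r ω) fun h0 => hQ.ne' ?_
  have hn' : (2 : ℝ) ≤ n := by exact_mod_cast hn
  have hpre : (2 : ℝ) / ((n : ℝ) * ((n : ℝ) - 1) * h) ≠ 0 := by
    have : 0 < (n : ℝ) - 1 := by linarith
    positivity
  have hsum := (mul_eq_zero.1 h0.symm).resolve_left hpre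
  rw [Finset.sum_eq_zero_iff_of_nonneg fun ij _ => by positivity] at hsum
  rw [Qsum, Finset.sum_eq_zero, mul_zero]
  intro ij hij
  have h1 := hsum ij hij
  rw [← mul_pow, sq_eq_zero_iff] at h1
  rw [mul_right_comm, h1, zero_mul]

end Statistics

namespace CenteredSample

variable {Ω : Type*} [MeasurableSpace Ω] {P : Measure Ω} [IsProbabilityMeasure P]
  {E : Type*} [NormedAddCommGroup E] [InnerProductSpace ℝ E] [CompleteSpace E]
  [MeasurableSpace E] [BorelSpace E] [SecondCountableTopology E]
  {U D : ℕ → Ω → E} {Z : ℕ → Ω → ℝ} {K : ℝ → ℝ} {h r : ℕ → ℝ}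

/-- The second moment `n² h` is compared with the squared threshold `(r² n² h)²`; the ratio is `(r²
n √h)⁻²`. The condition `n h ≥ 1` absorbs `K 0` into `n h`. -/
theorem tendsto_measure_UU (hs : CenteredSample P U D Z) (hK : SymmKernel K)
    (hh : ∀ n, 0 < h n) (hnh : ∀ᶠ n : ℕ in atTop, 1 ≤ (n : ℝ) * h n)
    {κ : ℝ} (hκ : 0 < κ) (hr : ∀ᶠ n in atTop, r n ≠ 0)
    (hrate : Tendsto (fun n : ℕ => r n ^ 2 * n * Real.sqrt (h n)) atTop atTop) :
    Tendsto (fun n : ℕ => P {ω | (κ * r n ^ 2 * n ^ 2 * h n) ^ 2 ≤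
      (∑ ij ∈ (Finset.range n).offDiag,
        inner ℝ (U ij.1 ω) (U ij.2 ω) * weight K (h n) n Z ω ij.1 ij.2) ^ 2}) atTop (𝓝 0) := by
  set M := ∫ ω, ‖U 0 ω‖ ^ 4 ∂P with hM
  have hM0 : 0 ≤ M := integral_nonneg fun ω => by positivity
  have hK0 := hK.nonneg 0
  set c := 8 * K 0 * (K 0 + 1) * M / κ ^ 2 with hc
  refine tendsto_measure_ge_zero (fun n ω => sq_nonneg _)
    (fun n => (hs.memLp_sum_UU hK (h n) n).integrable_sq)
    (ρ := fun n : ℕ => c * ((r n ^ 2 * n * Real.sqrt (h n)) ^ 2)⁻¹) ?_ ?_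
  · filter_upwards [hr, hnh, eventually_ge_atTop 1] with n hrn hn hn1
    have hhn := hh n
    have hn0 : (0 : ℝ) < n := by exact_mod_cast hn1
    refine ⟨by positivity, (hs.integral_sq_sum_UU_le hK hhn n).trans ?_⟩
    have h1 : K 0 + n * h n ≤ (K 0 + 1) * (n * h n) := by nlinarith
    calc 8 * K 0 * (K 0 + n * h n) * n * M ≤ 8 * K 0 * ((K 0 + 1) * (n * h n)) * n * M := by gcongr
      _ = _ := by
        rw [hc, mul_pow, Real.sq_sqrt hhn.le]
        field_simp
  · have := (tendsto_inv_atTop_zero.comp ((tendsto_pow_atTop two_ne_zero).comp hrate)).const_mul c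
    simpa using this

/-- The threshold carries `r` rather than `r²` because this sum is multiplied by `2 r` in the
expansion. The ratio of `n³ h²` to `(r n² h)²` is `(r² n)⁻¹`. -/
theorem tendsto_measure_UD (hs : CenteredSample P U D Z) (hK : SymmKernel K)
    (hh : ∀ n, 0 < h n) (hnh : ∀ᶠ n : ℕ in atTop, 1 ≤ (n : ℝ) * h n)
    {κ : ℝ} (hκ : 0 < κ) (hr : ∀ᶠ n in atTop, r n ≠ 0)
    (hrate : Tendsto (fun n : ℕ => r n ^ 2 * n) atTop atTop) :
    Tendsto (fun n : ℕ => P {ω | (κ * r n * n ^ 2 * h n) ^ 2 ≤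
      (∑ ij ∈ (Finset.range n).offDiag,
        inner ℝ (U ij.1 ω) (D ij.2 ω) * weight K (h n) n Z ω ij.1 ij.2) ^ 2}) atTop (𝓝 0) := by
  set M := ∫ ω, ‖U 0 ω‖ ^ 4 ∂P + ∫ ω, ‖D 0 ω‖ ^ 4 ∂P with hM
  have hM0 : 0 ≤ M :=
    add_nonneg (integral_nonneg fun ω => by positivity) (integral_nonneg fun ω => by positivity)
  have hK0 := hK.nonneg 0
  set c := 2 * (K 0 + 1) ^ 2 * M / κ ^ 2 with hc
  refine tendsto_measure_ge_zero (fun n ω => sq_nonneg _)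
    (fun n => (hs.memLp_sum_UD hK (h n) n).integrable_sq)
    (ρ := fun n : ℕ => c * (r n ^ 2 * n)⁻¹) ?_ ?_
  · filter_upwards [hr, hnh, eventually_ge_atTop 1] with n hrn hn hn1
    have hhn := hh n
    have hn0 : (0 : ℝ) < n := by exact_mod_cast hn1
    refine ⟨by positivity, (hs.integral_sq_sum_UD_le hK hhn n).trans ?_⟩
    have h1 : K 0 + n * h n ≤ (K 0 + 1) * (n * h n) := by nlinarith
    calc 2 * (K 0 + n * h n) ^ 2 * n * M ≤ 2 * ((K 0 + 1) * (n * h n)) ^ 2 * n * M := by gcongr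
      _ = _ := by
        rw [hc]
        field_simp
  · have := (tendsto_inv_atTop_zero.comp hrate).const_mul c
    simpa using this

/-- The price of replacing the ranks is `n² / (h √n)`, to be compared with `n² h`: the ratio is `(n
h⁴)^(-1/2)`. -/
theorem tendsto_measure_DD_sub (hs : CenteredSample P U D Z) (hK : SymmKernel K)
    (hh : ∀ n, 0 < h n) {κ : ℝ} (hκ : 0 < κ) {L : ℝ} (hL : 0 ≤ L)
    (hlip : ∀ u v : ℝ, |K u - K v| ≤ L * |u - v|)
    (hrate : Tendsto (fun n : ℕ => (n : ℝ) * h n ^ 4) atTop atTop) :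
    Tendsto (fun n : ℕ => P {ω | κ * n ^ 2 * h n ≤
      |(∑ ij ∈ (Finset.range n).offDiag,
        inner ℝ (D ij.1 ω) (D ij.2 ω) * weight K (h n) n Z ω ij.1 ij.2) -
      ∑ ij ∈ (Finset.range n).offDiag,
        inner ℝ (D ij.1 ω) (D ij.2 ω) * cdfWeight K (h n) P Z ω ij.1 ij.2|}) atTop (𝓝 0) := by
  set M := ∫ ω, ‖D 0 ω‖ ^ 4 ∂P + 3 with hM
  set c := L * M / κ with hc
  refine tendsto_measure_ge_zero (fun n ω => abs_nonneg _) (fun n => ?_)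
    (ρ := fun n : ℕ => c * (Real.sqrt (n * h n ^ 4))⁻¹) ?_ ?_
  · exact ((integrable_finsetSum _ fun ij _ =>
      (hs.memLp_DD_rank hK (h n) n ij.1 ij.2).integrable one_le_two).sub
      (integrable_finsetSum _ fun ij _ =>
        (hs.memLp_DD hK (h n) ij.1 ij.2).integrable one_le_two)).abs
  · filter_upwards [eventually_ge_atTop 1] with n hn1
    have hhn := hh n
    have hn0 : (0 : ℝ) < n := by exact_mod_cast hn1
    refine ⟨by positivity, (hs.integral_abs_sum_DD_sub_le hL hlip hhn (by omega)).trans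
      (le_of_eq ?_)⟩
    have h1 : Real.sqrt (n * h n ^ 4) = Real.sqrt n * h n ^ 2 := by
      rw [Real.sqrt_mul hn0.le, show h n ^ 4 = (h n ^ 2) ^ 2 by ring,
        Real.sqrt_sq (by positivity)]
    have h2 : 0 < Real.sqrt n := Real.sqrt_pos.2 hn0
    rw [h1, hc, hM]
    field_simp
  · have := (tendsto_inv_atTop_zero.comp (Real.tendsto_sqrt_atTop.comp hrate)).const_mul c
    simpa using this

/-- The variance `n³` against `(n² h)²` leaves `(n h²)⁻¹`. -/
theorem tendsto_measure_DD_sub_mean (hs : CenteredSample P U D Z) (hK : SymmKernel K)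
    (hh : ∀ n, 0 < h n) {κ : ℝ} (hκ : 0 < κ)
    (hrate : Tendsto (fun n : ℕ => (n : ℝ) * h n ^ 2) atTop atTop) :
    Tendsto (fun n : ℕ => P {ω | (κ * n ^ 2 * h n) ^ 2 ≤
      (∑ ij ∈ (Finset.range n).offDiag,
        (inner ℝ (D ij.1 ω) (D ij.2 ω) * cdfWeight K (h n) P Z ω ij.1 ij.2 -
          meanDD K (h n) P D Z)) ^ 2}) atTop (𝓝 0) := by
  set M := K 0 ^ 2 * ∫ ω, ‖D 0 ω‖ ^ 4 ∂P with hM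
  set c := 4 * M / κ ^ 2 with hc
  refine tendsto_measure_ge_zero (fun n ω => sq_nonneg _) (fun n => ?_)
    (ρ := fun n : ℕ => c * (n * h n ^ 2)⁻¹) ?_ ?_
  · exact (memLp_finsetSum _ fun ij _ =>
      (hs.memLp_DD hK (h n) ij.1 ij.2).sub (memLp_const _)).integrable_sq
  · filter_upwards [eventually_ge_atTop 1] with n hn1
    have hhn := hh n
    have hn0 : (0 : ℝ) < n := by exact_mod_cast hn1
    refine ⟨by positivity, (hs.integral_sq_sum_DD_sub_mean_le hK (h n) n).trans (le_of_eq ?_)⟩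
    rw [hc, hM]
    field_simp
  · have := (tendsto_inv_atTop_zero.comp hrate).const_mul c
    simpa using this

/-- For `|r n| ≤ 1` the variance estimate has a mean bounded by a constant, so it stays below any
threshold tending to infinity with probability tending to one. -/
theorem tendsto_measure_Vsum (hs : CenteredSample P U D Z) (hK : SymmKernel K)
    (hh : ∀ n, 0 < h n) (hnh : ∀ᶠ n : ℕ in atTop, 1 ≤ (n : ℝ) * h n)
    {L : ℕ → ℝ} (hL : Tendsto L atTop atTop)
    (hr1 : ∀ᶠ n in atTop, |r n| ≤ 1) :
    Tendsto (fun n : ℕ => P {ω | L n ≤ |Vsum K (h n) n (r n) U D Z ω|}) atTop (𝓝 0) := by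
  have hMU : 0 ≤ ∫ ω, ‖U 0 ω‖ ^ 4 ∂P := integral_nonneg fun ω => by positivity
  have hMD : 0 ≤ ∫ ω, ‖D 0 ω‖ ^ 4 ∂P := integral_nonneg fun ω => by positivity
  set M := ∫ ω, ‖U 0 ω‖ ^ 4 ∂P + ∫ ω, ‖D 0 ω‖ ^ 4 ∂P with hM
  have hM0 : 0 ≤ M := add_nonneg hMU hMD
  have hK0 := hK.nonneg 0
  set c := 64 * K 0 * (K 0 + 1) * M with hc
  have hV : ∀ n, Integrable (Vsum K (h n) n (r n) U D Z) P := fun n =>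
    (hs.integral_sum_sq_le hK (hh n) n (r n)).1.const_mul _
  refine tendsto_measure_ge_zero (fun n ω => abs_nonneg _) (fun n => (hV n).abs)
    (ρ := fun n : ℕ => c * (L n)⁻¹) ?_ ?_
  · filter_upwards [hr1, hnh, eventually_ge_atTop 2, hL.eventually_gt_atTop 0]
      with n hrn hn hn2 hLn
    have hhn := hh n
    have hn2' : (2 : ℝ) ≤ n := by exact_mod_cast hn2
    have hn0 : (0 : ℝ) < n := by linarith
    have hn1 : (0 : ℝ) < (n : ℝ) - 1 := by linarith
    refine ⟨hLn, ?_⟩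
    have habs : ∀ ω, |Vsum K (h n) n (r n) U D Z ω| = Vsum K (h n) n (r n) U D Z ω := fun ω =>
      abs_of_nonneg (Vsum_nonneg hhn (by omega) _ _)
    simp_rw [habs, Vsum]
    rw [integral_const_mul, mul_assoc c, inv_mul_cancel₀ hLn.ne', mul_one]
    have hr4 : r n ^ 4 ≤ 1 := by
      rw [← Even.pow_abs (by decide : Even 4)]
      exact pow_le_one₀ (abs_nonneg _) hrn
    have h1 : K 0 + n * h n ≤ (K 0 + 1) * (n * h n) := by nlinarith
    have h3 : ∫ ω, ‖U 0 ω‖ ^ 4 ∂P + r n ^ 4 * ∫ ω, ‖D 0 ω‖ ^ 4 ∂P ≤ M := by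
      rw [hM]; gcongr; exact mul_le_of_le_one_left hMD hr4
    have h4 : 2 / ((n : ℝ) * ((n : ℝ) - 1) * h n) ≤ 4 / ((n : ℝ) ^ 2 * h n) := by
      rw [div_le_div_iff₀ (by positivity) (by positivity)]
      have : (n : ℝ) ^ 2 ≤ 2 * ((n : ℝ) * (n - 1)) := by nlinarith
      nlinarith
    calc _ ≤ 4 / ((n : ℝ) ^ 2 * h n) * (16 * K 0 * ((K 0 + 1) * (n * h n)) * n * M) := by
          refine mul_le_mul h4 ((hs.integral_sum_sq_le hK hhn n (r n)).2.trans ?_)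
            (integral_nonneg fun ω => Finset.sum_nonneg fun ij _ => by positivity) (by positivity)
          have h5 : 0 ≤ ∫ ω, ‖U 0 ω‖ ^ 4 ∂P + r n ^ 4 * ∫ ω, ‖D 0 ω‖ ^ 4 ∂P := by positivity
          gcongr
      _ = c := by
          rw [hc]; field_simp; ring
  · have := (tendsto_inv_atTop_zero.comp hL).const_mul c
    simpa using this

end CenteredSample

/-! ### The standardized statistic in a fixed direction. -/

namespace CenteredSample

variable {Ω : Type*} [MeasurableSpace Ω] {P : Measure Ω} [IsProbabilityMeasure P]
  {E : Type*} [NormedAddCommGroup E] [InnerProductSpace ℝ E] [CompleteSpace E]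
  [MeasurableSpace E] [BorelSpace E] [SecondCountableTopology E]
  {U D : ℕ → Ω → E} {Z : ℕ → Ω → ℝ} {K : ℝ → ℝ} {h r α : ℕ → ℝ}

/-- The standardized statistic in a fixed direction dominates the penalty. -/
theorem tendsto_measure_stat_lt (hs : CenteredSample P U D Z) (hK : SymmKernel K)
    (hlip : ∃ L : ℝ, ∀ u v : ℝ, |K u - K v| ≤ L * |u - v|) (hh : ∀ n, 0 < h n)
    (hh0 : Tendsto h atTop (𝓝 0)) (hnh2 : Tendsto (fun n : ℕ => (n : ℝ) * h n ^ 2) atTop atTop)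
    (hnh4 : Tendsto (fun n : ℕ => (n : ℝ) * h n ^ 4) atTop atTop) (hα : Tendsto α atTop atTop)
    (hr1 : ∀ᶠ n in atTop, |r n| ≤ 1)
    (hrate : Tendsto (fun n : ℕ => r n ^ 2 * n * Real.sqrt (h n) / α n) atTop atTop)
    (hne : ¬ (P[D 0 | sigmaGen (Z 0)] =ᵐ[P] 0)) (C : ℝ) :
    Tendsto (fun n : ℕ => P {ω | (n : ℝ) * Real.sqrt (h n) * Qsum K (h n) n (r n) U D Z ω /
      Real.sqrt (Vsum K (h n) n (r n) U D Z ω) < C + α n}) atTop (𝓝 0) := by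
  obtain ⟨L, hlip⟩ := hlip
  have hL : 0 ≤ L := by
    have := (abs_nonneg _).trans (hlip 1 0)
    simpa using this
  obtain ⟨ψ, hψ⟩ := exists_isRegression P D Z
  have hc0 := hs.integral_sq_regression_pos hψ hne
  -- In units of `κ n² h`, the limit is `16`. The mean is eventually above `14`, hence above `7`
  -- since `n (n - 1) ≥ n² / 2`; the fluctuation and the replacement of ranks cost `1` each and
  -- leave `5`; the `UU` and `UD` sums cost `1` each relative to `r²` and leave `3`.
  set κ := (∫ ω, ‖ψ (Z 0 ω)‖ ^ 2 ∂P) / 16 with hκdef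
  have hκ : 0 < κ := by positivity
  have hmean : ∀ᶠ n in atTop, 14 * κ < 1 / h n * meanDD K (h n) P D Z :=
    (hs.tendsto_meanDD hK hψ hh hh0).eventually (lt_mem_nhds (by rw [hκdef]; linarith))
  have hle1 : ∀ᶠ n in atTop, h n < 1 := hh0.eventually (gt_mem_nhds one_pos)
  have hnh : ∀ᶠ n : ℕ in atTop, 1 ≤ (n : ℝ) * h n := by
    filter_upwards [hnh2.eventually_ge_atTop 1, hle1] with n h1 h2
    have h3 := hh n
    have : (n : ℝ) * h n ^ 2 ≤ n * h n := by
      rw [sq]; gcongr; exact mul_le_of_le_one_left h3.le h2.le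
    linarith
  have hwtop : Tendsto (fun n : ℕ => r n ^ 2 * n * Real.sqrt (h n)) atTop atTop := by
    refine tendsto_atTop_mono' _ ?_ hrate
    filter_upwards [hα.eventually_ge_atTop 1] with n h1
    exact div_le_self (by positivity) h1
  have hrn : Tendsto (fun n : ℕ => r n ^ 2 * n) atTop atTop := by
    refine tendsto_atTop_mono' _ ?_ hwtop
    filter_upwards [hle1] with n h1
    exact mul_le_of_le_one_right (by positivity) (Real.sqrt_le_one.2 h1.le)
  have hr0 : ∀ᶠ n in atTop, r n ≠ 0 := by
    filter_upwards [hrn.eventually_gt_atTop 0] with n h1 h2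
    simp [h2] at h1
  have t1 := hs.tendsto_measure_UU hK hh hnh hκ hr0 hwtop
  have t2 := hs.tendsto_measure_UD hK hh hnh (half_pos hκ) hr0 hrn
  have t3 := hs.tendsto_measure_DD_sub hK hh hκ hL hlip hnh4
  have t4 := hs.tendsto_measure_DD_sub_mean hK hh hκ hnh2
  -- The bound on the variance estimate is the diverging rate `l = r² n √h / α` itself: only `√l` is
  -- lost in the denominator, while the numerator gains `l`.
  have t5 := hs.tendsto_measure_Vsum hK hh hnh hrate hr1
  have tsum := (((t1.add t2).add t3).add t4).add t5
  simp only [add_zero] at tsum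
  refine tendsto_of_tendsto_of_tendsto_of_le_of_le' tendsto_const_nhds tsum
    (Eventually.of_forall fun n => zero_le) ?_
  have hsq : ∀ᶠ n : ℕ in atTop, 2 / (3 * κ) ≤
      Real.sqrt (r n ^ 2 * n * Real.sqrt (h n) / α n) :=
    (Real.tendsto_sqrt_atTop.comp hrate).eventually_ge_atTop _
  filter_upwards [hmean, hr0, hsq, hα.eventually_ge_atTop (max C 1), hrate.eventually_gt_atTop 0,
    eventually_ge_atTop 2] with n hm hrne hsqn hαn hLn hn2
  refine le_trans (measure_mono ?_) ((measure_union_le _ _).trans (add_le_add_left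
    ((measure_union_le _ _).trans (add_le_add_left ((measure_union_le _ _).trans (add_le_add_left
      (measure_union_le _ _) _)) _)) _))
  intro ω hω
  by_contra hgood
  simp only [mem_union, mem_ofPred_eq, not_or, not_le] at hgood
  obtain ⟨⟨⟨⟨g1, g2⟩, g3⟩, g4⟩, g5⟩ := hgood
  have hhn := hh n
  have hn2' : (2 : ℝ) ≤ n := by exact_mod_cast hn2
  set y : ℝ := (n : ℝ) ^ 2 * h n with hy
  have hy0 : 0 < y := by positivity
  have hr2 : 0 < r n ^ 2 := by positivity
  set S00 := ∑ ij ∈ (Finset.range n).offDiag,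
    inner ℝ (U ij.1 ω) (U ij.2 ω) * weight K (h n) n Z ω ij.1 ij.2
  set S0D := ∑ ij ∈ (Finset.range n).offDiag,
    inner ℝ (U ij.1 ω) (D ij.2 ω) * weight K (h n) n Z ω ij.1 ij.2
  set SDD := ∑ ij ∈ (Finset.range n).offDiag,
    inner ℝ (D ij.1 ω) (D ij.2 ω) * weight K (h n) n Z ω ij.1 ij.2
  set SV := ∑ ij ∈ (Finset.range n).offDiag,
    inner ℝ (D ij.1 ω) (D ij.2 ω) * cdfWeight K (h n) P Z ω ij.1 ij.2
  set m := meanDD K (h n) P D Z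
  set N : ℝ := (n : ℝ) * ((n : ℝ) - 1) with hN
  have hN0 : 0 < N := mul_pos (by linarith) (by linarith)
  have hN1 : (n : ℝ) ^ 2 ≤ 2 * N := by rw [hN]; nlinarith
  have hN2 : N ≤ (n : ℝ) ^ 2 := by rw [hN]; nlinarith
  have e1 : -(κ * r n ^ 2 * y) < S00 := by
    have := abs_lt_of_sq_lt_sq g1 (by positivity)
    have := (abs_lt.1 this).1
    calc _ = -(κ * r n ^ 2 * n ^ 2 * h n) := by rw [hy]; ring
      _ < _ := this
  have e2 : -(κ * r n ^ 2 * y) ≤ 2 * r n * S0D := by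
    have h1 : |S0D| < κ / 2 * |r n| * y := by
      refine abs_lt_of_sq_lt_sq (g2.trans_le (le_of_eq ?_)) (by positivity)
      rw [hy, mul_pow, mul_pow, mul_pow, mul_pow (κ / 2 * |r n|), mul_pow (κ / 2), sq_abs]
      ring
    have h2 : |2 * r n * S0D| ≤ κ * r n ^ 2 * y := by
      rw [abs_mul, abs_mul, abs_two]
      calc 2 * |r n| * |S0D| ≤ 2 * |r n| * (κ / 2 * |r n| * y) := by gcongr
        _ = κ * |r n| ^ 2 * y := by ring
        _ = _ := by rw [sq_abs]
    exact (abs_le.1 h2).1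
  have e3 : SV - κ * y ≤ SDD := by
    have := (abs_lt.1 g3).1
    have h1 : κ * (n : ℝ) ^ 2 * h n = κ * y := by rw [hy]; ring
    linarith
  have e4 : N * m - κ * y ≤ SV := by
    have h0 := abs_lt_of_sq_lt_sq g4 (by positivity)
    have h1 : κ * (n : ℝ) ^ 2 * h n = κ * y := by rw [hy]; ring
    have hcard : (((Finset.range n).offDiag.card : ℕ) : ℝ) = N := by
      rw [Finset.offDiag_card, Finset.card_range, Nat.cast_sub (Nat.le_mul_self n), hN]
      push_cast; ring
    rw [Finset.sum_sub_distrib, Finset.sum_const, nsmul_eq_mul, hcard] at h0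
    have := (abs_lt.1 h0).1
    linarith
  have e5 : 7 * κ * y ≤ N * m := by
    have h1 : 14 * κ * h n ≤ m := by
      rw [one_div, inv_mul_eq_div, lt_div_iff₀ hhn] at hm
      exact hm.le
    calc 7 * κ * y = (n : ℝ) ^ 2 / 2 * (14 * κ * h n) := by rw [hy]; ring
      _ ≤ N * m := mul_le_mul (by linarith) h1 (by positivity) hN0.le
  have hS : 3 * κ * r n ^ 2 * y ≤ ∑ ij ∈ (Finset.range n).offDiag,
      inner ℝ (U ij.1 ω + r n • D ij.1 ω) (U ij.2 ω + r n • D ij.2 ω) *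
        weight K (h n) n Z ω ij.1 ij.2 := by
    rw [sum_inner_expand hK]
    have h1 : 5 * κ * y ≤ SDD := by linarith
    have h2 : r n ^ 2 * (5 * κ * y) ≤ r n ^ 2 * SDD := mul_le_mul_of_nonneg_left h1 hr2.le
    change _ ≤ S00 + 2 * r n * S0D + r n ^ 2 * SDD
    linarith
  have hQ : 3 * κ * r n ^ 2 ≤ Qsum K (h n) n (r n) U D Z ω := by
    rw [Qsum_eq, ← hN]
    calc 3 * κ * r n ^ 2 = 1 / N * (1 / h n) * (3 * κ * r n ^ 2 * (N * h n)) := by field_simp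
      _ ≤ 1 / N * (1 / h n) * (3 * κ * r n ^ 2 * y) := by rw [hy]; gcongr
      _ ≤ _ := mul_le_mul_of_nonneg_left hS (by positivity)
  have hQ0 : 0 < Qsum K (h n) n (r n) U D Z ω := lt_of_lt_of_le (by positivity) hQ
  have hV0 := Vsum_pos_of_Qsum_pos hhn hn2 hQ0
  set V := Vsum K (h n) n (r n) U D Z ω
  set Q := Qsum K (h n) n (r n) U D Z ω
  set l := r n ^ 2 * n * Real.sqrt (h n) / α n with hl
  have hα0 : 0 < α n := lt_of_lt_of_le one_pos ((le_max_right C 1).trans hαn)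
  have hCα : C ≤ α n := (le_max_left C 1).trans hαn
  have hlα : r n ^ 2 * n * Real.sqrt (h n) = l * α n := by rw [hl]; field_simp
  have hVl : Real.sqrt V ≤ Real.sqrt l := Real.sqrt_le_sqrt ((le_abs_self V).trans g5.le)
  have hsV : 0 < Real.sqrt V := Real.sqrt_pos.2 hV0
  have hsl : 0 < Real.sqrt l := Real.sqrt_pos.2 hLn
  -- The numerator is at least `3 κ l α` and the denominator at most `√l`, so the quotient is at
  -- least `3 κ √l α`. By the choice of the threshold `2 / (3 κ)` for `√l` this is at least `2 α`,
  -- and `C ≤ α`.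
  have hfinal : C + α n ≤ (n : ℝ) * Real.sqrt (h n) * Q / Real.sqrt V := by
    calc C + α n ≤ 2 * α n := by linarith
      _ = 3 * κ * (2 / (3 * κ)) * α n := by field_simp
      _ ≤ 3 * κ * Real.sqrt l * α n := by gcongr
      _ = 3 * κ * (l * α n) / Real.sqrt l := by
          rw [eq_div_iff hsl.ne']
          calc _ = 3 * κ * (Real.sqrt l * Real.sqrt l) * α n := by ring
            _ = _ := by rw [Real.mul_self_sqrt hLn.le]; ring
      _ = (n : ℝ) * Real.sqrt (h n) * (3 * κ * r n ^ 2) / Real.sqrt l := by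
          rw [← hlα]; ring
      _ ≤ (n : ℝ) * Real.sqrt (h n) * Q / Real.sqrt l := by gcongr
      _ ≤ (n : ℝ) * Real.sqrt (h n) * Q / Real.sqrt V := by gcongr
  exact absurd hω (not_lt.2 hfinal)

end CenteredSample

/-! ### Return to the functional data and conclusion. -/

instance secondCountableTopology_L2 : SecondCountableTopology L2 :=
  haveI : Fact ((2 : ℝ≥0∞) ≠ ∞) := ⟨ENNReal.ofNat_ne_top⟩
  inferInstance

/-- The added coordinates contribute zero terms. Hence the statistic in the detecting direction does
not change when that direction is viewed in dimension `p n`. -/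
theorem toL2_zeroPad (ρ : HilbertBasis ℕ ℝ L2) {p q : ℕ} (hpq : p ≤ q)
    (γ : EuclideanSpace ℝ (Fin p)) : toL2 ρ (zeroPad q γ) = toL2 ρ γ := by
  set f : ℕ → L2 := fun k => if hk : k < p then γ ⟨k, hk⟩ • ρ k else 0 with hf
  have h1 : toL2 ρ (zeroPad q γ) = ∑ j : Fin q, f j := by
    refine Finset.sum_congr rfl fun j _ => ?_
    by_cases hj : (j : ℕ) < p <;> simp [hf, zeroPad, hj]
  have h2 : toL2 ρ γ = ∑ j : Fin p, f j :=
    Finset.sum_congr rfl fun j _ => by simp [hf]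
  rw [h1, h2, Fin.sum_univ_eq_sum_range, Fin.sum_univ_eq_sum_range]
  refine (Finset.sum_subset (Finset.range_mono hpq) fun k _ hk => ?_).symm
  simp only [hf]
  rw [dif_neg (by simpa using hk)]

/-- Both `D` and `Z` are functions of `X`, so the centering given `X` passes to `(D, Z)` by the
tower property; the fourth moment of the errors comes from the eighth. -/
theorem centeredSample_of_dataAssumption {Ω : Type*} [MeasurableSpace Ω] {P : Measure Ω}
    [IsProbabilityMeasure P] {ρ : HilbertBasis ℕ ℝ L2} {γ₀ : L2}
    {B : ∀ p : ℕ, Set (EuclideanSpace ℝ (Fin p))} {U X : ℕ → Ω → L2} {δ : L2 → L2}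
    (hdata : DataAssumption P U X ρ γ₀ B) (hU : P[U 0 | sigmaGen (X 0)] =ᵐ[P] 0)
    (hδm : Measurable δ) (hδ : Integrable (fun ω => ‖δ (X 0 ω)‖ ^ 4) P) {g : L2}
    (hg : Continuous (projCdf P (X 0) g)) :
    CenteredSample P U (fun i ω => δ (X i ω)) (fun i ω => inner ℝ (X i ω) g) := by
  have hmap : Measurable fun q : L2 × L2 => (q.1, δ q.2, (inner ℝ q.2 g : ℝ)) :=
    measurable_fst.prodMk ((hδm.comp measurable_snd).prodMk
      (measurable_snd.inner measurable_const))
  have hZ : ∀ i, Measurable fun ω => (inner ℝ (X i ω) g : ℝ) := fun i =>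
    (hdata.measurable_X i).inner measurable_const
  refine
    { measurable_U := hdata.measurable_U
      measurable_D := fun i => hδm.comp (hdata.measurable_X i)
      measurable_Z := hZ
      indep := hdata.indep.comp (fun _ q => (q.1, δ q.2, (inner ℝ q.2 g : ℝ))) fun _ => hmap
      ident := fun i => (hdata.ident i).comp hmap
      moment_U := ?_
      moment_D := hδ
      centered := ?_
      continuous_cdf := ?_ }
  · refine ((integrable_const (1 : ℝ)).add hdata.moment).mono'
      ((hdata.measurable_U 0).norm.pow_const 4).aestronglyMeasurable (ae_of_all _ fun ω => ?_)
    rw [Real.norm_of_nonneg (by positivity), Pi.add_apply]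
    nlinarith [sq_nonneg (‖U 0 ω‖ ^ 4 - 1), sq_nonneg (‖U 0 ω‖ ^ 2)]
  · have hle : (sigmaGen fun ω => (δ (X 0 ω), (inner ℝ (X 0 ω) g : ℝ))) ≤ sigmaGen (X 0) := by
      refine Measurable.comap_le ?_
      have hm : Measurable fun x : L2 => (δ x, (inner ℝ x g : ℝ)) :=
        hδm.prodMk (measurable_id.inner measurable_const)
      exact hm.comp (comap_measurable (X 0))
    have h1 := condExp_condExp_of_le (μ := P) (f := U 0) hle (hdata.measurable_X 0).comap_le
    refine h1.symm.trans ((condExp_congr_ae hU).trans ?_)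
    rw [condExp_zero]
  · have : IsProbabilityMeasure (P.map fun ω => (inner ℝ (X 0 ω) g : ℝ)) :=
      Measure.isProbabilityMeasure_map (hZ 0).aemeasurable
    convert hg using 1
    ext t
    rw [cdf_eq_real, projCdf, map_measureReal_apply (hZ 0) measurableSet_Iic]
    rfl

theorem stdStat_eq {Ω : Type*} (K : ℝ → ℝ) (h : ℝ) (n : ℕ) (r : ℝ) (U X : ℕ → Ω → L2)
    (δ : L2 → L2) (g : L2) (ω : Ω) :
    stdStat K h n (fun i => U i ω + r • δ (X i ω)) (fun i => X i ω) g =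
      (n : ℝ) * Real.sqrt h *
        Qsum K h n r U (fun i ω => δ (X i ω)) (fun i ω => inner ℝ (X i ω) g) ω /
        Real.sqrt (Vsum K h n r U (fun i ω => δ (X i ω)) (fun i ω => inner ℝ (X i ω) g) ω) := rfl

/-- The statistic at the selected direction dominates the penalized statistic at any direction. -/
theorem IsLeastFavorable.le_stdStat {ρ : HilbertBasis ℕ ℝ L2} {γ₀ : L2} {α : ℝ} {K : ℝ → ℝ}
    {h : ℝ} {n : ℕ} {u x : ℕ → L2} {p : ℕ} {B : Set (EuclideanSpace ℝ (Fin p))}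
    {γ γ' : EuclideanSpace ℝ (Fin p)} (hγ : IsLeastFavorable ρ γ₀ α K h n u x B γ) (hα : 0 ≤ α)
    (hγ' : γ' ∈ B) :
    stdStat K h n u x (toL2 ρ γ') - α ≤ stdStat K h n u x (toL2 ρ γ) := by
  have h1 : criterion ρ γ₀ α K h n u x γ' ≤ criterion ρ γ₀ α K h n u x γ := hγ.2 hγ'
  rw [criterion, criterion] at h1
  have h2 : ({initialDir ρ γ₀ p}ᶜ : Set (EuclideanSpace ℝ (Fin p))).indicator (fun _ => α) γ' ≤ α :=
    indicator_le_self' (fun _ _ => hα) γ'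
  have h3 : 0 ≤ ({initialDir ρ γ₀ p}ᶜ : Set (EuclideanSpace ℝ (Fin p))).indicator (fun _ => α) γ :=
    indicator_nonneg (fun _ _ => hα) γ
  linarith

end FunctionalTest

open FunctionalTest in
theorem theorem2 {Ω : Type*} [MeasurableSpace Ω] (P : Measure Ω) [IsProbabilityMeasure P]
    (ρ : HilbertBasis ℕ ℝ L2) (γ₀ : L2) (B : ∀ p : ℕ, Set (EuclideanSpace ℝ (Fin p)))
    (U₀ X : ℕ → Ω → L2) (δ : L2 → L2)
    (K : ℝ → ℝ) (h α r : ℕ → ℝ) (p : ℕ → ℕ)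
    -- the data, with errors `U⁰`
    (hdata : DataAssumption P U₀ X ρ γ₀ B)
    (hU₀ : P[U₀ 0 | sigmaGen (X 0)] =ᵐ[P] 0)
    -- kernel, bandwidth and dimension
    (hkernel : KernelAssumption K h p)
    (hh4 : Tendsto (fun n : ℕ => (n : ℝ) * h n ^ 4) atTop atTop)
    (hlip : ∃ C : ℝ, ∀ u v : ℝ, |K u - K v| ≤ C * |u - v|)
    -- rates
    (hα_pos : ∀ n, 0 < α n)
    (hα : Tendsto (fun n : ℕ => α n / ((p n : ℝ) * Real.log n)) atTop atTop)
    (hr : Tendsto r atTop (𝓝 0) ∨ ∀ n, r n = 1)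
    (hrate : Tendsto (fun n : ℕ => r n ^ 2 * (n : ℝ) * Real.sqrt (h n) / α n) atTop atTop)
    -- the direction of departure
    (hδ_meas : Measurable δ)
    (hδ_mean : ∫ ω, δ (X 0 ω) ∂P = 0)
    (hδ_int : Integrable (fun ω => ‖δ (X 0 ω)‖ ^ 4) P)
    (hδ_pos : 0 < ∫ ω, ‖δ (X 0 ω)‖ ^ 4 ∂P)
    -- a detecting direction
    (hdir : ∃ q : ℕ, 1 ≤ q ∧ ∃ γ ∈ B q,
      ¬ (P[fun ω => δ (X 0 ω) | sigmaGen fun ω => (inner ℝ (X 0 ω) (toL2 ρ γ) : ℝ)] =ᵐ[P] 0) ∧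
      ∃ d : ℝ → ℝ → ℝ,
        IsCondMeanFunction P (fun ω => δ (X 0 ω))
          (fun ω => projCdf P (X 0) (toL2 ρ γ) (inner ℝ (X 0 ω) (toL2 ρ γ))) d ∧
        ∀ t ∈ Icc (0 : ℝ) 1, Integrable (d t) ∧ Integrable (𝓕 fun v : ℝ => (d t v : ℂ)))
    -- the selected direction, computed from the responses `U_i = U⁰_i + r_n δ(X_i)`
    (γhat : ∀ n : ℕ, Ω → EuclideanSpace ℝ (Fin (p n)))
    (hγhat : ∀ᶠ n in atTop, ∀ᵐ ω ∂P,
      IsLeastFavorable ρ γ₀ (α n) K (h n) n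
        (fun i => U₀ i ω + r n • δ (X i ω)) (fun i => X i ω) (B (p n)) (γhat n ω)) :
    ∀ C : ℝ, Tendsto
      (fun n : ℕ => P {ω | C ≤ stdStat K (h n) n
        (fun i => U₀ i ω + r n • δ (X i ω)) (fun i => X i ω) (toL2 ρ (γhat n ω))})
      atTop (𝓝 1) := by
  obtain ⟨q, hq, γ, hγB, hne, -⟩ := hdir
  set g := toL2 ρ γ with hg
  have hγ1 : ‖γ‖ = 1 := by
    obtain ⟨O, -, hO⟩ := hdata.open_in_sphere q hq
    rw [hO] at hγB
    simpa using hγB.2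
  have hs : CenteredSample P U₀ (fun i ω => δ (X i ω)) (fun i ω => inner ℝ (X i ω) g) :=
    centeredSample_of_dataAssumption hdata hU₀ hδ_meas hδ_int (hdata.continuous_cdf q hq γ hγ1)
  have hK : SymmKernel K := ⟨hkernel.continuous, hkernel.nonneg, hkernel.integrable,
    hkernel.integral_eq_one, hkernel.symm, hkernel.antitone⟩
  have hα_top : Tendsto α atTop atTop := by
    refine tendsto_atTop_mono' _ ?_ hα
    have hlog : ∀ᶠ n : ℕ in atTop, 1 ≤ Real.log n :=
      (Real.tendsto_log_atTop.comp tendsto_natCast_atTop_atTop).eventually_ge_atTop 1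
    filter_upwards [hlog] with n hn
    have hp : (1 : ℝ) ≤ p n := by exact_mod_cast hkernel.one_le_p n
    exact div_le_self (hα_pos n).le (one_le_mul_of_one_le_of_one_le hp hn)
  have hr1 : ∀ᶠ n in atTop, |r n| ≤ 1 := by
    rcases hr with hr | hr
    · have := hr.abs
      rw [abs_zero] at this
      exact (this.eventually (gt_mem_nhds one_pos)).mono fun n hn => hn.le
    · exact Eventually.of_forall fun n => by simp [hr n]
  intro C
  have hbad := hs.tendsto_measure_stat_lt hK hlip hkernel.h_pos hkernel.h_tendsto hkernel.nh_sq hh4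
    hα_top hr1 hrate hne C
  have hlow := ENNReal.Tendsto.sub (tendsto_const_nhds (x := (1 : ℝ≥0∞))) hbad
    (Or.inl ENNReal.one_ne_top)
  rw [tsub_zero] at hlow
  refine tendsto_of_tendsto_of_tendsto_of_le_of_le' hlow tendsto_const_nhds ?_
    (Eventually.of_forall fun n => prob_le_one)
  filter_upwards [hγhat, hkernel.p_tendsto.eventually_gt_atTop q] with n hn hpq
  -- The selected direction is not assumed measurable in `ω`, so no complement is taken: almost all
  -- of the space is covered by the bad event and the event of interest, and subadditivity of the
  -- outer measure suffices.
  rw [tsub_le_iff_left, ← measure_univ (μ := P)]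
  refine (measure_mono_ae ?_).trans (measure_union_le _ _)
  filter_upwards [hn] with ω hω _
  by_cases hlt : C + α n ≤ stdStat K (h n) n (fun i => U₀ i ω + r n • δ (X i ω))
      (fun i => X i ω) g
  · right
    -- The maximizer is compared with the zero-padded detecting direction, at the cost of at most `α
    -- n`.
    have h1 := hω.le_stdStat (hα_pos n).le (hdata.nested q (p n) hq hpq γ hγB)
    rw [toL2_zeroPad ρ hpq.le γ, ← hg] at h1
    change C ≤ _
    linarith
  · left
    rw [stdStat_eq] at hlt
    exact not_le.1 hlt
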